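/- Let $a_1,b_1,a_2,b_2,a_3,b_3\in\mathbb{R}$ and $v_1,v_2,v_3>0$. The Gaussian two-way wiretap channel maps the inputs $X_1,X_2\in\mathbb{R}$ of Users 1 and 2 to $$Y_1=a_1X_1+b_1X_2+N_1,\qquad Y_2=a_2X_1+b_2X_2+N_2,\qquad Z=a_3X_1+b_3X_2+N_3,$$ where $Y_i$ is observed by User $i$ and $Z$ by the eavesdropper, and $N_i$ is Gaussian with mean $0$ and variance $v_i$. The joint law of $(N_1,N_2,N_3)$ is fixed but otherwise arbitrary (for example, a product law). The noise triples of different channel uses are i.i.d. and independent of messages and inputs. A non-adaptive code of length $n$ consists of message sets $\mathcal{M}_1,\mathcal{M}_2$ (finite, non-empty), stochastic encoders which choose the input block $X_i^n\in\mathbb{R}^n$ at random depending only on $M_i\in\mathcal{M}_i$, and decoders by which User $1$ estimates $M_2$ from $(X_1^n,Y_1^n)$ and User $2$ estimates $M_1$ from $(X_2^n,Y_2^n)$. The messages $M_1,M_2$ are independent and uniformly distributed, the two encoders use independent randomness, and the rates are $R_{i,n}=\frac1n\log|\mathcal{M}_i|$. Logarithms are natural and $I(\cdot\,;\cdot)$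 denotes mutual information. The code satisfies the peak power constraint with $c_1,c_2\in\mathbb{R}$ if $\frac1n\sum_{j=1}^n X_{i,j}^2\le c_i$ almost surely, for each message and for $i=1,2$. Let $\mathcal{C}_{J}^{c_1,c_2}$ (resp. $\mathcal{C}_{I}^{c_1,c_2}$) be the set of pairs $(R_1,R_2)$ for which there is a sequence of such codes, of lengths $n=1,2,\dots$, all satisfying the peak power constraint with $c_1,c_2$, such that $R_{i,n}\to R_i$ for $i=1,2$, the probability (averaged over the messages) that at least one user decodes wrongly tends to $0$, and $I(M_1,M_2;Z^n)\to0$ (strong joint secrecy) (resp. $I(M_1;Z^n)\to0$ and $I(M_2;Z^n)\to0$, strong individual secrecy). For $p_1,p_2\ge0$ put $$\beta_1=\tfrac12\big(\log(a_2^2p_1+v_2)-\log v_2-\log(a_3^2p_1+b_3^2p_2+v_3)+\log(b_3^2p_2+v_3)\big),$$ $$\beta_2=\tfrac12\big(\log(b_1^2p_2+v_1)-\log v_1-\log(a_3^2p_1+b_3^2p_2+v_3)+\log(a_3^2p_1+v_3)\big),$$ $$\beta_{12}=\tfrac12\big(\log(b_1^2p_2+v_1)+\log(a_2^2p_1+v_2)-\log(a_3^2p_1+b_3^2p_2+v_3)+\log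 v_3-\log v_1-\log v_2\big),$$ $$\mathcal{R}_J^{p_1,p_2}=\{(R_1,R_2)\in[0,\infty)^2: R_1\le\beta_1,\ R_2\le\beta_2,\ R_1+R_2\le\beta_{12}\},$$ $$\mathcal{R}_I^{p_1,p_2}=\{(R_1,R_2)\in[0,\infty)^2: R_1\le\beta_1,\ R_2\le\beta_2,\ \max(R_1,R_2)\le\beta_{12}\},$$ and for $K\in\{J,I\}$ let $\mathcal{A}_K^{c_1,c_2}$ be the closure of the convex hull of $\bigcup_{0\le p_1\le c_1,\,0\le p_2\le c_2}\mathcal{R}_K^{p_1,p_2}$. Theorem. For all $c_1,c_2\in\mathbb{R}$, $$\mathcal{A}_J^{c_1,c_2}\subset\mathcal{C}_J^{c_1,c_2}\qquad\text{and}\qquad\mathcal{A}_I^{c_1,c_2}\subset\mathcal{C}_I^{c_1,c_2}.$$ -/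

import Mathlib

open MeasureTheory ProbabilityTheory Filter Topology
open scoped NNReal ENNReal

noncomputable section

/-- The mutual information `I(X; Y)` (in nats) of two random variables on `(Ω, μ)`: the relative
entropy of their joint law with respect to the product of the marginal laws. -/
def mutualInfo {Ω α β : Type*} [MeasurableSpace Ω] [MeasurableSpace α] [MeasurableSpace β]
    (μ : Measure Ω) (X : Ω → α) (Y : Ω → β) : ℝ≥0∞ :=
  InformationTheory.klDiv (μ.map fun ω => (X ω, Y ω)) ((μ.map X).prod (μ.map Y))

/-- A Gaussian two-way wiretap channel
`Y₁ = a₁ X₁ + b₁ X₂ + N₁`, `Y₂ = a₂ X₁ + b₂ X₂ + N₂`, `Z = a₃ X₁ + b₃ X₂ + N₃`.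
The field `noise` is the joint law of `(N₁, N₂, N₃)` in one channel use; its marginals are centred
Gaussian with variances `v₁, v₂, v₃ > 0`. Independent noises are the special case of a product
law; no joint condition is imposed. -/
structure GaussianTWWC where
  (a₁ b₁ a₂ b₂ a₃ b₃ : ℝ)
  (v₁ v₂ v₃ : ℝ≥0)
  v₁_pos : 0 < v₁
  v₂_pos : 0 < v₂
  v₃_pos : 0 < v₃
  noise : Measure (ℝ × ℝ × ℝ)
  noise_fst : noise.map (fun t => t.1) = gaussianReal 0 v₁
  noise_snd : noise.map (fun t => t.2.1) = gaussianReal 0 v₂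
  noise_trd : noise.map (fun t => t.2.2) = gaussianReal 0 v₃

/-- A non-adaptive secrecy code of length `n`: message sets of sizes `M₁, M₂ ≥ 1`, stochastic
encoders `φ₁, φ₂` which choose the whole input block from the message alone, and decoders
`ψ₁, ψ₂` (of the second type) by which a user estimates the message of the other user from the
user's own input block and output block. -/
structure NonAdaptiveCode (n : ℕ) where
  M₁ : ℕ
  M₂ : ℕ
  M₁_pos : 0 < M₁
  M₂_pos : 0 < M₂
  φ₁ : Kernel (Fin M₁) (Fin n → ℝ)
  φ₂ : Kernel (Fin M₂) (Fin n → ℝ)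
  markov₁ : IsMarkovKernel φ₁
  markov₂ : IsMarkovKernel φ₂
  ψ₁ : (Fin n → ℝ) × (Fin n → ℝ) → Fin M₂
  ψ₂ : (Fin n → ℝ) × (Fin n → ℝ) → Fin M₁
  measurable_ψ₁ : Measurable ψ₁
  measurable_ψ₂ : Measurable ψ₂

namespace NonAdaptiveCode

variable {n : ℕ} (C : NonAdaptiveCode n)

/-- The rate `R₁` with `|M₁| = e ^ (n R₁)`. -/
def rate₁ : ℝ := Real.log C.M₁ / n

/-- The rate `R₂` with `|M₂| = e ^ (n R₂)`. -/
def rate₂ : ℝ := Real.log C.M₂ / n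

/-- The peak cost constraint for the cost function `x ↦ x ^ 2`: every input block that the
encoder of user `i` emits has average power at most `cᵢ`. -/
def PeakConstraint (c₁ c₂ : ℝ) : Prop :=
  (∀ m, ∀ᵐ x ∂(C.φ₁ m), (1 / (n : ℝ)) * ∑ j, x j ^ 2 ≤ c₁) ∧
    (∀ m, ∀ᵐ x ∂(C.φ₂ m), (1 / (n : ℝ)) * ∑ j, x j ^ 2 ≤ c₂)

/-- The sample space of one run of the code: `((m₁, x₁ⁿ), (m₂, x₂ⁿ), noise block)`. -/
abbrev Sample : Type :=
  (Fin C.M₁ × (Fin n → ℝ)) × (Fin C.M₂ × (Fin n → ℝ)) × (Fin n → ℝ × ℝ × ℝ)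

variable (G : GaussianTWWC)

/-- The law of one run of the code: the messages are uniform and independent, the input blocks are
drawn by the encoders, and the noise is i.i.d. over the channel uses (memoryless channel) and
independent of messages and inputs. -/
def law : Measure C.Sample :=
  ((uniformOn (Set.univ : Set (Fin C.M₁))) ⊗ₘ C.φ₁).prod
    (((uniformOn (Set.univ : Set (Fin C.M₂))) ⊗ₘ C.φ₂).prod
      (Measure.pi fun _ : Fin n => G.noise))

/-- The message of user 1. -/
def msg₁ (ω : C.Sample) : Fin C.M₁ := ω.1.1

/-- The message of user 2. -/
def msg₂ (ω : C.Sample) : Fin C.M₂ := ω.2.1.1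

/-- The input block of user 1. -/
def X₁ (ω : C.Sample) : Fin n → ℝ := ω.1.2

/-- The input block of user 2. -/
def X₂ (ω : C.Sample) : Fin n → ℝ := ω.2.1.2

/-- The output block of user 1. -/
def Y₁ (ω : C.Sample) : Fin n → ℝ :=
  fun j => G.a₁ * C.X₁ ω j + G.b₁ * C.X₂ ω j + (ω.2.2 j).1

/-- The output block of user 2. -/
def Y₂ (ω : C.Sample) : Fin n → ℝ :=
  fun j => G.a₂ * C.X₁ ω j + G.b₂ * C.X₂ ω j + (ω.2.2 j).2.1

/-- The output block of the eavesdropper. -/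
def Z (ω : C.Sample) : Fin n → ℝ :=
  fun j => G.a₃ * C.X₁ ω j + G.b₃ * C.X₂ ω j + (ω.2.2 j).2.2

/-- The probability of decoding error (some user fails), averaged over the messages. -/
def errorProb : ℝ≥0∞ :=
  C.law G {ω | C.ψ₁ (C.X₁ ω, C.Y₁ G ω) ≠ C.msg₂ ω ∨ C.ψ₂ (C.X₂ ω, C.Y₂ G ω) ≠ C.msg₁ ω}

/-- The joint leakage `I(M₁, M₂; Zⁿ)`. -/
def leakJoint : ℝ≥0∞ :=
  mutualInfo (C.law G) (fun ω => (C.msg₁ ω, C.msg₂ ω)) (C.Z G)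

/-- The individual leakage `I(M₁; Zⁿ)`. -/
def leak₁ : ℝ≥0∞ := mutualInfo (C.law G) C.msg₁ (C.Z G)

/-- The individual leakage `I(M₂; Zⁿ)`. -/
def leak₂ : ℝ≥0∞ := mutualInfo (C.law G) C.msg₂ (C.Z G)

end NonAdaptiveCode

namespace GaussianTWWC

variable (G : GaussianTWWC) (c₁ c₂ : ℝ)

/-- The rate pairs achievable under the strong joint secrecy constraint by non-adaptive codes with
second-type decoders and with peak cost constraint `c₁, c₂`. -/
def capacityJoint : Set (ℝ × ℝ) :=
  {R | ∃ C : ∀ n : ℕ, NonAdaptiveCode n,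
    (∀ n, (C n).PeakConstraint c₁ c₂) ∧
    Tendsto (fun n => (C n).rate₁) atTop (𝓝 R.1) ∧
    Tendsto (fun n => (C n).rate₂) atTop (𝓝 R.2) ∧
    Tendsto (fun n => (C n).errorProb G) atTop (𝓝 0) ∧
    Tendsto (fun n => (C n).leakJoint G) atTop (𝓝 0)}

/-- The rate pairs achievable under the strong individual secrecy constraint by non-adaptive codes
with second-type decoders and with peak cost constraint `c₁, c₂`. -/
def capacityIndividual : Set (ℝ × ℝ) :=
  {R | ∃ C : ∀ n : ℕ, NonAdaptiveCode n,
    (∀ n, (C n).PeakConstraint c₁ c₂) ∧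
    Tendsto (fun n => (C n).rate₁) atTop (𝓝 R.1) ∧
    Tendsto (fun n => (C n).rate₂) atTop (𝓝 R.2) ∧
    Tendsto (fun n => (C n).errorProb G) atTop (𝓝 0) ∧
    Tendsto (fun n => (C n).leak₁ G) atTop (𝓝 0) ∧
    Tendsto (fun n => (C n).leak₂ G) atTop (𝓝 0)}

/-- The bound on `R₁` for Gaussian inputs of powers `p₁, p₂`. -/
def bound₁ (p₁ p₂ : ℝ) : ℝ :=
  (1 / 2) * (Real.log (G.a₂ ^ 2 * p₁ + G.v₂) - Real.log G.v₂
    - Real.log (G.a₃ ^ 2 * p₁ + G.b₃ ^ 2 * p₂ + G.v₃) + Real.log (G.b₃ ^ 2 * p₂ + G.v₃))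

/-- The bound on `R₂` for Gaussian inputs of powers `p₁, p₂`. -/
def bound₂ (p₁ p₂ : ℝ) : ℝ :=
  (1 / 2) * (Real.log (G.b₁ ^ 2 * p₂ + G.v₁) - Real.log G.v₁
    - Real.log (G.a₃ ^ 2 * p₁ + G.b₃ ^ 2 * p₂ + G.v₃) + Real.log (G.a₃ ^ 2 * p₁ + G.v₃))

/-- The bound on `R₁ + R₂` (joint) or on `max R₁ R₂` (individual) for Gaussian inputs of powers
`p₁, p₂`. -/
def bound₁₂ (p₁ p₂ : ℝ) : ℝ :=
  (1 / 2) * (Real.log (G.b₁ ^ 2 * p₂ + G.v₁) + Real.log (G.a₂ ^ 2 * p₁ + G.v₂)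
    - Real.log (G.a₃ ^ 2 * p₁ + G.b₃ ^ 2 * p₂ + G.v₃)
    + Real.log G.v₃ - Real.log G.v₁ - Real.log G.v₂)

/-- The joint secrecy rate region for Gaussian inputs of powers `p₁, p₂`. -/
def regionJoint (p₁ p₂ : ℝ) : Set (ℝ × ℝ) :=
  {R | 0 ≤ R.1 ∧ 0 ≤ R.2 ∧ R.1 ≤ G.bound₁ p₁ p₂ ∧ R.2 ≤ G.bound₂ p₁ p₂ ∧
    R.1 + R.2 ≤ G.bound₁₂ p₁ p₂}

/-- The individual secrecy rate region for Gaussian inputs of powers `p₁, p₂`. -/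
def regionIndividual (p₁ p₂ : ℝ) : Set (ℝ × ℝ) :=
  {R | 0 ≤ R.1 ∧ 0 ≤ R.2 ∧ R.1 ≤ G.bound₁ p₁ p₂ ∧ R.2 ≤ G.bound₂ p₁ p₂ ∧
    max R.1 R.2 ≤ G.bound₁₂ p₁ p₂}

/-- The closed convex hull of the joint secrecy regions over all powers `0 ≤ pᵢ ≤ cᵢ`. -/
def innerJoint : Set (ℝ × ℝ) :=
  closure (convexHull ℝ (⋃ p₁ ∈ Set.Icc 0 c₁, ⋃ p₂ ∈ Set.Icc 0 c₂, G.regionJoint p₁ p₂))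

/-- The closed convex hull of the individual secrecy regions over all powers `0 ≤ pᵢ ≤ cᵢ`. -/
def innerIndividual : Set (ℝ × ℝ) :=
  closure (convexHull ℝ (⋃ p₁ ∈ Set.Icc 0 c₁, ⋃ p₂ ∈ Set.Icc 0 c₂, G.regionIndividual p₁ p₂))

end GaussianTWWC

end

/-! The proof is random coding with randomized codewords. User i has a codebook indexed by a message
(rate R_i) and a randomization index (rate r_i), with independent Gaussian letters. A receiver
subtracts its own signal, so decoding is a point-to-point problem, solvable when R_i + r_i < J_i,
where J_i is the Gaussian mutual information from user i to the other user
(`exists_threshold_decoder`, `lintegral_threshold_decoder_le`).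

Secrecy is channel resolvability. The leakage is at most the average relative entropy between the
eavesdropper's output law given the message and any fixed law Q (`mutualInfo_le_average_klFun`),
here the Gaussian law induced by the inputs. Write E, E_1, E_2 for the mutual informations
I(X_1,X_2;Z), I(X_1;Z), I(X_2;Z). For a fixed pair of messages the divergence vanishes if r_1 > E_1,
r_2 > E_2 and r_1 + r_2 > E. If only one message is fixed, the other user's entire codebook
randomizes, and r_1 + R_2 + r_2 > E, respectively R_1 + r_1 + r_2 > E, suffices instead of the sum
condition. Eliminating r_1 and r_2 gives the sum bound for joint secrecy and the bound on the
maximum for individual secrecy.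

The core estimate is `lintegral_klFun_resolvability_le`: a tangent line to the logarithm reduces the
expected relative entropy to second moments of the codebook, and then to moments of order s of three
information densities. For Gaussian letters `lintegral_gaussianRatio_rpow_le` bounds such a moment
by exp(s I + 2 s²), so for small s every excess of rate over information gives exponential decay in
the block length.

The peak constraint is met by conditioning the Gaussian blocks on admissible power. The conditioned
law is dominated by κ times the Gaussian law with κ → 1, which costs only a factor and a term log
κ². Convex combinations are realized by letting the powers follow a deterministic schedule over the
letters. The approachable rates form a closed set, so rates and powers may be shrunk slightly to
make all inequalities strict. A user of rate zero needs no decoding and is kept as a separate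
alternative throughout. -/

noncomputable section

/-! ### Second moments of random codebooks and relative entropy at a fixed output. -/

section Resolvability

open InformationTheory

variable {α β : Type*} [MeasurableSpace α] [MeasurableSpace β]

theorem lintegral_pi_eval {ι : Type*} [Fintype ι] (P : Measure α) [IsProbabilityMeasure P] (a : ι)
    {f : α → ℝ≥0∞} (hf : Measurable f) :
    ∫⁻ x, f (x a) ∂(Measure.pi fun _ : ι => P) = ∫⁻ u, f u ∂P :=
  (measurePreserving_eval (fun _ : ι => P) a).lintegral_comp hf

theorem lintegral_pi_eval_pair {ι : Type*} [Fintype ι] (P : Measure α) [IsProbabilityMeasure P]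
    {a b : ι} (hab : a ≠ b) {f : α × α → ℝ≥0∞} (hf : Measurable f) :
    ∫⁻ x, f (x a, x b) ∂(Measure.pi fun _ : ι => P) = ∫⁻ u, ∫⁻ v, f (u, v) ∂P ∂P := by
  have hind : IndepFun (fun x : ι → α => x a) (fun x => x b) (Measure.pi fun _ : ι => P) :=
    (iIndepFun_pi (μ := fun _ : ι => P) (X := fun _ => id) (fun _ => aemeasurable_id)).indepFun hab
  have h := (indepFun_iff_map_prod_eq_prod_map_map (measurable_pi_apply a).aemeasurable
    (measurable_pi_apply b).aemeasurable).1 hind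
  have hm (i : ι) : (Measure.pi fun _ : ι => P).map (fun x => x i) = P :=
    (measurePreserving_eval (fun _ : ι => P) i).map_eq
  rw [hm, hm] at h
  rw [← lintegral_map (g := fun x : ι → α => (x a, x b)) hf (by fun_prop), h,
    lintegral_prod _ hf.aemeasurable]

/-- The expectation, over an i.i.d. codebook, of the sum of `f (x a, x a')` over all `a'`. -/
theorem lintegral_pi_sum_pair_le {ι σ : Type*} [Fintype ι] [Fintype σ] (P : Measure α)
    [IsProbabilityMeasure P] {e : σ → ι} (he : Function.Injective e) (a : σ)
    {f : α × α → ℝ≥0∞} (hf : Measurable f) :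
    ∫⁻ x, ∑ a', f (x (e a), x (e a')) ∂(Measure.pi fun _ : ι => P)
      ≤ ∫⁻ u, f (u, u) ∂P + Fintype.card σ * ∫⁻ u, ∫⁻ v, f (u, v) ∂P ∂P := by
  classical
  rw [lintegral_finsetSum _ (fun a' _ => by fun_prop)]
  calc ∑ a', ∫⁻ x, f (x (e a), x (e a')) ∂(Measure.pi fun _ : ι => P)
      -- The independent-pair expectation is also added at a' = a, so that its factor is the full
      -- cardinality of `σ`.
      ≤ ∑ a' : σ, ((if a' = a then ∫⁻ u, f (u, u) ∂P else 0) + ∫⁻ u, ∫⁻ v, f (u, v) ∂P ∂P) := by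
        refine Finset.sum_le_sum fun a' _ => ?_
        by_cases h : a' = a
        · subst h
          rw [lintegral_pi_eval P (e a') (f := fun u => f (u, u)) (by fun_prop)]
          simp
        · rw [lintegral_pi_eval_pair P (fun h' => h (he h').symm) hf]
          simp [h]
    _ = _ := by simp [Finset.sum_add_distrib]

/-- The tangent inequality log(T / t i) ≤ T / t i - 1 replaces log T by a different affine function
of T in each summand. As T is linear in `w`, the result is quadratic in `w`, and its expectation
over a codebook involves only pairs of codewords. -/
theorem klFun_average_add_le {σ : Type*} [Fintype σ] {c : ℝ} (hc : 0 < c) (w t : σ → ℝ)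
    (hw : ∀ i, 0 ≤ w i) (ht : ∀ i, 1 ≤ t i) (T : ℝ) (hT : T = c * ∑ i, w i) :
    klFun T + 2 * T ≤ c * ∑ i, (w i * Real.log (t i) + w i * T / t i) + 1 := by
  have hT0 : 0 ≤ T := by rw [hT]; exact mul_nonneg hc.le (Finset.sum_nonneg fun i _ => hw i)
  have key : T * Real.log T + T ≤ c * ∑ i, (w i * Real.log (t i) + w i * T / t i) := by
    have e : T * Real.log T + T = c * ∑ i, w i * (Real.log T + 1) := by
      rw [← Finset.sum_mul, ← mul_assoc, ← hT]; ring
    rw [e]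
    refine mul_le_mul_of_nonneg_left (Finset.sum_le_sum fun i _ => ?_) hc.le
    rcases hT0.eq_or_lt with h0 | h0
    · have hs : ∑ i, w i = 0 := by
        rcases mul_eq_zero.1 (hT.symm.trans h0.symm) with h | h
        · exact absurd h hc.ne'
        · exact h
      simp [(Finset.sum_eq_zero_iff_of_nonneg fun i _ => hw i).1 hs i (Finset.mem_univ i)]
    · have hti : 0 < t i := lt_of_lt_of_le one_pos (ht i)
      have := Real.log_le_sub_one_of_pos (div_pos h0 hti)
      rw [Real.log_div h0.ne' hti.ne'] at this
      have h2 : Real.log T + 1 ≤ Real.log (t i) + T / t i := by linarith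
      calc w i * (Real.log T + 1) ≤ w i * (Real.log (t i) + T / t i) :=
            mul_le_mul_of_nonneg_left h2 (hw i)
        _ = _ := by ring
  rw [klFun_apply]; linarith


variable {ι₁ ι₂ σ₁ σ₂ : Type*} [Fintype ι₁] [Fintype ι₂] [Fintype σ₁] [Fintype σ₂]

/-- The average of `w` over the pairs of codewords with indices in the images of `e₁` and `e₂`. -/
def pairAverage (w : α × β → ℝ≥0) (e₁ : σ₁ → ι₁) (e₂ : σ₂ → ι₂) (x₁ : ι₁ → α) (x₂ : ι₂ → β) : ℝ≥0 :=
  (Fintype.card σ₁ * Fintype.card σ₂ : ℝ≥0)⁻¹ * ∑ a, ∑ b, w (x₁ (e₁ a), x₂ (e₂ b))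

theorem lintegral_pairAverage [Nonempty σ₁] [Nonempty σ₂] (P₁ : Measure α) (P₂ : Measure β)
    [IsProbabilityMeasure P₁] [IsProbabilityMeasure P₂] (e₁ : σ₁ → ι₁) (e₂ : σ₂ → ι₂)
    {w : α × β → ℝ≥0} (hw : Measurable w) :
    ∫⁻ x₁, ∫⁻ x₂, (pairAverage w e₁ e₂ x₁ x₂ : ℝ≥0∞)
        ∂(Measure.pi fun _ : ι₂ => P₂) ∂(Measure.pi fun _ : ι₁ => P₁)
      = ∫⁻ u, ∫⁻ v, w (u, v) ∂P₂ ∂P₁ := by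
  have hn : (Fintype.card σ₁ * Fintype.card σ₂ : ℝ≥0) ≠ 0 := by simp
  have h1 (x₁ : ι₁ → α) : ∫⁻ x₂, (pairAverage w e₁ e₂ x₁ x₂ : ℝ≥0∞) ∂(Measure.pi fun _ : ι₂ => P₂)
      = ((Fintype.card σ₁ * Fintype.card σ₂ : ℝ≥0)⁻¹ : ℝ≥0) *
        ∑ a : σ₁, (Fintype.card σ₂ : ℝ≥0∞) * ∫⁻ v, w (x₁ (e₁ a), v) ∂P₂ := by
    simp only [pairAverage, ENNReal.coe_mul, ENNReal.ofNNReal_finsetSum]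
    rw [lintegral_const_mul _ (by fun_prop), lintegral_finsetSum _ (fun a' _ => by fun_prop)]
    congr 1
    refine Finset.sum_congr rfl fun a _ => ?_
    rw [lintegral_finsetSum _ (fun a' _ => by fun_prop)]
    rw [Finset.sum_congr rfl fun b _ => lintegral_pi_eval P₂ (e₂ b)
      (f := fun v => (w (x₁ (e₁ a), v) : ℝ≥0∞)) (by fun_prop)]
    simp
  simp only [h1]
  have hm : Measurable fun u => ∫⁻ v, (w (u, v) : ℝ≥0∞) ∂P₂ :=
    Measurable.lintegral_prod_right' (f := fun p : α × β => (w p : ℝ≥0∞)) (by fun_prop)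
  rw [lintegral_const_mul _ (by fun_prop), lintegral_finsetSum _ (fun a' _ => by fun_prop)]
  rw [Finset.sum_congr rfl fun a _ => lintegral_pi_eval P₁ (e₁ a)
      (f := fun u => (Fintype.card σ₂ : ℝ≥0∞) * ∫⁻ v, w (u, v) ∂P₂) (by fun_prop)]
  rw [lintegral_const_mul _ hm]
  simp only [Finset.sum_const, Finset.card_univ, nsmul_eq_mul]
  rw [← mul_assoc, ← mul_assoc]
  convert one_mul _
  rw [mul_assoc]
  have : (Fintype.card σ₁ : ℝ≥0∞) * (Fintype.card σ₂ : ℝ≥0∞)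
    = ((Fintype.card σ₁ * Fintype.card σ₂ : ℝ≥0) : ℝ≥0∞) := by push_cast; rfl
  rw [this, ← ENNReal.coe_mul, inv_mul_cancel₀ hn, ENNReal.coe_one]

/-- The second-moment estimate behind channel resolvability for two i.i.d. codebooks. -/
theorem lintegral_pi_pi_sum_le (P₁ : Measure α) (P₂ : Measure β)
    [IsProbabilityMeasure P₁] [IsProbabilityMeasure P₂] {e₁ : σ₁ → ι₁} {e₂ : σ₂ → ι₂}
    (he₁ : Function.Injective e₁) (he₂ : Function.Injective e₂) (a : σ₁) (b : σ₂)
    {g w : α × β → ℝ≥0} (hg : Measurable g) (hw : Measurable w) {N : ℝ≥0∞}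
    {t : α × β → ℝ≥0}
    (ht : ∀ u v, (w (u, v) : ℝ≥0∞) + Fintype.card σ₂ * ∫⁻ v', w (u, v') ∂P₂
      + Fintype.card σ₁ * ∫⁻ u', w (u', v) ∂P₁
      + Fintype.card σ₁ * Fintype.card σ₂ * ∫⁻ u', ∫⁻ v', w (u', v') ∂P₂ ∂P₁ ≤ N * t (u, v)) :
    ∫⁻ x₁, ∫⁻ x₂, ∑ a', ∑ b', (g (x₁ (e₁ a), x₂ (e₂ b)) * w (x₁ (e₁ a'), x₂ (e₂ b')) : ℝ≥0∞)
        ∂(Measure.pi fun _ : ι₂ => P₂) ∂(Measure.pi fun _ : ι₁ => P₁)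
      ≤ ∫⁻ u, ∫⁻ v, g (u, v) * (N * t (u, v)) ∂P₂ ∂P₁ := by
  have hw2 : Measurable fun u => ∫⁻ v, (w (u, v) : ℝ≥0∞) ∂P₂ :=
    Measurable.lintegral_prod_right' (f := fun p : α × β => (w p : ℝ≥0∞)) (by fun_prop)
  have hw1 : Measurable fun v => ∫⁻ u, (w (u, v) : ℝ≥0∞) ∂P₁ :=
    Measurable.lintegral_prod_left' (f := fun p : α × β => (w p : ℝ≥0∞)) (by fun_prop)
  set n₂ : ℝ≥0∞ := (Fintype.card σ₂ : ℝ≥0∞)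
  set n₁ : ℝ≥0∞ := (Fintype.card σ₁ : ℝ≥0∞)
  -- Averaging over the second codebook leaves a function of two codewords of the first, to which
  -- the one-codebook estimate applies again. The four coincidence patterns of the indices produce
  -- the four terms of `ht`.
  let G : α × α → ℝ≥0∞ := fun p =>
    ∫⁻ v, (g (p.1, v) : ℝ≥0∞) * (w (p.2, v) + n₂ * ∫⁻ v', w (p.2, v') ∂P₂) ∂P₂
  have hG' : Measurable fun q : (α × α) × β =>
      (g (q.1.1, q.2) : ℝ≥0∞) * (w (q.1.2, q.2) + n₂ * ∫⁻ v', w (q.1.2, v') ∂P₂) := by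
    have := hw2.comp (f := fun q : (α × α) × β => q.1.2) (by fun_prop)
    simp only [Function.comp_def] at this
    fun_prop
  have hG : Measurable G := hG'.lintegral_prod_right'
  have inner (x₁ : ι₁ → α) : ∫⁻ x₂, ∑ a', ∑ b',
      (g (x₁ (e₁ a), x₂ (e₂ b)) * w (x₁ (e₁ a'), x₂ (e₂ b')) : ℝ≥0∞)
        ∂(Measure.pi fun _ : ι₂ => P₂) ≤ ∑ a', G (x₁ (e₁ a), x₁ (e₁ a')) := by
    rw [lintegral_finsetSum _ (fun a' _ => by fun_prop)]
    refine Finset.sum_le_sum fun a' _ => ?_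
    refine (lintegral_pi_sum_pair_le P₂ he₂ b (f := fun q : β × β =>
      (g (x₁ (e₁ a), q.1) * w (x₁ (e₁ a'), q.2) : ℝ≥0∞)) (by fun_prop)).trans ?_
    rw [← lintegral_const_mul' _ _ (by simp), ← lintegral_add_left (by fun_prop)]
    refine lintegral_mono fun v => ?_
    simp only
    rw [lintegral_const_mul _ (by fun_prop), mul_add]
    refine add_le_add le_rfl (le_of_eq (by ring))
  refine (lintegral_mono inner).trans ((lintegral_pi_sum_pair_le P₁ he₁ a hG).trans ?_)
  have swap (u : α) : ∫⁻ u', G (u, u') ∂P₁ = ∫⁻ v, (g (u, v) : ℝ≥0∞) *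
      (∫⁻ u', w (u', v) ∂P₁ + n₂ * ∫⁻ u', ∫⁻ v', w (u', v') ∂P₂ ∂P₁) ∂P₂ := by
    have hm : Measurable fun q : α × β =>
      (g (u, q.2) : ℝ≥0∞) * (w (q.1, q.2) + n₂ * ∫⁻ v', w (q.1, v') ∂P₂) :=
      hG'.comp (f := fun q : (α × β) => ((u, q.1), q.2)) (by fun_prop)
    simp only [G]
    rw [lintegral_lintegral_swap hm.aemeasurable]
    refine lintegral_congr fun v => ?_
    rw [lintegral_const_mul _ (by fun_prop), lintegral_add_left (by fun_prop),
      lintegral_const_mul _ hw2]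
  have hGd : Measurable fun u => G (u, u) := hG.comp (f := fun u : α => (u, u)) (by fun_prop)
  rw [← lintegral_const_mul' _ _ (by simp), ← lintegral_add_left hGd]
  refine lintegral_mono fun u => ?_
  simp only [swap u]
  simp only [G]
  rw [← lintegral_const_mul' (Fintype.card σ₁ : ℝ≥0∞) _ (by simp),
    ← lintegral_add_left (by fun_prop)]
  refine lintegral_mono fun v => ?_
  refine le_trans (le_of_eq ?_) (mul_le_mul_right (ht u v) _)
  ring


/-- Here `t` dominates the conditional mean of the average given one of its codeword pairs. Hence
the quadratic term of `klFun_average_add_le` has expectation at most that of `w`, and cancels one of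
the two copies of this mean on the left. -/
theorem lintegral_klFun_pairAverage_le [Nonempty σ₁] [Nonempty σ₂] (P₁ : Measure α) (P₂ : Measure β)
    [IsProbabilityMeasure P₁] [IsProbabilityMeasure P₂] {e₁ : σ₁ → ι₁} {e₂ : σ₂ → ι₂}
    (he₁ : Function.Injective e₁) (he₂ : Function.Injective e₂)
    {w t : α × β → ℝ≥0} (hw : Measurable w) (htm : Measurable t) (ht1 : ∀ p, 1 ≤ t p)
    (hfin : ∫⁻ u, ∫⁻ v, w (u, v) ∂P₂ ∂P₁ ≠ ∞)
    (ht : ∀ u v, (w (u, v) : ℝ≥0∞) + Fintype.card σ₂ * ∫⁻ v', w (u, v') ∂P₂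
      + Fintype.card σ₁ * ∫⁻ u', w (u', v) ∂P₁
      + Fintype.card σ₁ * Fintype.card σ₂ * ∫⁻ u', ∫⁻ v', w (u', v') ∂P₂ ∂P₁
        ≤ (Fintype.card σ₁ * Fintype.card σ₂ : ℝ≥0) * t (u, v)) :
    ∫⁻ x₁, ∫⁻ x₂, ENNReal.ofReal (klFun (pairAverage w e₁ e₂ x₁ x₂))
        ∂(Measure.pi fun _ : ι₂ => P₂) ∂(Measure.pi fun _ : ι₁ => P₁)
        + ∫⁻ u, ∫⁻ v, w (u, v) ∂P₂ ∂P₁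
      ≤ ∫⁻ u, ∫⁻ v, w (u, v) * ENNReal.ofReal (Real.log (t (u, v))) ∂P₂ ∂P₁ + 1 := by
  set N : ℝ≥0 := Fintype.card σ₁ * Fintype.card σ₂ with hN
  have hN0 : N ≠ 0 := by simp [hN]
  set c : ℝ≥0 := N⁻¹ with hc
  have hc0 : 0 < c := by positivity
  let w' : α × β → ℝ≥0 := fun p => w p * (Real.log (t p)).toNNReal
  have hw' : Measurable w' := by fun_prop
  -- One factor `c` normalizes the outer average, the other is hidden in the average T multiplying
  -- `w / t`.
  let g : α × β → ℝ≥0 := fun p => c * c * w p / t p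
  have hg : Measurable g := by fun_prop
  have pointwise (x₁ : ι₁ → α) (x₂ : ι₂ → β) :
      ENNReal.ofReal (klFun (pairAverage w e₁ e₂ x₁ x₂)) + 2 * pairAverage w e₁ e₂ x₁ x₂
        ≤ pairAverage w' e₁ e₂ x₁ x₂ + ∑ a, ∑ b, ∑ a', ∑ b',
          (g (x₁ (e₁ a), x₂ (e₂ b)) * w (x₁ (e₁ a'), x₂ (e₂ b')) : ℝ≥0∞) + 1 := by
    have h := klFun_average_add_le (σ := σ₁ × σ₂) (c := c) (by exact_mod_cast hc0)
      (fun q => w (x₁ (e₁ q.1), x₂ (e₂ q.2))) (fun q => t (x₁ (e₁ q.1), x₂ (e₂ q.2)))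
      (fun q => NNReal.coe_nonneg _) (fun q => by exact_mod_cast ht1 _)
      (pairAverage w e₁ e₂ x₁ x₂) (by
        simp only [pairAverage, Fintype.sum_prod_type, NNReal.coe_mul, NNReal.coe_sum]; rfl)
    have h' := ENNReal.ofReal_le_ofReal h
    rw [ENNReal.ofReal_add (klFun_nonneg (NNReal.coe_nonneg _)) (by positivity)] at h'
    have e1 : ENNReal.ofReal (2 * (pairAverage w e₁ e₂ x₁ x₂ : ℝ)) =
        2 * (pairAverage w e₁ e₂ x₁ x₂ : ℝ≥0∞) := by
      rw [ENNReal.ofReal_mul (by norm_num)]; simp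
    rw [e1] at h'
    refine h'.trans (le_of_eq ?_)
    have e2 : (c : ℝ) * ∑ i : σ₁ × σ₂, ((w (x₁ (e₁ i.1), x₂ (e₂ i.2)) : ℝ) *
          Real.log (t (x₁ (e₁ i.1), x₂ (e₂ i.2))) +
        w (x₁ (e₁ i.1), x₂ (e₂ i.2)) * pairAverage w e₁ e₂ x₁ x₂ / t (x₁ (e₁ i.1), x₂ (e₂ i.2))) + 1
        = ((pairAverage w' e₁ e₂ x₁ x₂ + ∑ a, ∑ b, ∑ a', ∑ b',
          g (x₁ (e₁ a), x₂ (e₂ b)) * w (x₁ (e₁ a'), x₂ (e₂ b')) + 1 : ℝ≥0) : ℝ) := by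
      rw [Finset.sum_add_distrib, mul_add]
      push_cast
      congr 2
      · simp only [pairAverage, w', Fintype.sum_prod_type]
        push_cast
        simp only [Real.coe_toNNReal _ (Real.log_nonneg (by exact_mod_cast ht1 _ :
          (1 : ℝ) ≤ t _))]
        simp [hc, hN]
      · rw [Fintype.sum_prod_type, Finset.mul_sum]
        refine Finset.sum_congr rfl fun a _ => ?_
        rw [Finset.mul_sum]
        refine Finset.sum_congr rfl fun b _ => ?_
        simp only [pairAverage, g, ← Finset.mul_sum]
        push_cast
        simp only [hc, hN]
        push_cast
        ring
    rw [e2, ENNReal.ofReal_coe_nnreal]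
    push_cast
    rfl
  have hI := lintegral_mono (μ := Measure.pi fun _ : ι₁ => P₁) fun x₁ =>
    lintegral_mono (μ := Measure.pi fun _ : ι₂ => P₂) fun x₂ => pointwise x₁ x₂
  have hpm {f : α × β → ℝ≥0} (hf : Measurable f) : Measurable fun q : (ι₁ → α) × (ι₂ → β) =>
      pairAverage f e₁ e₂ q.1 q.2 := by unfold pairAverage; fun_prop
  have hpm1 {f : α × β → ℝ≥0} (hf : Measurable f) (x₁ : ι₁ → α) : Measurable fun x₂ : ι₂ → β =>
      pairAverage f e₁ e₂ x₁ x₂ := by unfold pairAverage; fun_prop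
  have hpm2 {f : α × β → ℝ≥0} (hf : Measurable f) : Measurable fun x₁ : ι₁ → α =>
      ∫⁻ x₂, (pairAverage f e₁ e₂ x₁ x₂ : ℝ≥0∞) ∂(Measure.pi fun _ : ι₂ => P₂) :=
    Measurable.lintegral_prod_right'
      (f := fun q : (ι₁ → α) × (ι₂ → β) => (pairAverage f e₁ e₂ q.1 q.2 : ℝ≥0∞))
      (hpm hf).coe_nnreal_ennreal
  have hgm (a : σ₁) (b : σ₂) : Measurable fun x₁ : ι₁ → α => ∫⁻ x₂ : ι₂ → β, ∑ a', ∑ b',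
      (g (x₁ (e₁ a), x₂ (e₂ b)) * w (x₁ (e₁ a'), x₂ (e₂ b')) : ℝ≥0∞)
        ∂(Measure.pi fun _ : ι₂ => P₂) :=
    Measurable.lintegral_prod_right' (f := fun q : (ι₁ → α) × (ι₂ → β) => ∑ a', ∑ b',
      (g (q.1 (e₁ a), q.2 (e₂ b)) * w (q.1 (e₁ a'), q.2 (e₂ b')) : ℝ≥0∞)) (by fun_prop)
  have hl : ∫⁻ x₁, ∫⁻ x₂, ENNReal.ofReal (klFun (pairAverage w e₁ e₂ x₁ x₂)) + 2 *
      (pairAverage w e₁ e₂ x₁ x₂ : ℝ≥0∞)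
        ∂(Measure.pi fun _ : ι₂ => P₂) ∂(Measure.pi fun _ : ι₁ => P₁) =
      ∫⁻ x₁, ∫⁻ x₂, ENNReal.ofReal (klFun (pairAverage w e₁ e₂ x₁ x₂))
        ∂(Measure.pi fun _ : ι₂ => P₂) ∂(Measure.pi fun _ : ι₁ => P₁) +
      2 * ∫⁻ u, ∫⁻ v, w (u, v) ∂P₂ ∂P₁ := by
    rw [← lintegral_pairAverage P₁ P₂ e₁ e₂ hw, ← lintegral_const_mul _ (hpm2 hw),
      ← lintegral_add_right _ ((hpm2 hw).const_mul _)]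
    refine lintegral_congr fun x₁ => ?_
    rw [← lintegral_const_mul _ (hpm1 hw x₁).coe_nnreal_ennreal,
      ← lintegral_add_right _ ((hpm1 hw x₁).coe_nnreal_ennreal.const_mul _)]
  have hr : ∫⁻ x₁, ∫⁻ x₂, pairAverage w' e₁ e₂ x₁ x₂ + ∑ a, ∑ b, ∑ a', ∑ b',
          (g (x₁ (e₁ a), x₂ (e₂ b)) * w (x₁ (e₁ a'), x₂ (e₂ b')) : ℝ≥0∞) + 1
        ∂(Measure.pi fun _ : ι₂ => P₂) ∂(Measure.pi fun _ : ι₁ => P₁) =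
      ∫⁻ u, ∫⁻ v, w (u, v) * ENNReal.ofReal (Real.log (t (u, v))) ∂P₂ ∂P₁ +
      ∑ a, ∑ b, ∫⁻ x₁, ∫⁻ x₂, ∑ a', ∑ b',
          (g (x₁ (e₁ a), x₂ (e₂ b)) * w (x₁ (e₁ a'), x₂ (e₂ b')) : ℝ≥0∞)
        ∂(Measure.pi fun _ : ι₂ => P₂) ∂(Measure.pi fun _ : ι₁ => P₁) + 1 := by
    have e0 : ∫⁻ u, ∫⁻ v, w (u, v) * ENNReal.ofReal (Real.log (t (u, v))) ∂P₂ ∂P₁ =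
      ∫⁻ u, ∫⁻ v, w' (u, v) ∂P₂ ∂P₁ := by
      simp only [w', ENNReal.coe_mul, ENNReal.ofReal]
    rw [e0, ← lintegral_pairAverage P₁ P₂ e₁ e₂ hw']
    simp_rw [← lintegral_finsetSum _ (fun b _ => hgm _ b)]
    rw [← lintegral_finsetSum _ (fun a _ => Finset.measurable_fun_sum _ fun b _ => hgm a b),
      ← lintegral_add_left (hpm2 hw')]
    conv_rhs => rw [← (by simp : ∫⁻ _, 1 ∂(Measure.pi fun _ : ι₁ => P₁) = 1)]
    rw [← lintegral_add_right _ measurable_const]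
    refine lintegral_congr fun x₁ => ?_
    rw [lintegral_add_right _ measurable_const,
      lintegral_add_left (hpm1 hw' x₁).coe_nnreal_ennreal,
      lintegral_finsetSum _ (fun a _ => by fun_prop)]
    rw [Finset.sum_congr rfl fun a _ => lintegral_finsetSum _ (fun b _ => by fun_prop),
      lintegral_const, measure_univ, mul_one]
  rw [hl, hr] at hI
  have hS : ∑ a, ∑ b, ∫⁻ x₁, ∫⁻ x₂, ∑ a', ∑ b',
          (g (x₁ (e₁ a), x₂ (e₂ b)) * w (x₁ (e₁ a'), x₂ (e₂ b')) : ℝ≥0∞)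
        ∂(Measure.pi fun _ : ι₂ => P₂) ∂(Measure.pi fun _ : ι₁ => P₁)
        ≤ ∫⁻ u, ∫⁻ v, w (u, v) ∂P₂ ∂P₁ := by
    have h1 (a : σ₁) (b : σ₂) := lintegral_pi_pi_sum_le P₁ P₂ he₁ he₂ a b hg hw ht
    refine (Finset.sum_le_sum fun a _ => Finset.sum_le_sum fun b _ => h1 a b).trans ?_
    have h2 : ∫⁻ u, ∫⁻ v, (g (u, v) : ℝ≥0∞) * (N * t (u, v)) ∂P₂ ∂P₁
        = c * ∫⁻ u, ∫⁻ v, w (u, v) ∂P₂ ∂P₁ := by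
      rw [← lintegral_const_mul' _ _ (by simp)]
      refine lintegral_congr fun u => ?_
      rw [← lintegral_const_mul' _ _ (by simp)]
      refine lintegral_congr fun v => ?_
      simp only [← ENNReal.coe_mul, g]
      congr 1
      have : t (u, v) ≠ 0 := (lt_of_lt_of_le one_pos (ht1 _)).ne'
      rw [hc]
      field_simp
    rw [h2]
    simp only [Finset.sum_const, Finset.card_univ, nsmul_eq_mul]
    rw [← mul_assoc, ← mul_assoc]
    have : (Fintype.card σ₁ : ℝ≥0∞) * Fintype.card σ₂ = (N : ℝ≥0∞) := by
      rw [hN]; push_cast; rfl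
    rw [this, ← ENNReal.coe_mul, hc, mul_inv_cancel₀ hN0, ENNReal.coe_one, one_mul]
  set W := ∫⁻ u, ∫⁻ v, (w (u, v) : ℝ≥0∞) ∂P₂ ∂P₁
  have hI' := hI.trans (add_le_add (add_le_add le_rfl hS) le_rfl)
  rw [two_mul, ← add_assoc, add_right_comm _ W 1] at hI'
  exact (ENNReal.add_le_add_iff_right hfin).1 hI'

end Resolvability

/-! ### Channel resolvability in terms of moments of information densities. -/

section Resolvability

open InformationTheory

/-- Apply log y ≤ y - 1 to the s-th power of the sum, and use that x ↦ x^s is subadditive for s ≤ 1.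
This turns an expected logarithm into moments of order s. -/
theorem log_one_add_add_add_le {a b c s : ℝ} (ha : 0 ≤ a) (hb : 0 ≤ b) (hc : 0 ≤ c) (hs : 0 < s)
    (hs1 : s ≤ 1) : Real.log (1 + a + b + c) ≤ s⁻¹ * (a ^ s + b ^ s + c ^ s) := by
  have h0 : 0 < 1 + a + b + c := by positivity
  have h1 : (1 + a + b + c) ^ s ≤ 1 + a ^ s + b ^ s + c ^ s := by
    have e1 := Real.rpow_add_le_add_rpow (by positivity : 0 ≤ 1 + a + b) hc hs.le hs1
    have e2 := Real.rpow_add_le_add_rpow (by positivity : 0 ≤ 1 + a) hb hs.le hs1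
    have e3 := Real.rpow_add_le_add_rpow zero_le_one ha hs.le hs1
    rw [Real.one_rpow] at e3
    linarith
  have h2 := Real.log_le_sub_one_of_pos (Real.rpow_pos_of_pos h0 s)
  rw [Real.log_rpow h0] at h2
  rw [le_inv_mul_iff₀ hs]
  linarith

variable {α β γ : Type*} [MeasurableSpace α] [MeasurableSpace β] [MeasurableSpace γ]
variable {ι₁ ι₂ σ₁ σ₂ : Type*} [Fintype ι₁] [Fintype ι₂] [Fintype σ₁] [Fintype σ₂]

theorem one_le_of_le_smul {P P' : Measure α} [IsProbabilityMeasure P] [IsProbabilityMeasure P']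
    {κ : ℝ≥0} (h : P' ≤ κ • P) : 1 ≤ κ := by
  have := h Set.univ
  simpa using this

theorem lintegral_le_of_le_smul {P P' : Measure α} {κ : ℝ≥0} (h : P' ≤ κ • P) (f : α → ℝ≥0∞) :
    ∫⁻ x, f x ∂P' ≤ κ * ∫⁻ x, f x ∂P := by
  refine (lintegral_mono' h le_rfl).trans (le_of_eq ?_)
  rw [lintegral_smul_measure]; rfl

theorem lintegral_lintegral_le_of_le_smul {P₁ P₁' : Measure α} {P₂ P₂' : Measure β} {κ : ℝ≥0}
    (h₁ : P₁' ≤ κ • P₁) (h₂ : P₂' ≤ κ • P₂) (f : α → β → ℝ≥0∞) :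
    ∫⁻ x, ∫⁻ y, f x y ∂P₂' ∂P₁' ≤ (κ ^ 2 : ℝ≥0) * ∫⁻ x, ∫⁻ y, f x y ∂P₂ ∂P₁ := by
  refine (lintegral_le_of_le_smul h₁ _).trans ?_
  rw [pow_two, ENNReal.coe_mul, mul_assoc]
  refine mul_le_mul_right ?_ _
  rw [← lintegral_const_mul' (κ : ℝ≥0∞) _ (by simp)]
  exact lintegral_mono fun x => lintegral_le_of_le_smul h₂ _

theorem lintegral_rotate {μ : Measure α} {ν : Measure β} {ρ : Measure γ} [SFinite μ] [SFinite ν]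
    [SFinite ρ] {f : α × β × γ → ℝ≥0∞} (hf : Measurable f) :
    ∫⁻ z, ∫⁻ u, ∫⁻ v, f (u, v, z) ∂ν ∂μ ∂ρ = ∫⁻ u, ∫⁻ v, ∫⁻ z, f (u, v, z) ∂ρ ∂ν ∂μ := by
  have hm : Measurable fun q : γ × α => ∫⁻ v, f (q.2, v, q.1) ∂ν :=
    Measurable.lintegral_prod_right' (f := fun q : (γ × α) × β => f (q.1.2, q.2, q.1.1))
      (by fun_prop)
  rw [lintegral_lintegral_swap hm.aemeasurable]
  refine lintegral_congr fun u => ?_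
  exact lintegral_lintegral_swap (f := fun z v => f (u, v, z))
    (hf.comp (f := fun q : γ × β => (u, q.2, q.1)) (by fun_prop)).aemeasurable

/-- **Channel resolvability for two independent i.i.d. codebooks**, in relative entropy. The
codewords are drawn from laws `P₁', P₂'` dominated by `P₁, P₂`, and `w` is the density of the
channel with respect to the output law `Q` induced by `P₁, P₂`. -/
theorem lintegral_klFun_resolvability_le [Nonempty σ₁] [Nonempty σ₂]
    (P₁ P₁' : Measure α) (P₂ P₂' : Measure β) (Q : Measure γ)
    [IsProbabilityMeasure P₁] [IsProbabilityMeasure P₂]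
    [IsProbabilityMeasure P₁'] [IsProbabilityMeasure P₂'] [IsProbabilityMeasure Q]
    {κ : ℝ≥0} (h₁ : P₁' ≤ κ • P₁) (h₂ : P₂' ≤ κ • P₂)
    {e₁ : σ₁ → ι₁} {e₂ : σ₂ → ι₂} (he₁ : Function.Injective e₁) (he₂ : Function.Injective e₂)
    {w : α × β × γ → ℝ≥0} {w₁ : α × γ → ℝ≥0} {w₂ : β × γ → ℝ≥0} (hw : Measurable w)
    (hw₁ : Measurable w₁) (hw₂ : Measurable w₂)
    (hQ : ∀ u v, ∫⁻ z, w (u, v, z) ∂Q = 1)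
    (hm₁ : ∀ u z, ∫⁻ v, w (u, v, z) ∂P₂ = w₁ (u, z))
    (hm₂ : ∀ v z, ∫⁻ u, w (u, v, z) ∂P₁ = w₂ (v, z))
    (hm : ∀ z, ∫⁻ u, w₁ (u, z) ∂P₁ = 1) {s : ℝ} (hs : 0 < s) (hs1 : s ≤ 1) :
    ∫⁻ x₁, ∫⁻ x₂, ∫⁻ z, ENNReal.ofReal
        (klFun (pairAverage (fun p => w (p.1, p.2, z)) e₁ e₂ x₁ x₂)) ∂Q
        ∂(Measure.pi fun _ : ι₂ => P₂') ∂(Measure.pi fun _ : ι₁ => P₁')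
      ≤ ENNReal.ofReal (Real.log (κ ^ 2)) + (κ ^ 2 * s.toNNReal⁻¹ : ℝ≥0) *
        (∫⁻ u, ∫⁻ v, ∫⁻ z, (w (u, v, z) * (w (u, v, z) /
            (Fintype.card σ₁ * Fintype.card σ₂)) ^ s : ℝ≥0) ∂Q ∂P₂ ∂P₁ +
          ∫⁻ u, ∫⁻ v, ∫⁻ z, (w (u, v, z) * (w₁ (u, z) / Fintype.card σ₁) ^ s : ℝ≥0) ∂Q ∂P₂ ∂P₁ +
          ∫⁻ u, ∫⁻ v, ∫⁻ z, (w (u, v, z) * (w₂ (v, z) / Fintype.card σ₂) ^ s : ℝ≥0)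
            ∂Q ∂P₂ ∂P₁) := by
  have hκ : 1 ≤ κ := one_le_of_le_smul h₁
  set n₁ : ℝ≥0 := (Fintype.card σ₁ : ℝ≥0) with hn₁
  set n₂ : ℝ≥0 := (Fintype.card σ₂ : ℝ≥0) with hn₂
  have hn₁0 : n₁ ≠ 0 := by simp [hn₁]
  have hn₂0 : n₂ ≠ 0 := by simp [hn₂]
  -- The four terms are the contributions of the coincidence patterns (none, both, first only,
  -- second only) to the conditional mean. The factor κ² pays for replacing `P₁'`, `P₂'` by `P₁`,
  -- `P₂`.
  let t : α × β × γ → ℝ≥0 := fun p =>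
    κ ^ 2 * (1 + w p / (n₁ * n₂) + w₁ (p.1, p.2.2) / n₁ + w₂ p.2 / n₂)
  have htm : Measurable t := by fun_prop
  have ht1 (p) : 1 ≤ t p := by
    have h1 : 1 ≤ κ ^ 2 := one_le_pow₀ hκ
    have h2 : 1 ≤ 1 + w p / (n₁ * n₂) + w₁ (p.1, p.2.2) / n₁ + w₂ p.2 / n₂ := by
      rw [add_assoc, add_assoc]; exact le_self_add
    exact one_le_mul h1 h2
  have hbd (z : γ) : ∫⁻ u, ∫⁻ v, w (u, v, z) ∂P₂' ∂P₁' ≤ (κ ^ 2 : ℝ≥0) := by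
    refine (lintegral_lintegral_le_of_le_smul h₁ h₂ _).trans ?_
    simp only [hm₁, hm, mul_one, le_refl]
  have hfix (z : γ) : ∫⁻ x₁, ∫⁻ x₂, ENNReal.ofReal
        (klFun (pairAverage (fun p => w (p.1, p.2, z)) e₁ e₂ x₁ x₂))
        ∂(Measure.pi fun _ : ι₂ => P₂') ∂(Measure.pi fun _ : ι₁ => P₁')
        + ∫⁻ u, ∫⁻ v, w (u, v, z) ∂P₂' ∂P₁'
      ≤ ∫⁻ u, ∫⁻ v, w (u, v, z) * ENNReal.ofReal (Real.log (t (u, v, z))) ∂P₂' ∂P₁' + 1 := by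
    refine lintegral_klFun_pairAverage_le P₁' P₂' he₁ he₂ (w := fun p => w (p.1, p.2, z))
      (t := fun p => t (p.1, p.2, z)) (by fun_prop) (by fun_prop) (fun p => ht1 _)
      (ne_top_of_le_ne_top (by simp) (hbd z)) fun u v => ?_
    have i1 : ∫⁻ v', (w (u, v', z) : ℝ≥0∞) ∂P₂' ≤ (κ ^ 2 * w₁ (u, z) : ℝ≥0) := by
      refine (lintegral_le_of_le_smul h₂ _).trans ?_
      rw [hm₁, ← ENNReal.coe_mul]
      gcongr
      exact le_self_pow₀ hκ two_ne_zero
    have i2 : ∫⁻ u', (w (u', v, z) : ℝ≥0∞) ∂P₁' ≤ (κ ^ 2 * w₂ (v, z) : ℝ≥0) := by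
      refine (lintegral_le_of_le_smul h₁ _).trans ?_
      rw [hm₂, ← ENNReal.coe_mul]
      gcongr
      exact le_self_pow₀ hκ two_ne_zero
    have i0 : w (u, v, z) ≤ κ ^ 2 * w (u, v, z) := le_mul_of_one_le_left' (one_le_pow₀ hκ)
    calc _ ≤ ((κ ^ 2 * w (u, v, z) : ℝ≥0) : ℝ≥0∞) + (n₂ : ℝ≥0∞) * (κ ^ 2 * w₁ (u, z) : ℝ≥0) +
          (n₁ : ℝ≥0∞) * (κ ^ 2 * w₂ (v, z) : ℝ≥0) + (n₁ : ℝ≥0∞) * n₂ * (κ ^ 2 : ℝ≥0) := by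
          simp only [hn₁, hn₂, ENNReal.coe_natCast]
          gcongr
          exact hbd z
      _ = _ := by
          simp only [← ENNReal.coe_mul, ← ENNReal.coe_add, t]
          congr 1
          field_simp
          ring
  have hlog (p) : ENNReal.ofReal (Real.log (t p)) ≤ ENNReal.ofReal (Real.log (κ ^ 2)) +
      (s.toNNReal⁻¹ * ((w p / (n₁ * n₂)) ^ s + (w₁ (p.1, p.2.2) / n₁) ^ s + (w₂ p.2 / n₂) ^ s) :
        ℝ≥0) := by
    have h := log_one_add_add_add_le (a := ((w p / (n₁ * n₂) : ℝ≥0) : ℝ))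
      (b := ((w₁ (p.1, p.2.2) / n₁ : ℝ≥0) : ℝ)) (c := ((w₂ p.2 / n₂ : ℝ≥0) : ℝ))
      (NNReal.coe_nonneg _) (NNReal.coe_nonneg _) (NNReal.coe_nonneg _) hs hs1
    rw [← ENNReal.ofReal_coe_nnreal, ← ENNReal.ofReal_add
      (Real.log_nonneg (by exact_mod_cast one_le_pow₀ hκ)) (NNReal.coe_nonneg _)]
    refine ENNReal.ofReal_le_ofReal ?_
    simp only [t, NNReal.coe_mul]
    rw [Real.log_mul (by positivity) (by positivity)]
    push_cast [Real.coe_toNNReal s hs.le] at h ⊢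
    linarith
  have hmeas : Measurable fun q : (ι₁ → α) × (ι₂ → β) × γ => ENNReal.ofReal
      (klFun (pairAverage (fun p => w (p.1, p.2, q.2.2)) e₁ e₂ q.1 q.2.1)) := by
    unfold pairAverage; fun_prop
  rw [← lintegral_rotate hmeas]
  -- Integrated over z, the mean of `w` equals one and cancels the additive constant 1 of the
  -- fixed-output estimate.
  have hwone : ∫⁻ z, ∫⁻ u, ∫⁻ v, (w (u, v, z) : ℝ≥0∞) ∂P₂' ∂P₁' ∂Q = 1 := by
    rw [lintegral_rotate (f := fun p => (w p : ℝ≥0∞)) (by fun_prop)]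
    simp [hQ]
  have hI := lintegral_mono (μ := Q) hfix
  have hwm : Measurable fun z => ∫⁻ u, ∫⁻ v, (w (u, v, z) : ℝ≥0∞) ∂P₂' ∂P₁' := by
    have h1 : Measurable fun q : γ × α => ∫⁻ v, (w (q.2, v, q.1) : ℝ≥0∞) ∂P₂' :=
      Measurable.lintegral_prod_right'
        (f := fun q : (γ × α) × β => (w (q.1.2, q.2, q.1.1) : ℝ≥0∞)) (by fun_prop)
    exact h1.lintegral_prod_right'
  rw [lintegral_add_right _ hwm, hwone, lintegral_add_right _ measurable_const, lintegral_const,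
    measure_univ, mul_one] at hI
  refine ((ENNReal.add_le_add_iff_right (by simp)).1 hI).trans ?_
  rw [lintegral_rotate (f := fun p => (w p : ℝ≥0∞) * ENNReal.ofReal (Real.log (t p)))
    (by fun_prop)]
  let A : α × β × γ → ℝ≥0 := fun p => w p * (w p / (n₁ * n₂)) ^ s
  let B : α × β × γ → ℝ≥0 := fun p => w p * (w₁ (p.1, p.2.2) / n₁) ^ s
  let C : α × β × γ → ℝ≥0 := fun p => w p * (w₂ p.2 / n₂) ^ s
  have hA : Measurable A := by fun_prop
  have hB : Measurable B := by fun_prop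
  have hC : Measurable C := by fun_prop
  have m1 {f : α × β × γ → ℝ≥0} (hf : Measurable f) (u : α) (v : β) :
      Measurable fun z => (f (u, v, z) : ℝ≥0∞) := by fun_prop
  have m2 {f : α × β × γ → ℝ≥0} (hf : Measurable f) (u : α) :
      Measurable fun v => ∫⁻ z, (f (u, v, z) : ℝ≥0∞) ∂Q :=
    Measurable.lintegral_prod_right' (f := fun q : β × γ => (f (u, q.1, q.2) : ℝ≥0∞))
      (by fun_prop)
  have m3 {f : α × β × γ → ℝ≥0} (hf : Measurable f) :
      Measurable fun u => ∫⁻ v, ∫⁻ z, (f (u, v, z) : ℝ≥0∞) ∂Q ∂P₂ := by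
    have h1 : Measurable fun q : α × β => ∫⁻ z, (f (q.1, q.2, z) : ℝ≥0∞) ∂Q :=
      Measurable.lintegral_prod_right'
        (f := fun q : (α × β) × γ => (f (q.1.1, q.1.2, q.2) : ℝ≥0∞)) (by fun_prop)
    exact h1.lintegral_prod_right'
  have hstep (u : α) (v : β) : ∫⁻ z, w (u, v, z) * ENNReal.ofReal (Real.log (t (u, v, z))) ∂Q ≤
      ENNReal.ofReal (Real.log (κ ^ 2)) + (s.toNNReal⁻¹ : ℝ≥0) *
        (∫⁻ z, A (u, v, z) ∂Q + ∫⁻ z, B (u, v, z) ∂Q + ∫⁻ z, C (u, v, z) ∂Q) := by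
    rw [← lintegral_add_left (m1 hA u v), ← lintegral_add_right _ (m1 hC u v),
      ← lintegral_const_mul' _ _ (by simp), ← mul_one (ENNReal.ofReal (Real.log (κ ^ 2))),
      ← hQ u v, ← lintegral_const_mul' _ _ ENNReal.ofReal_ne_top, ← lintegral_add_left
        (by have := m1 hw u v; fun_prop)]
    refine lintegral_mono fun z => ?_
    refine (mul_le_mul_right (hlog (u, v, z)) _).trans (le_of_eq ?_)
    rw [mul_add, mul_comm (w _ : ℝ≥0∞)]
    congr 1
    simp only [← ENNReal.coe_mul, ← ENNReal.coe_add, A, B, C]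
    congr 1
    ring
  calc _ ≤ ∫⁻ u, ∫⁻ v, ENNReal.ofReal (Real.log (κ ^ 2)) + (s.toNNReal⁻¹ : ℝ≥0) *
        (∫⁻ z, A (u, v, z) ∂Q + ∫⁻ z, B (u, v, z) ∂Q + ∫⁻ z, C (u, v, z) ∂Q) ∂P₂' ∂P₁' :=
        lintegral_mono fun u => lintegral_mono fun v => hstep u v
    _ = ENNReal.ofReal (Real.log (κ ^ 2)) + ∫⁻ u, ∫⁻ v, (s.toNNReal⁻¹ : ℝ≥0) *
        (∫⁻ z, A (u, v, z) ∂Q + ∫⁻ z, B (u, v, z) ∂Q + ∫⁻ z, C (u, v, z) ∂Q) ∂P₂' ∂P₁' := by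
        simp [lintegral_add_left measurable_const]
    _ ≤ _ := by
        refine add_le_add le_rfl ((lintegral_lintegral_le_of_le_smul h₁ h₂ _).trans (le_of_eq ?_))
        rw [ENNReal.coe_mul, mul_assoc]
        congr 1
        rw [← lintegral_add_left (m3 hA), ← lintegral_add_right _ (m3 hC),
          ← lintegral_const_mul' _ _ (by simp)]
        refine lintegral_congr fun u => ?_
        rw [lintegral_const_mul' _ _ (by simp), lintegral_add_right _ (m2 hC u),
          lintegral_add_left (m2 hA u)]

end Resolvability

/-! ### Mutual information and relative entropy to a reference law. -/

section MutualInformation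

open InformationTheory

variable {α : Type*} [MeasurableSpace α]

theorem klDiv_withDensity_withDensity (Q : Measure α) [SigmaFinite Q] {f g : α → ℝ≥0}
    (hf : Measurable f) (hg : Measurable g) (hg0 : ∀ x, g x ≠ 0)
    [IsFiniteMeasure (Q.withDensity fun x => (f x : ℝ≥0∞))]
    [IsFiniteMeasure (Q.withDensity fun x => (g x : ℝ≥0∞))] :
    klDiv (Q.withDensity fun x => (f x : ℝ≥0∞)) (Q.withDensity fun x => (g x : ℝ≥0∞)) =
      ∫⁻ x, g x * ENNReal.ofReal (klFun (f x / g x)) ∂Q := by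
  have e : (Q.withDensity fun x => (f x : ℝ≥0∞)) =
      (Q.withDensity fun x => (g x : ℝ≥0∞)).withDensity fun x => ((f x / g x : ℝ≥0) : ℝ≥0∞) := by
    rw [← withDensity_mul _ (by fun_prop) (by fun_prop)]
    congr 1
    funext x
    rw [Pi.mul_apply, ← ENNReal.coe_mul, mul_div_cancel₀ _ (hg0 x)]
  have hac : (Q.withDensity fun x => (f x : ℝ≥0∞)) ≪ Q.withDensity fun x => (g x : ℝ≥0∞) := by
    rw [e]; exact withDensity_absolutelyContinuous _ _
  have hrn := Measure.rnDeriv_withDensity (Q.withDensity fun x => (g x : ℝ≥0∞))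
    (f := fun x => ((f x / g x : ℝ≥0) : ℝ≥0∞)) (by fun_prop)
  rw [← e] at hrn
  rw [klDiv_eq_lintegral_klFun_of_ac hac,
    lintegral_congr_ae (g := fun x => ENNReal.ofReal (klFun ((f x / g x : ℝ≥0) : ℝ))) (by
      filter_upwards [hrn] with x hx
      rw [hx, ENNReal.coe_toReal]),
    lintegral_withDensity_eq_lintegral_mul _ (by fun_prop) (by fun_prop)]
  simp


/-- The right side minus the left side is exactly `klFun S`, which is nonnegative. This is the
pointwise form of the compensation identity: replacing the true output law by a reference law can
only increase the average divergence. -/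
theorem mul_klFun_div_average_le {ι : Type*} [Fintype ι] [Nonempty ι] (T : ι → ℝ) (hT : ∀ i, 0 < T i) (S : ℝ)
    (hS : S = (Fintype.card ι : ℝ)⁻¹ * ∑ i, T i) :
    (Fintype.card ι : ℝ)⁻¹ * ∑ i, S * klFun (T i / S) ≤
      (Fintype.card ι : ℝ)⁻¹ * ∑ i, klFun (T i) := by
  have hc : (0 : ℝ) < Fintype.card ι := by exact_mod_cast Fintype.card_pos
  have hS0 : 0 < S := by
    rw [hS]; exact mul_pos (inv_pos.2 hc) (Finset.sum_pos (fun i _ => hT i) Finset.univ_nonempty)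
  have h1 (i : ι) : S * klFun (T i / S) = klFun (T i) - T i * Real.log S + S - 1 := by
    rw [klFun_apply, klFun_apply, Real.log_div (hT i).ne' hS0.ne']
    field_simp
    ring
  simp only [h1, Finset.sum_sub_distrib, Finset.sum_add_distrib, ← Finset.sum_mul,
    Finset.sum_const, Finset.card_univ, nsmul_eq_mul]
  have h2 : (Fintype.card ι : ℝ)⁻¹ * (∑ i, klFun (T i) - (∑ i, T i) * Real.log S +
      Fintype.card ι * S - Fintype.card ι * 1) =
      (Fintype.card ι : ℝ)⁻¹ * ∑ i, klFun (T i) - klFun S := by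
    have : ∑ i, T i = Fintype.card ι * S := by rw [hS]; field_simp
    rw [this, klFun_apply]
    field_simp
    ring
  rw [h2]
  linarith [klFun_nonneg hS0.le]

/-- The mutual information between a uniform message and an output with conditional densities
`T i` is at most the average relative entropy of the conditional output laws with respect to any
reference law `Q`. -/
theorem mutualInfo_le_average_klFun {Ω ι γ : Type*} [MeasurableSpace Ω] [MeasurableSpace γ]
    [MeasurableSpace ι] [Fintype ι] [Nonempty ι] [MeasurableSingletonClass ι]
    (μ : Measure Ω) [IsProbabilityMeasure μ]
    {X : Ω → ι} {Y : Ω → γ} (hX : Measurable X) (hY : Measurable Y) (Q : Measure γ)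
    [IsProbabilityMeasure Q] {T : ι → γ → ℝ≥0} (hT : ∀ i, Measurable (T i))
    (hT0 : ∀ i z, T i z ≠ 0) (hT1 : ∀ i, ∫⁻ z, T i z ∂Q = 1)
    (hlaw : ∀ F : ι × γ → ℝ≥0∞, Measurable F → ∫⁻ ω, F (X ω, Y ω) ∂μ =
      (Fintype.card ι : ℝ≥0∞)⁻¹ * ∑ i, ∫⁻ z, T i z * F (i, z) ∂Q) :
    mutualInfo μ X Y ≤
      (Fintype.card ι : ℝ≥0∞)⁻¹ * ∑ i, ∫⁻ z, ENNReal.ofReal (klFun (T i z)) ∂Q := by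
  have hc0 : (Fintype.card ι : ℝ≥0∞) ≠ 0 := by simp
  set U : Measure ι := (Fintype.card ι : ℝ≥0∞)⁻¹ • Measure.count with hU
  have : IsProbabilityMeasure U := ⟨by
    rw [hU, Measure.smul_apply, Measure.count_univ, smul_eq_mul, ENat.card_eq_coe_fintype_card]
    simpa using ENNReal.inv_mul_cancel hc0 (by simp)⟩
  have hlU (F : ι → ℝ≥0∞) : ∫⁻ i, F i ∂U = (Fintype.card ι : ℝ≥0∞)⁻¹ * ∑ i, F i := by
    rw [hU, lintegral_smul_measure, lintegral_count, tsum_fintype, smul_eq_mul]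
  have hTm : Measurable fun p : ι × γ => T p.1 p.2 :=
    measurable_from_prod_countable_right fun i => hT i
  let S : γ → ℝ≥0 := fun z => (Fintype.card ι : ℝ≥0)⁻¹ * ∑ i, T i z
  have hSm : Measurable S := by fun_prop
  have hS0 (z) : S z ≠ 0 := by
    refine mul_ne_zero (by simp) ?_
    rw [ne_eq, Finset.sum_eq_zero_iff]
    intro h
    obtain ⟨i⟩ := ‹Nonempty ι›
    exact hT0 i z (h i (Finset.mem_univ i))
  have hScoe (z) : (S z : ℝ≥0∞) = (Fintype.card ι : ℝ≥0∞)⁻¹ * ∑ i, (T i z : ℝ≥0∞) := by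
    simp only [S]
    rw [ENNReal.coe_mul, ENNReal.coe_inv (by simp)]
    simp
  have hjoint : μ.map (fun ω => (X ω, Y ω)) =
      (U.prod Q).withDensity fun p => (T p.1 p.2 : ℝ≥0∞) := by
    ext A hA
    rw [withDensity_apply _ hA, ← lintegral_indicator_one hA, lintegral_map
      (measurable_one.indicator hA) (hX.prodMk hY), hlaw _ (measurable_one.indicator hA),
      ← lintegral_indicator hA, lintegral_prod _ (by fun_prop (disch := assumption)), hlU]
    congr 1
    refine Finset.sum_congr rfl fun i _ => lintegral_congr fun z => ?_
    by_cases h : (i, z) ∈ A <;> simp [h]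
  have hmX : μ.map X = U := by
    ext A hA
    rw [← lintegral_indicator_one hA, lintegral_map (measurable_one.indicator hA) hX,
      hlaw (fun p => A.indicator 1 p.1) ((measurable_one.indicator hA).comp measurable_fst),
      ← lintegral_indicator_one hA, hlU]
    congr 1
    refine Finset.sum_congr rfl fun i _ => ?_
    refine (lintegral_mul_const (A.indicator 1 i) (by have := hT i; fun_prop)).trans ?_
    rw [hT1, one_mul]
  have hmY : μ.map Y = Q.withDensity fun z => (S z : ℝ≥0∞) := by
    ext A hA
    rw [withDensity_apply _ hA, ← lintegral_indicator_one hA,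
      lintegral_map (measurable_one.indicator hA) hY,
      hlaw (fun p => A.indicator 1 p.2) ((measurable_one.indicator hA).comp measurable_snd),
      ← lintegral_indicator hA, ← lintegral_finsetSum _ (fun i _ => by
        have := hT i
        have := (measurable_one (α := ℝ≥0∞) (β := γ)).indicator hA
        fun_prop), ← lintegral_const_mul' _ _ (by simp)]
    refine lintegral_congr fun z => ?_
    by_cases h : z ∈ A <;> simp [h, hScoe]
  have hprod : (μ.map X).prod (μ.map Y) =
      (U.prod Q).withDensity fun p => (S p.2 : ℝ≥0∞) := by
    rw [hmX, hmY]; exact prod_withDensity_right (by fun_prop)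
  have i1 : IsProbabilityMeasure (μ.map fun ω => (X ω, Y ω)) :=
    Measure.isProbabilityMeasure_map (by fun_prop)
  have i2 : IsProbabilityMeasure (μ.map X) := Measure.isProbabilityMeasure_map (by fun_prop)
  have i3 : IsProbabilityMeasure (μ.map Y) := Measure.isProbabilityMeasure_map (by fun_prop)
  have i4 : IsFiniteMeasure ((μ.map X).prod (μ.map Y)) := inferInstance
  rw [mutualInfo]
  rw [hjoint] at i1 ⊢
  rw [hprod] at i4 ⊢
  rw [klDiv_withDensity_withDensity (U.prod Q) (f := fun p => T p.1 p.2) (g := fun p => S p.2)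
    hTm (by fun_prop) (fun p => hS0 _), lintegral_prod _ (by fun_prop), hlU,
    ← lintegral_finsetSum _ (fun i _ => by have := hT i; fun_prop),
    ← lintegral_const_mul' _ _ (by simp), ← lintegral_finsetSum _ (fun i _ => by
      have := hT i; fun_prop), ← lintegral_const_mul' _ _ (by simp)]
  refine lintegral_mono fun z => ?_
  have h := mul_klFun_div_average_le (fun i => (T i z : ℝ))
    (fun i => lt_of_le_of_ne (NNReal.coe_nonneg _) (by exact_mod_cast (hT0 i z).symm)) (S z)
    (by simp [S])
  have hk (x : ℝ≥0) : 0 ≤ klFun x := klFun_nonneg x.coe_nonneg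
  have hcc : (Fintype.card ι : ℝ≥0∞)⁻¹ = ENNReal.ofReal (Fintype.card ι : ℝ)⁻¹ := by
    rw [ENNReal.ofReal_inv_of_pos (by exact_mod_cast Fintype.card_pos)]; simp
  have h' := ENNReal.ofReal_le_ofReal h
  have hk2 (i) : 0 ≤ (S z : ℝ) * klFun (T i z / S z) := by
    have := hk (T i z / S z)
    push_cast at this
    positivity
  rw [ENNReal.ofReal_mul (by positivity), ENNReal.ofReal_mul (by positivity),
    ENNReal.ofReal_sum_of_nonneg (fun i _ => hk2 i),
    ENNReal.ofReal_sum_of_nonneg (fun i _ => hk _), ← hcc] at h'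
  simpa [ENNReal.ofReal_mul] using h'

end MutualInformation

/-! ### Threshold decoding of a random codebook. -/

section Decoding

variable {α γ : Type*} [MeasurableSpace α] [MeasurableSpace γ]

/-- A threshold decoder for a codebook `x` whose codewords are indexed by messages and
randomization indices. -/
theorem exists_threshold_decoder {m l : Type*} [Fintype m] [Fintype l] [Nonempty m]
    [DecidableEq m] [DecidableEq l] [MeasurableSpace m]
    (Q : Measure γ) (f : m × l → γ → ℝ≥0) (hf : ∀ i, Measurable (f i)) (hf0 : ∀ i y, f i y ≠ 0)
    {τ : ℝ≥0} (hτ : τ ≠ 0) {s : ℝ} (hs : 0 < s) :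
    ∃ dec : γ → m, Measurable dec ∧ ∀ i : m × l,
      (Q.withDensity fun y => (f i y : ℝ≥0∞)) {y | dec y ≠ i.1} ≤
        ∫⁻ y, (f i y * ((τ / f i y) ^ s + ∑ j ∈ Finset.univ.erase i, f j y / τ) : ℝ≥0) ∂Q := by
  classical
  -- The decoder sees the output only through finitely many threshold comparisons, so an arbitrary
  -- choice among the accepted indices is measurable.
  let D : (m × l → Prop) → m := fun v =>
    if h : ∃ i, v i then h.choose.1 else Classical.arbitrary m
  let V : γ → m × l → Prop := fun y i => τ < f i y
  have hV : Measurable V := by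
    refine measurable_pi_iff.2 fun i => ?_
    exact measurableSet_setOfPred.1 (measurableSet_lt measurable_const (hf i))
  have hfib (A : Set m) : MeasurableSet {y | D (V y) ∈ A} :=
    (measurable_of_countable (fun v : m × l → Prop => (D v ∈ A))).comp hV |>.setOf
  refine ⟨fun y => D (V y), fun A _ => hfib A, fun i => ?_⟩
  have hset : MeasurableSet {y | D (V y) ≠ i.1} := hfib {i.1}ᶜ
  rw [withDensity_apply _ hset, ← lintegral_indicator hset]
  refine lintegral_mono fun y => ?_
  by_cases hy : y ∈ {y | D (V y) ≠ i.1}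
  swap
  · simp [Set.indicator_of_notMem hy]
  rw [Set.indicator_of_mem hy, ENNReal.coe_le_coe]
  refine le_mul_of_one_le_right (by simp) ?_
  -- An error has one of two causes: a different index is accepted, which makes some `f j y / τ` at
  -- least 1, or the true index is rejected, which makes `(τ / f i y) ^ s` at least 1.
  by_cases hi : V y i
  · have hex : ∃ i, V y i := ⟨i, hi⟩
    have hD : D (V y) = hex.choose.1 := dif_pos hex
    have hne : hex.choose ≠ i := by
      intro h
      apply hy
      rw [hD, h]
    have hlt : τ < f hex.choose y := hex.choose_spec
    refine le_trans ?_ (le_add_of_nonneg_left (by simp))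
    refine le_trans ?_ (Finset.single_le_sum (f := fun j => f j y / τ) (fun j _ => by simp)
      (Finset.mem_erase.2 ⟨hne, Finset.mem_univ _⟩))
    rw [one_le_div (by positivity)]
    exact hlt.le
  · refine le_trans ?_ (le_add_of_nonneg_right (by simp))
    refine NNReal.one_le_rpow ?_ hs.le
    rw [one_le_div (by have := hf0 i y; positivity)]
    exact not_lt.1 hi

/-- The random coding bound for a threshold decoder, averaged over an i.i.d. codebook. -/
theorem lintegral_threshold_decoder_le {ι : Type*} [Fintype ι] [Nonempty ι] [DecidableEq ι]
    (P P' : Measure α) [IsProbabilityMeasure P] [IsProbabilityMeasure P']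
    (Q : Measure γ) [IsProbabilityMeasure Q] {κ : ℝ≥0} (hP : P' ≤ κ • P)
    {w : α × γ → ℝ≥0} (hw : Measurable w) (hQ : ∀ u, ∫⁻ y, w (u, y) ∂Q = 1)
    (hm : ∀ y, ∫⁻ u, w (u, y) ∂P = 1) (τ : ℝ≥0) (s : ℝ) :
    ∫⁻ x, (Fintype.card ι : ℝ≥0∞)⁻¹ * ∑ i, ∫⁻ y, (w (x i, y) * ((τ / w (x i, y)) ^ s +
        ∑ j ∈ Finset.univ.erase i, w (x j, y) / τ) : ℝ≥0) ∂Q ∂(Measure.pi fun _ : ι => P')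
      ≤ κ * ∫⁻ u, ∫⁻ y, (w (u, y) * (τ / w (u, y)) ^ s : ℝ≥0) ∂Q ∂P +
        (κ * Fintype.card ι / τ : ℝ≥0) := by
  have hint1 {f : α × γ → ℝ≥0} (hf : Measurable f) :
      Measurable fun u => ∫⁻ y, (f (u, y) : ℝ≥0∞) ∂Q :=
    Measurable.lintegral_prod_right' (f := fun p : α × γ => (f p : ℝ≥0∞)) (by fun_prop)
  have hint2 (i j : ι) : Measurable fun x : ι → α =>
      ∫⁻ y, (w (x i, y) * (w (x j, y) / τ) : ℝ≥0) ∂Q :=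
    Measurable.lintegral_prod_right' (f := fun p : (ι → α) × γ =>
      ((w (p.1 i, p.2) * (w (p.1 j, p.2) / τ) : ℝ≥0) : ℝ≥0∞)) (by fun_prop)
  let g : α × γ → ℝ≥0 := fun p => w p * (τ / w p) ^ s
  have hg : Measurable g := by fun_prop
  have hsplit (x : ι → α) (i : ι) : ∫⁻ y, (w (x i, y) * ((τ / w (x i, y)) ^ s +
        ∑ j ∈ Finset.univ.erase i, w (x j, y) / τ) : ℝ≥0) ∂Q =
      ∫⁻ y, g (x i, y) ∂Q + ∑ j ∈ Finset.univ.erase i,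
        ∫⁻ y, (w (x i, y) * (w (x j, y) / τ) : ℝ≥0) ∂Q := by
    rw [← lintegral_finsetSum _ (fun j _ => by fun_prop), ← lintegral_add_left (by fun_prop)]
    refine lintegral_congr fun y => ?_
    simp only [g, ← ENNReal.ofNNReal_finsetSum, ← ENNReal.coe_add, mul_add, Finset.mul_sum]
  -- A competing codeword is independent of the transmitted one. Its density has mean 1 under `P`,
  -- hence at most κ under `P'`, at every output.
  have hpair {i j : ι} (hij : j ≠ i) : ∫⁻ x, ∫⁻ y, (w (x i, y) * (w (x j, y) / τ) : ℝ≥0) ∂Q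
      ∂(Measure.pi fun _ : ι => P') ≤ (κ / τ : ℝ≥0) := by
    have hm' : Measurable fun p : α × α => ∫⁻ y, (w (p.1, y) * (w (p.2, y) / τ) : ℝ≥0) ∂Q :=
      Measurable.lintegral_prod_right' (f := fun q : (α × α) × γ =>
        ((w (q.1.1, q.2) * (w (q.1.2, q.2) / τ) : ℝ≥0) : ℝ≥0∞)) (by fun_prop)
    rw [lintegral_pi_eval_pair P' hij.symm
      (f := fun p => ∫⁻ y, (w (p.1, y) * (w (p.2, y) / τ) : ℝ≥0) ∂Q) hm']
    have h1 (u : α) : ∫⁻ v, ∫⁻ y, (w (u, y) * (w (v, y) / τ) : ℝ≥0) ∂Q ∂P' ≤ (κ / τ : ℝ≥0) := by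
      rw [lintegral_lintegral_swap (by fun_prop)]
      calc ∫⁻ y, ∫⁻ v, (w (u, y) * (w (v, y) / τ) : ℝ≥0) ∂P' ∂Q
          ≤ ∫⁻ y, (κ / τ : ℝ≥0) * w (u, y) ∂Q := by
            refine lintegral_mono fun y => ?_
            have e (v) : ((w (u, y) * (w (v, y) / τ) : ℝ≥0) : ℝ≥0∞) =
                ((w (u, y) * τ⁻¹ : ℝ≥0) : ℝ≥0∞) * w (v, y) := by
              rw [← ENNReal.coe_mul]; congr 1; ring
            simp only [e]
            rw [lintegral_const_mul' _ _ ENNReal.coe_ne_top]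
            refine (mul_le_mul_right (lintegral_le_of_le_smul hP _) _).trans (le_of_eq ?_)
            rw [hm, mul_one, ← ENNReal.coe_mul, ← ENNReal.coe_mul]
            congr 1
            ring
        _ = (κ / τ : ℝ≥0) := by rw [lintegral_const_mul' _ _ (by simp), hQ, mul_one]
    refine (lintegral_mono h1).trans (by simp)
  have hone (i : ι) : ∫⁻ x, (∫⁻ y, g (x i, y) ∂Q + ∑ j ∈ Finset.univ.erase i,
        ∫⁻ y, (w (x i, y) * (w (x j, y) / τ) : ℝ≥0) ∂Q) ∂(Measure.pi fun _ : ι => P') ≤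
      κ * ∫⁻ u, ∫⁻ y, g (u, y) ∂Q ∂P + (κ * Fintype.card ι / τ : ℝ≥0) := by
    rw [lintegral_add_right _ (Finset.measurable_fun_sum _ fun j _ => hint2 i j),
      lintegral_pi_eval P' i (hint1 hg), lintegral_finsetSum _ (fun j _ => hint2 i j)]
    refine add_le_add (lintegral_le_of_le_smul hP _) ?_
    calc _ ≤ ∑ j ∈ Finset.univ.erase i, ((κ / τ : ℝ≥0) : ℝ≥0∞) :=
          Finset.sum_le_sum fun j hj => hpair (Finset.mem_erase.1 hj).1
      _ ≤ ∑ j : ι, ((κ / τ : ℝ≥0) : ℝ≥0∞) := Finset.sum_le_sum_of_subset (by simp)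
      _ = _ := by
        rw [Finset.sum_const, Finset.card_univ, nsmul_eq_mul, ← ENNReal.coe_natCast,
          ← ENNReal.coe_mul]
        congr 1
        ring
  have hms (i : ι) : Measurable fun x : ι → α => ∫⁻ y, g (x i, y) ∂Q +
      ∑ j ∈ Finset.univ.erase i, ∫⁻ y, (w (x i, y) * (w (x j, y) / τ) : ℝ≥0) ∂Q :=
    ((hint1 hg).comp (measurable_pi_apply i)).add
      (Finset.measurable_fun_sum _ fun j _ => hint2 i j)
  simp only [hsplit]
  rw [lintegral_const_mul' _ _ (by simp), lintegral_finsetSum _ (fun i _ => hms i)]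
  refine (mul_le_mul_right (Finset.sum_le_sum fun i _ => hone i) _).trans (le_of_eq ?_)
  rw [Finset.sum_const, Finset.card_univ, nsmul_eq_mul, ← mul_assoc,
    ENNReal.inv_mul_cancel (by simp) (by simp), one_mul]

end Decoding

/-! ### Integrals and densities for finite product measures. -/

section PiMeasure

variable {ι : Type*} [Fintype ι] {α : ι → Type*} [∀ i, MeasurableSpace (α i)]

theorem lintegral_pi_prod_eq_prod (μ : ∀ i, Measure (α i)) [∀ i, IsProbabilityMeasure (μ i)]
    {f : ∀ i, α i → ℝ≥0∞} (hf : ∀ i, Measurable (f i)) :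
    ∫⁻ x, ∏ i, f i (x i) ∂(Measure.pi μ) = ∏ i, ∫⁻ y, f i y ∂(μ i) := by
  have hind : iIndepFun (fun i (x : ∀ i, α i) => f i (x i)) (Measure.pi μ) :=
    iIndepFun_pi fun i => (hf i).aemeasurable
  rw [lintegral_prod_eq_prod_lintegral_of_indepFun Finset.univ _ hind
    fun i => (hf i).comp (measurable_pi_apply i)]
  exact Finset.prod_congr rfl fun i _ => (measurePreserving_eval μ i).lintegral_comp (hf i)

theorem pi_withDensity_eq (μ : ∀ i, Measure (α i)) [∀ i, IsProbabilityMeasure (μ i)]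
    {f : ∀ i, α i → ℝ≥0∞} (hf : ∀ i, Measurable (f i))
    [∀ i, SigmaFinite ((μ i).withDensity (f i))] :
    Measure.pi (fun i => (μ i).withDensity (f i)) =
      (Measure.pi μ).withDensity fun x => ∏ i, f i (x i) := by
  refine Measure.pi_eq fun s hs => ?_
  rw [withDensity_apply _ (.univ_pi hs), ← lintegral_indicator (.univ_pi hs)]
  have e (x : ∀ i, α i) : (Set.univ.pi s).indicator (fun x => ∏ i, f i (x i)) x =
      ∏ i, (s i).indicator (f i) (x i) := by
    by_cases h : x ∈ Set.univ.pi s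
    · rw [Set.indicator_of_mem h]
      exact Finset.prod_congr rfl fun i _ => (Set.indicator_of_mem (h i trivial) _).symm
    · rw [Set.indicator_of_notMem h]
      simp only [Set.mem_pi, Set.mem_univ, true_imp_iff, not_forall] at h
      obtain ⟨i, hi⟩ := h
      exact (Finset.prod_eq_zero (Finset.mem_univ i) (Set.indicator_of_notMem hi _)).symm
  simp only [e]
  rw [lintegral_pi_prod_eq_prod μ fun i => (hf i).indicator (hs i)]
  exact Finset.prod_congr rfl fun i _ => by
    rw [lintegral_indicator (hs i), withDensity_apply _ (hs i)]

end PiMeasure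

/-! ### One-letter Gaussian computations. -/

section Gaussian

/-- The density of `N(t, u)` with respect to `N(0, σ)`. -/
def gaussianRatio (u σ : ℝ≥0) (t z : ℝ) : ℝ≥0 :=
  (gaussianPDFReal t u z / gaussianPDFReal 0 σ z).toNNReal

@[fun_prop]
theorem measurable_gaussianRatio {α : Type*} [MeasurableSpace α] (u σ : ℝ≥0) {f g : α → ℝ}
    (hf : Measurable f) (hg : Measurable g) : Measurable fun x => gaussianRatio u σ (f x) (g x) := by
  unfold gaussianRatio
  simp only [gaussianPDFReal]
  fun_prop

theorem gaussianRatio_pos {u σ : ℝ≥0} (hu : u ≠ 0) (hσ : σ ≠ 0) (t z : ℝ) :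
    0 < gaussianRatio u σ t z :=
  Real.toNNReal_pos.2 (div_pos (gaussianPDFReal_pos _ _ _ hu) (gaussianPDFReal_pos _ _ _ hσ))

theorem gaussianRatio_self {σ : ℝ≥0} (hσ : σ ≠ 0) (z : ℝ) : gaussianRatio σ σ 0 z = 1 := by
  rw [gaussianRatio, div_self (gaussianPDFReal_pos _ _ _ hσ).ne', Real.toNNReal_one]

theorem coe_gaussianRatio {u σ : ℝ≥0} (hu : u ≠ 0) (hσ : σ ≠ 0) (t z : ℝ) :
    (gaussianRatio u σ t z : ℝ) =
      Real.exp (1 / 2 * Real.log (σ / u) - (z - t) ^ 2 / (2 * u) + z ^ 2 / (2 * σ)) := by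
  have hu' : (0 : ℝ) < u := by positivity
  have hσ' : (0 : ℝ) < σ := by positivity
  rw [gaussianRatio, Real.coe_toNNReal _ (div_nonneg (gaussianPDFReal_nonneg _ _ _)
    (gaussianPDFReal_nonneg _ _ _)), gaussianPDFReal, gaussianPDFReal, Real.exp_add, Real.exp_sub,
    mul_comm (1 / 2 : ℝ), ← Real.rpow_def_of_pos (by positivity), ← Real.sqrt_eq_rpow,
    Real.sqrt_div' _ hu'.le, Real.sqrt_mul (by positivity), Real.sqrt_mul (by positivity) (σ : ℝ),
    sub_zero, neg_div, neg_div, Real.exp_neg, Real.exp_neg]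
  have h1 := Real.sqrt_pos.2 hu'
  have h2 := Real.sqrt_pos.2 hσ'
  have h3 := Real.sqrt_pos.2 (by positivity : 0 < 2 * Real.pi)
  have h4 := Real.exp_pos ((z - t) ^ 2 / (2 * u))
  have h5 := Real.exp_pos (z ^ 2 / (2 * σ))
  field_simp

theorem gaussianReal_eq_withDensity_gaussianRatio {u σ : ℝ≥0} (hu : u ≠ 0) (hσ : σ ≠ 0) (t : ℝ) :
    gaussianReal t u =
      (gaussianReal 0 σ).withDensity fun z => (gaussianRatio u σ t z : ℝ≥0∞) := by
  rw [gaussianReal_of_var_ne_zero _ hu, gaussianReal_of_var_ne_zero _ hσ,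
    ← withDensity_mul _ (measurable_gaussianPDF _ _) (by fun_prop)]
  congr 1
  funext z
  rw [Pi.mul_apply, gaussianPDF, gaussianPDF, gaussianRatio]
  change _ = _ * ENNReal.ofReal _
  rw [← ENNReal.ofReal_mul (gaussianPDFReal_nonneg _ _ _),
    mul_div_cancel₀ _ (gaussianPDFReal_pos _ _ _ hσ).ne']

/-- Completing the square, which is Bayes' rule: prior times channel equals output density times
posterior density, with posterior mean b p (z - t) / q and variance p v / q. -/
theorem gaussianPDFReal_mul_gaussianPDFReal {p v q r : ℝ≥0} {b : ℝ} (hp : p ≠ 0) (hv : v ≠ 0)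
    (hq : (q : ℝ) = b ^ 2 * p + v) (hr : (r : ℝ) = p * v / q) (t x z : ℝ) :
    gaussianPDFReal 0 p x * gaussianPDFReal (t + b * x) v z =
      gaussianPDFReal t q z * gaussianPDFReal (b * p * (z - t) / q) r x := by
  have hp' : (0 : ℝ) < p := by positivity
  have hv' : (0 : ℝ) < v := by positivity
  have hq' : (0 : ℝ) < q := by rw [hq]; positivity
  have hr' : (0 : ℝ) < r := by rw [hr]; positivity
  simp only [gaussianPDFReal]
  rw [mul_mul_mul_comm, mul_mul_mul_comm (√(2 * Real.pi * q))⁻¹, ← Real.exp_add, ← Real.exp_add,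
    ← mul_inv, ← mul_inv, ← Real.sqrt_mul (by positivity), ← Real.sqrt_mul (by positivity)]
  congr 1
  · congr 2
    rw [hr]
    field_simp
  · congr 1
    rw [hr]
    field_simp
    rw [hq]
    ring

theorem lintegral_gaussianRatio {p v q σ : ℝ≥0} {b : ℝ} (hv : v ≠ 0)
    (hq : (q : ℝ) = b ^ 2 * p + v) (t z : ℝ) :
    ∫⁻ x, gaussianRatio v σ (t + b * x) z ∂(gaussianReal 0 p) = gaussianRatio q σ t z := by
  -- At power zero the input law is a Dirac mass without density, so Bayes' rule for densities is
  -- unavailable.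
  rcases eq_or_ne p 0 with rfl | hp
  · have : q = v := by rw [← NNReal.coe_inj, hq]; simp
    rw [gaussianReal_zero_var, lintegral_dirac' _ (by fun_prop), this]
    simp
  · have hq0 : q ≠ 0 := by
      rw [← NNReal.coe_ne_zero, hq]
      have : (0 : ℝ) < v := by positivity
      positivity
    have hr0 : p * v / q ≠ 0 := by positivity
    rw [gaussianReal_of_var_ne_zero _ hp,
      lintegral_withDensity_eq_lintegral_mul _ (measurable_gaussianPDF _ _) (by fun_prop)]
    have e (x : ℝ) : (gaussianPDF 0 p * fun x => (gaussianRatio v σ (t + b * x) z : ℝ≥0∞)) x =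
        gaussianRatio q σ t z * gaussianPDF (b * p * (z - t) / q) (p * v / q) x := by
      rw [Pi.mul_apply, gaussianPDF, gaussianPDF, gaussianRatio, gaussianRatio]
      change _ * ENNReal.ofReal _ = ENNReal.ofReal _ * _
      rw [← ENNReal.ofReal_mul (gaussianPDFReal_nonneg _ _ _), ← ENNReal.ofReal_mul
        (div_nonneg (gaussianPDFReal_nonneg _ _ _) (gaussianPDFReal_nonneg _ _ _)),
        ← mul_div_assoc, gaussianPDFReal_mul_gaussianPDFReal (r := p * v / q) hp hv hq
        (by push_cast; rfl)]
      congr 1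
      ring
    simp only [e]
    rw [lintegral_const_mul' _ _ (by simp), lintegral_gaussianPDF_eq_one _ hr0, mul_one]

/-- The exponential weight turns the density of N(0, u) into a multiple of the density of N(0, u /
(1 - 2r)), which integrates to one. -/
theorem lintegral_exp_sq_gaussianReal {u : ℝ≥0} (hu : u ≠ 0) {r : ℝ} (hr : r < 1 / 2) :
    ∫⁻ x, ENNReal.ofReal (Real.exp (r * (x ^ 2 / u))) ∂(gaussianReal 0 u) =
      ENNReal.ofReal ((√(1 - 2 * r))⁻¹) := by
  have h0 : 0 < 1 - 2 * r := by linarith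
  have hu' : (0 : ℝ) < u := by positivity
  let q : ℝ≥0 := ⟨u / (1 - 2 * r), by positivity⟩
  have hq : (q : ℝ) = u / (1 - 2 * r) := rfl
  have hq0 : q ≠ 0 := by rw [← NNReal.coe_ne_zero, hq]; positivity
  rw [gaussianReal_of_var_ne_zero _ hu,
      lintegral_withDensity_eq_lintegral_mul _ (measurable_gaussianPDF _ _) (by fun_prop)]
  have e (x : ℝ) : (gaussianPDF 0 u * fun x => ENNReal.ofReal (Real.exp (r * (x ^ 2 / u)))) x =
      ENNReal.ofReal ((√(1 - 2 * r))⁻¹) * gaussianPDF 0 q x := by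
    rw [Pi.mul_apply, gaussianPDF, gaussianPDF, ← ENNReal.ofReal_mul (gaussianPDFReal_nonneg _ _ _),
      ← ENNReal.ofReal_mul (by positivity)]
    congr 1
    simp only [gaussianPDFReal]
    rw [mul_assoc, ← Real.exp_add, ← mul_assoc, ← mul_inv, ← Real.sqrt_mul h0.le, hq]
    congr 1
    · congr 2
      field_simp
    · congr 1
      field_simp
      ring
  simp only [e]
  rw [lintegral_const_mul' _ _ (by simp), lintegral_gaussianPDF_eq_one _ hq0, mul_one]

/-- The product equals (1 - 4s²)^(-1/4). For |s| ≤ 1/4 the inequality log y ≥ 1 - 1/y at y = 1 - 4s²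
gives log y ≥ -8s², whence the exponent 2s². -/
theorem inv_sqrt_mul_inv_sqrt_rpow_le {s : ℝ} (hs : |s| ≤ 1 / 4) :
    ((√(1 + 2 * s))⁻¹) ^ (1 / 2 : ℝ) * ((√(1 - 2 * s))⁻¹) ^ (1 / 2 : ℝ) ≤ Real.exp (2 * s ^ 2) := by
  obtain ⟨h1, h2⟩ := abs_le.1 hs
  have hp : 0 < 1 + 2 * s := by linarith
  have hm : 0 < 1 - 2 * s := by linarith
  have hlog {x : ℝ} (hx : 0 < x) : ((√x)⁻¹) ^ (1 / 2 : ℝ) = Real.exp (-(1 / 4) * Real.log x) := by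
    rw [Real.rpow_def_of_pos (by positivity), Real.log_inv, Real.log_sqrt hx.le]
    congr 1; ring
  rw [hlog hp, hlog hm, ← Real.exp_add, Real.exp_le_exp]
  have hsq : s ^ 2 ≤ 1 / 16 := by nlinarith
  have hprod : Real.log (1 + 2 * s) + Real.log (1 - 2 * s) = Real.log (1 - 4 * s ^ 2) := by
    rw [← Real.log_mul hp.ne' hm.ne']; congr 1; ring
  have h4 : 0 < 1 - 4 * s ^ 2 := by linarith
  have := Real.one_sub_inv_le_log_of_pos h4
  have h5 : (1 - 4 * s ^ 2)⁻¹ ≤ 1 + 8 * s ^ 2 := by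
    rw [inv_le_iff_one_le_mul₀ h4]
    nlinarith [sq_nonneg s]
  linarith

/-- The moment generating function of a Gaussian information density: `U` and `T` may have any
joint law with Gaussian marginals. -/
theorem lintegral_exp_gaussian_information_le {Ω : Type*} [MeasurableSpace Ω] (μ : Measure Ω)
    {U T : Ω → ℝ} (hU : Measurable U) (hT : Measurable T) {u σ : ℝ≥0} (hu : u ≠ 0) (hσ : σ ≠ 0)
    (hUl : μ.map U = gaussianReal 0 u) (hTl : μ.map T = gaussianReal 0 σ) {s : ℝ}
    (hs : |s| ≤ 1 / 4) :
    ∫⁻ ω, ENNReal.ofReal (Real.exp (s * (1 / 2 * Real.log (σ / u) - U ω ^ 2 / (2 * u) +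
        T ω ^ 2 / (2 * σ)))) ∂μ ≤
      ENNReal.ofReal (Real.exp (s * (1 / 2 * Real.log (σ / u)) + 2 * s ^ 2)) := by
  obtain ⟨h1, h2⟩ := abs_le.1 hs
  let F : Ω → ℝ≥0∞ := fun ω => ENNReal.ofReal (Real.exp (-s * (U ω ^ 2 / u) / 2))
  let G : Ω → ℝ≥0∞ := fun ω => ENNReal.ofReal (Real.exp (s * (T ω ^ 2 / σ) / 2))
  have e (ω : Ω) : ENNReal.ofReal (Real.exp (s * (1 / 2 * Real.log (σ / u) - U ω ^ 2 / (2 * u) +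
        T ω ^ 2 / (2 * σ)))) =
      ENNReal.ofReal (Real.exp (s * (1 / 2 * Real.log (σ / u)))) * (F * G) ω := by
    simp only [F, G, Pi.mul_apply]
    rw [← ENNReal.ofReal_mul (by positivity), ← ENNReal.ofReal_mul (by positivity),
      ← Real.exp_add, ← Real.exp_add]
    congr 2
    ring
  simp only [e]
  rw [lintegral_const_mul' _ _ (by simp), Real.exp_add, ENNReal.ofReal_mul (by positivity)]
  refine mul_le_mul_right ?_ _
  have hsq (y : ℝ) : ENNReal.ofReal (Real.exp (y / 2)) ^ (2 : ℝ) = ENNReal.ofReal (Real.exp y) := by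
    rw [ENNReal.ofReal_rpow_of_nonneg (by positivity) (by norm_num), ← Real.exp_mul]
    congr 2; ring
  have hF : ∫⁻ ω, F ω ^ (2 : ℝ) ∂μ = ENNReal.ofReal ((√(1 + 2 * s))⁻¹) := by
    simp only [F, hsq]
    rw [← lintegral_map (f := fun x => ENNReal.ofReal (Real.exp (-s * (x ^ 2 / u)))) (by fun_prop)
      hU, hUl, lintegral_exp_sq_gaussianReal hu (by linarith)]
    congr 4; ring
  have hG : ∫⁻ ω, G ω ^ (2 : ℝ) ∂μ = ENNReal.ofReal ((√(1 - 2 * s))⁻¹) := by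
    simp only [G, hsq]
    rw [← lintegral_map (f := fun x => ENNReal.ofReal (Real.exp (s * (x ^ 2 / σ)))) (by fun_prop)
      hT, hTl, lintegral_exp_sq_gaussianReal hσ (by linarith)]
  -- Cauchy–Schwarz separates the squares of `U` and `T`, so their dependence never matters. Each
  -- factor is then a Gaussian moment of a square.
  refine (ENNReal.lintegral_mul_le_Lp_mul_Lq μ Real.HolderConjugate.two_two (by fun_prop)
    (by fun_prop)).trans ?_
  rw [hF, hG, ENNReal.ofReal_rpow_of_nonneg (by positivity) (by norm_num),
    ENNReal.ofReal_rpow_of_nonneg (by positivity) (by norm_num),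
    ← ENNReal.ofReal_mul (by positivity)]
  exact ENNReal.ofReal_le_ofReal (inv_sqrt_mul_inv_sqrt_rpow_le hs)

theorem map_add_prod_gaussianReal {α β : Type*} [MeasurableSpace α] [MeasurableSpace β]
    (μ : Measure α) (ν : Measure β) [IsProbabilityMeasure μ] [IsProbabilityMeasure ν]
    {X : α → ℝ} {Y : β → ℝ} (hX : Measurable X) (hY : Measurable Y) {p q : ℝ≥0}
    (hXl : μ.map X = gaussianReal 0 p) (hYl : ν.map Y = gaussianReal 0 q) :
    (μ.prod ν).map (fun ω => X ω.1 + Y ω.2) = gaussianReal 0 (p + q) := by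
  have h1 : (μ.prod ν).map (fun ω => X ω.1) = gaussianReal 0 p := by
    rw [← hXl, ← Function.comp_def X, ← Measure.map_map hX measurable_fst,
      Measure.map_fst_prod, measure_univ, one_smul]
  have h2 : (μ.prod ν).map (fun ω => Y ω.2) = gaussianReal 0 q := by
    rw [← hYl, ← Function.comp_def Y, ← Measure.map_map hY measurable_snd,
      Measure.map_snd_prod, measure_univ, one_smul]
  have := gaussianReal_add_gaussianReal_of_indepFun (indepFun_prod (μ := μ) (ν := ν) hX hY) h1 h2
  rwa [add_zero] at this

theorem map_linear_prod_gaussianReal {p₁ p₂ v q : ℝ≥0} {c₁ c₂ : ℝ}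
    (hq : (q : ℝ) = c₁ ^ 2 * p₁ + c₂ ^ 2 * p₂ + v) :
    ((gaussianReal 0 p₁).prod ((gaussianReal 0 p₂).prod (gaussianReal 0 v))).map
      (fun ω => c₁ * ω.1 + (c₂ * ω.2.1 + ω.2.2)) = gaussianReal 0 q := by
  have hl (p : ℝ≥0) (c : ℝ) : (gaussianReal 0 p).map (fun x => c * x) =
      gaussianReal 0 (.mk (c ^ 2) (sq_nonneg _) * p) := by
    rw [gaussianReal_map_const_mul, mul_zero]
  have h := map_add_prod_gaussianReal (gaussianReal 0 p₁)
    ((gaussianReal 0 p₂).prod (gaussianReal 0 v)) (X := fun x => c₁ * x)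
    (Y := fun ω => c₂ * ω.1 + ω.2) (by fun_prop) (by fun_prop) (hl p₁ c₁)
    (map_add_prod_gaussianReal _ _ (X := fun x => c₂ * x) (Y := fun x => x) (by fun_prop)
      (by fun_prop) (hl p₂ c₂) Measure.map_id')
  rw [h]
  congr 1
  rw [← NNReal.coe_inj, hq]
  push_cast
  ring

/-- One channel use: the exponential moment of the information density of
`z = a x + b y + N(0, v)` given `α x + β y`. -/
theorem lintegral_gaussianRatio_rpow_le {p₁ p₂ v u σ : ℝ≥0} {a b α β s : ℝ} (hv : v ≠ 0)
    (hσ : (σ : ℝ) = a ^ 2 * p₁ + b ^ 2 * p₂ + v)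
    (hu : (u : ℝ) = (a - α) ^ 2 * p₁ + (b - β) ^ 2 * p₂ + v) (hs : |s| ≤ 1 / 4) :
    ∫⁻ x, ∫⁻ y, ∫⁻ z, (gaussianRatio v σ (a * x + b * y) z *
        (gaussianRatio u σ (α * x + β * y) z) ^ s : ℝ≥0) ∂(gaussianReal 0 σ)
        ∂(gaussianReal 0 p₂) ∂(gaussianReal 0 p₁) ≤
      ENNReal.ofReal (Real.exp (s * (1 / 2 * Real.log (σ / u)) + 2 * s ^ 2)) := by
  have hv' : (0 : ℝ) < v := by positivity
  have hσ0 : σ ≠ 0 := by rw [← NNReal.coe_ne_zero, hσ]; positivity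
  have hu0 : u ≠ 0 := by rw [← NNReal.coe_ne_zero, hu]; positivity
  have h1 (x y : ℝ) : ∫⁻ z, (gaussianRatio v σ (a * x + b * y) z *
        (gaussianRatio u σ (α * x + β * y) z) ^ s : ℝ≥0) ∂(gaussianReal 0 σ) =
      ∫⁻ w, ((gaussianRatio u σ (α * x + β * y) (a * x + (b * y + w))) ^ s : ℝ≥0)
        ∂(gaussianReal 0 v) := by
    have e : gaussianReal (a * x + b * y) v =
        (gaussianReal 0 v).map (fun w => a * x + b * y + w) := by
      rw [gaussianReal_map_const_add, zero_add]
    have e2 := lintegral_map (μ := gaussianReal 0 v)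
      (f := fun z => ((gaussianRatio u σ (α * x + β * y) z) ^ s : ℝ≥0))
      (g := fun w => a * x + b * y + w) (by fun_prop) (by fun_prop)
    simp only [add_assoc] at e2 e
    rw [← e2, ← e, ← add_zero (b * y), add_zero (b * y),
      gaussianReal_eq_withDensity_gaussianRatio hv hσ0,
      lintegral_withDensity_eq_lintegral_mul _ (by fun_prop) (by fun_prop)]
    simp
  simp only [h1]
  have h2 : ∫⁻ x, ∫⁻ y, ∫⁻ w, ((gaussianRatio u σ (α * x + β * y) (a * x + (b * y + w))) ^ s : ℝ≥0)
        ∂(gaussianReal 0 v) ∂(gaussianReal 0 p₂) ∂(gaussianReal 0 p₁) =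
      ∫⁻ ω, ((gaussianRatio u σ (α * ω.1 + β * ω.2.1) (a * ω.1 + (b * ω.2.1 + ω.2.2))) ^ s : ℝ≥0)
        ∂((gaussianReal 0 p₁).prod ((gaussianReal 0 p₂).prod (gaussianReal 0 v))) := by
    rw [lintegral_prod _ (by fun_prop)]
    refine lintegral_congr fun x => ?_
    rw [lintegral_prod _ (by fun_prop)]
  rw [h2]
  -- The information density depends only on the output and on the residual left after removing α x
  -- + β y. These are centred Gaussians of variances σ and u.
  have h3 (ω : ℝ × ℝ × ℝ) :
      (((gaussianRatio u σ (α * ω.1 + β * ω.2.1) (a * ω.1 + (b * ω.2.1 + ω.2.2))) ^ s : ℝ≥0) :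
        ℝ≥0∞) = ENNReal.ofReal (Real.exp (s * (1 / 2 * Real.log (σ / u) -
          ((a - α) * ω.1 + ((b - β) * ω.2.1 + ω.2.2)) ^ 2 / (2 * u) +
          (a * ω.1 + (b * ω.2.1 + ω.2.2)) ^ 2 / (2 * σ)))) := by
    rw [← ENNReal.ofReal_coe_nnreal, NNReal.coe_rpow, coe_gaussianRatio hu0 hσ0, ← Real.exp_mul]
    congr 2
    ring
  simp only [h3]
  exact lintegral_exp_gaussian_information_le _ (by fun_prop) (by fun_prop) hu0 hσ0
    (map_linear_prod_gaussianReal hu) (map_linear_prod_gaussianReal hσ) hs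

end Gaussian

/-! ### Gaussian blocks with letter-dependent variances. -/

section GaussianVector

variable {n : ℕ}

/-- The law of independent centred Gaussian letters with variances `p`. -/
def gaussianVec (p : Fin n → ℝ≥0) : Measure (Fin n → ℝ) := Measure.pi fun j => gaussianReal 0 (p j)

instance (p : Fin n → ℝ≥0) : IsProbabilityMeasure (gaussianVec p) := by
  unfold gaussianVec; infer_instance

/-- The density of the product of the `N(t j, u j)` with respect to the product of the
`N(0, σ j)`. -/
def gaussianVecRatio (u σ : Fin n → ℝ≥0) (t z : Fin n → ℝ) : ℝ≥0 :=
  ∏ j, gaussianRatio (u j) (σ j) (t j) (z j)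

@[fun_prop]
theorem measurable_gaussianVecRatio {α : Type*} [MeasurableSpace α] (u σ : Fin n → ℝ≥0)
    {f g : α → Fin n → ℝ} (hf : Measurable f) (hg : Measurable g) :
    Measurable fun x => gaussianVecRatio u σ (f x) (g x) := by
  unfold gaussianVecRatio
  fun_prop

theorem gaussianVecRatio_ne_zero {u σ : Fin n → ℝ≥0} (hu : ∀ j, u j ≠ 0) (hσ : ∀ j, σ j ≠ 0)
    (t z : Fin n → ℝ) : gaussianVecRatio u σ t z ≠ 0 :=
  Finset.prod_ne_zero_iff.2 fun j _ => (gaussianRatio_pos (hu j) (hσ j) _ _).ne'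

theorem gaussianVecRatio_self {σ : Fin n → ℝ≥0} (hσ : ∀ j, σ j ≠ 0) (z : Fin n → ℝ) :
    gaussianVecRatio σ σ 0 z = 1 :=
  Finset.prod_eq_one fun j _ => gaussianRatio_self (hσ j) _

theorem pi_gaussianReal_eq_withDensity {u σ : Fin n → ℝ≥0} (hu : ∀ j, u j ≠ 0)
    (hσ : ∀ j, σ j ≠ 0) (t : Fin n → ℝ) :
    (Measure.pi fun j => gaussianReal (t j) (u j)) =
      (gaussianVec σ).withDensity fun z => (gaussianVecRatio u σ t z : ℝ≥0∞) := by
  have e (j) := gaussianReal_eq_withDensity_gaussianRatio (hu j) (hσ j) (t j)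
  have hfin (j) : SigmaFinite ((gaussianReal 0 (σ j)).withDensity
      fun z => (gaussianRatio (u j) (σ j) (t j) z : ℝ≥0∞)) := by rw [← e j]; infer_instance
  simp only [e]
  rw [pi_withDensity_eq _ (fun j => by fun_prop)]
  simp [gaussianVec, gaussianVecRatio]

theorem lintegral_gaussianVecRatio_one {u σ : Fin n → ℝ≥0} (hu : ∀ j, u j ≠ 0)
    (hσ : ∀ j, σ j ≠ 0) (t : Fin n → ℝ) :
    ∫⁻ z, gaussianVecRatio u σ t z ∂(gaussianVec σ) = 1 := by
  have h : (Measure.pi fun j => gaussianReal (t j) (u j)) Set.univ = 1 := measure_univ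
  rwa [pi_gaussianReal_eq_withDensity hu hσ, withDensity_apply _ .univ, setLIntegral_univ] at h

theorem lintegral_gaussianVecRatio {p v q σ : Fin n → ℝ≥0} {b : ℝ} (hv : ∀ j, v j ≠ 0)
    (hq : ∀ j, (q j : ℝ) = b ^ 2 * p j + v j) (t z : Fin n → ℝ) :
    ∫⁻ x, gaussianVecRatio v σ (fun j => t j + b * x j) z ∂(gaussianVec p) =
      gaussianVecRatio q σ t z := by
  simp only [gaussianVecRatio, gaussianVec, ENNReal.ofNNReal_finsetProd]
  rw [lintegral_pi_prod_eq_prod (fun j => gaussianReal 0 (p j))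
    (f := fun j x => (gaussianRatio (v j) (σ j) (t j + b * x) (z j) : ℝ≥0∞))
    (fun j => by fun_prop)]
  exact Finset.prod_congr rfl fun j _ => lintegral_gaussianRatio (hv j) (hq j) _ _

/-- Independence of the letters factorizes the moment. The variances may change from letter to
letter, as time sharing requires. -/
theorem lintegral_gaussianVecRatio_rpow_le {p₁ p₂ v u σ : Fin n → ℝ≥0} {a b α β s : ℝ}
    (hv : ∀ j, v j ≠ 0) (hσ : ∀ j, (σ j : ℝ) = a ^ 2 * p₁ j + b ^ 2 * p₂ j + v j)
    (hu : ∀ j, (u j : ℝ) = (a - α) ^ 2 * p₁ j + (b - β) ^ 2 * p₂ j + v j) (hs : |s| ≤ 1 / 4) :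
    ∫⁻ x, ∫⁻ y, ∫⁻ z, (gaussianVecRatio v σ (fun j => a * x j + b * y j) z *
        (gaussianVecRatio u σ (fun j => α * x j + β * y j) z) ^ s : ℝ≥0) ∂(gaussianVec σ)
        ∂(gaussianVec p₂) ∂(gaussianVec p₁) ≤
      ENNReal.ofReal (Real.exp (s * ∑ j, 1 / 2 * Real.log (σ j / u j) + n * (2 * s ^ 2))) := by
  let F : Fin n → ℝ → ℝ → ℝ → ℝ≥0 := fun j x y z => gaussianRatio (v j) (σ j) (a * x + b * y) z *
    (gaussianRatio (u j) (σ j) (α * x + β * y) z) ^ s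
  have hF (j) : Measurable fun q : (ℝ × ℝ) × ℝ => F j q.1.1 q.1.2 q.2 := by fun_prop
  have hF1 (j) : Measurable fun q : ℝ × ℝ => ∫⁻ z, (F j q.1 q.2 z : ℝ≥0∞) ∂(gaussianReal 0 (σ j)) :=
    Measurable.lintegral_prod_right' (f := fun q : (ℝ × ℝ) × ℝ => (F j q.1.1 q.1.2 q.2 : ℝ≥0∞))
      (hF j).coe_nnreal_ennreal
  have hF2 (j) : Measurable fun x : ℝ => ∫⁻ y, ∫⁻ z, (F j x y z : ℝ≥0∞) ∂(gaussianReal 0 (σ j))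
      ∂(gaussianReal 0 (p₂ j)) := (hF1 j).lintegral_prod_right'
  have e (x y z : Fin n → ℝ) : ((gaussianVecRatio v σ (fun j => a * x j + b * y j) z *
        (gaussianVecRatio u σ (fun j => α * x j + β * y j) z) ^ s : ℝ≥0) : ℝ≥0∞) =
      ∏ j, (F j (x j) (y j) (z j) : ℝ≥0∞) := by
    simp only [gaussianVecRatio, F, ← ENNReal.ofNNReal_finsetProd]
    rw [Finset.prod_mul_distrib, NNReal.finsetProd_rpow]
  simp only [e, gaussianVec]
  have e1 (x y : Fin n → ℝ) := lintegral_pi_prod_eq_prod (fun j => gaussianReal 0 (σ j))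
    (f := fun j z => (F j (x j) (y j) z : ℝ≥0∞)) (fun j => by fun_prop)
  have e2 (x : Fin n → ℝ) := lintegral_pi_prod_eq_prod (fun j => gaussianReal 0 (p₂ j))
    (f := fun j y => ∫⁻ z, (F j (x j) y z : ℝ≥0∞) ∂(gaussianReal 0 (σ j)))
    (fun j => (hF1 j).comp (f := fun y => (x j, y)) (by fun_prop))
  have e3 := lintegral_pi_prod_eq_prod (fun j => gaussianReal 0 (p₁ j))
    (f := fun j x => ∫⁻ y, ∫⁻ z, (F j x y z : ℝ≥0∞) ∂(gaussianReal 0 (σ j))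
      ∂(gaussianReal 0 (p₂ j))) hF2
  simp only [e1, e2, e3]
  refine (Finset.prod_le_prod' fun j _ => lintegral_gaussianRatio_rpow_le (hv j) (hσ j) (hu j)
    hs).trans (le_of_eq ?_)
  rw [← ENNReal.ofReal_prod_of_nonneg fun j _ => by positivity, ← Real.exp_sum,
    Finset.sum_add_distrib, ← Finset.mul_sum]
  simp

end GaussianVector

/-! ### The code built from two codebooks and its error probability. -/

section CodebookCode

open InformationTheory

theorem lintegral_uniformOn_univ {ι : Type*} [MeasurableSpace ι] [MeasurableSingletonClass ι]
    [Fintype ι] (f : ι → ℝ≥0∞) :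
    ∫⁻ i, f i ∂(uniformOn (Set.univ : Set ι)) = (Fintype.card ι : ℝ≥0∞)⁻¹ * ∑ i, f i := by
  rw [uniformOn, ProbabilityTheory.cond, Measure.restrict_univ, lintegral_smul_measure,
    lintegral_count, tsum_fintype, Measure.count_univ, ENat.card_eq_coe_fintype_card, smul_eq_mul]
  simp

variable {n M₁ L₁ M₂ L₂ : ℕ}

/-- The stochastic encoder which sends a uniformly chosen codeword of the message. -/
def codebookKernel {M L : ℕ} (x : Fin M × Fin L → Fin n → ℝ) : Kernel (Fin M) (Fin n → ℝ) where
  toFun m := (uniformOn (Set.univ : Set (Fin L))).map fun l => x (m, l)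
  measurable' := measurable_of_countable _

theorem isMarkovKernel_codebookKernel {M L : ℕ} (hL : 0 < L) (x : Fin M × Fin L → Fin n → ℝ) :
    IsMarkovKernel (codebookKernel x) := by
  have : Nonempty (Fin L) := ⟨⟨0, hL⟩⟩
  have : IsProbabilityMeasure (uniformOn (Set.univ : Set (Fin L))) :=
    isProbabilityMeasure_uniformOn Set.finite_univ Set.univ_nonempty
  exact ⟨fun m => Measure.isProbabilityMeasure_map (measurable_of_countable _).aemeasurable⟩

theorem lintegral_codebookKernel {M L : ℕ} (x : Fin M × Fin L → Fin n → ℝ) (m : Fin M)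
    {f : (Fin n → ℝ) → ℝ≥0∞} (hf : Measurable f) :
    ∫⁻ y, f y ∂(codebookKernel x m) = (L : ℝ≥0∞)⁻¹ * ∑ l, f (x (m, l)) := by
  change ∫⁻ y, f y ∂((uniformOn (Set.univ : Set (Fin L))).map fun l => x (m, l)) = _
  rw [lintegral_map hf (measurable_of_countable _), lintegral_uniformOn_univ, Fintype.card_fin]

theorem lintegral_compProd_codebookKernel {M L : ℕ} (hM : 0 < M) (hL : 0 < L)
    (x : Fin M × Fin L → Fin n → ℝ) {f : Fin M × (Fin n → ℝ) → ℝ≥0∞} (hf : Measurable f) :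
    ∫⁻ p, f p ∂((uniformOn (Set.univ : Set (Fin M))) ⊗ₘ codebookKernel x) =
      (Fintype.card (Fin M × Fin L) : ℝ≥0∞)⁻¹ * ∑ i, f (i.1, x i) := by
  have : Nonempty (Fin M) := ⟨⟨0, hM⟩⟩
  have : IsProbabilityMeasure (uniformOn (Set.univ : Set (Fin M))) :=
    isProbabilityMeasure_uniformOn Set.finite_univ Set.univ_nonempty
  have := isMarkovKernel_codebookKernel hL x
  rw [Measure.lintegral_compProd hf, lintegral_uniformOn_univ]
  have e (m : Fin M) := lintegral_codebookKernel x m (f := fun y => f (m, y)) (by fun_prop)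
  simp only [e]
  rw [← Finset.mul_sum, ← mul_assoc, Fintype.sum_prod_type, Fintype.card_prod, Fintype.card_fin,
    Fintype.card_fin, Nat.cast_mul, ENNReal.mul_inv (by simp) (by simp)]

/-- The code with codebooks `x₁, x₂` whose users subtract their own contribution from the received
block before applying the decoders `d₁, d₂`. -/
def codebookCode (G : GaussianTWWC) (hM₁ : 0 < M₁) (hL₁ : 0 < L₁) (hM₂ : 0 < M₂) (hL₂ : 0 < L₂)
    (x₁ : Fin M₁ × Fin L₁ → Fin n → ℝ) (x₂ : Fin M₂ × Fin L₂ → Fin n → ℝ)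
    {d₁ : (Fin n → ℝ) → Fin M₁} {d₂ : (Fin n → ℝ) → Fin M₂} (hd₁ : Measurable d₁)
    (hd₂ : Measurable d₂) : NonAdaptiveCode n where
  M₁ := M₁
  M₂ := M₂
  M₁_pos := hM₁
  M₂_pos := hM₂
  φ₁ := codebookKernel x₁
  φ₂ := codebookKernel x₂
  markov₁ := isMarkovKernel_codebookKernel hL₁ x₁
  markov₂ := isMarkovKernel_codebookKernel hL₂ x₂
  ψ₁ := fun p => d₂ fun j => p.2 j - G.a₁ * p.1 j
  ψ₂ := fun p => d₁ fun j => p.2 j - G.b₂ * p.1 j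
  measurable_ψ₁ := hd₂.comp (by fun_prop)
  measurable_ψ₂ := hd₁.comp (by fun_prop)

/-- The total mass is read off from a Gaussian marginal. -/
instance (G : GaussianTWWC) : IsProbabilityMeasure G.noise := ⟨by
  have h : (G.noise.map fun t => t.1) Set.univ = 1 := by rw [G.noise_fst]; exact measure_univ
  rwa [Measure.map_apply (by fun_prop) .univ, Set.preimage_univ] at h⟩

variable (G : GaussianTWWC) (x₁ : Fin M₁ × Fin L₁ → Fin n → ℝ) (x₂ : Fin M₂ × Fin L₂ → Fin n → ℝ)
  {d₁ : (Fin n → ℝ) → Fin M₁} {d₂ : (Fin n → ℝ) → Fin M₂} (hd₁ : Measurable d₁)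
  (hd₂ : Measurable d₂)

theorem peakConstraint_codebookCode (hM₁ : 0 < M₁) (hL₁ : 0 < L₁) (hM₂ : 0 < M₂) (hL₂ : 0 < L₂)
    {c₁ c₂ : ℝ}
    (h₁ : ∀ i, (1 / (n : ℝ)) * ∑ j, x₁ i j ^ 2 ≤ c₁)
    (h₂ : ∀ i, (1 / (n : ℝ)) * ∑ j, x₂ i j ^ 2 ≤ c₂) :
    (codebookCode G hM₁ hL₁ hM₂ hL₂ x₁ x₂ hd₁ hd₂).PeakConstraint c₁ c₂ := by
  have key {M L : ℕ} (x : Fin M × Fin L → Fin n → ℝ) {c : ℝ}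
      (h : ∀ i, (1 / (n : ℝ)) * ∑ j, x i j ^ 2 ≤ c) (m : Fin M) :
      ∀ᵐ y ∂(codebookKernel x m), (1 / (n : ℝ)) * ∑ j, y j ^ 2 ≤ c := by
    change ∀ᵐ y ∂((uniformOn (Set.univ : Set (Fin L))).map fun l => x (m, l)), _
    rw [ae_map_iff (measurable_of_countable _).aemeasurable
      (measurableSet_le (by fun_prop) measurable_const)]
    exact ae_of_all _ fun l => h (m, l)
  exact ⟨key x₁ h₁, key x₂ h₂⟩

/-- The law of messages, codewords and noise of a codebook code. -/
def codebookLaw : Measure ((Fin M₁ × (Fin n → ℝ)) × (Fin M₂ × (Fin n → ℝ)) ×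
    (Fin n → ℝ × ℝ × ℝ)) :=
  (uniformOn (Set.univ : Set (Fin M₁)) ⊗ₘ codebookKernel x₁).prod
    ((uniformOn (Set.univ : Set (Fin M₂)) ⊗ₘ codebookKernel x₂).prod
      (Measure.pi fun _ : Fin n => G.noise))

theorem lintegral_codebookLaw (hM₁ : 0 < M₁) (hL₁ : 0 < L₁) (hM₂ : 0 < M₂) (hL₂ : 0 < L₂)
    {F : (Fin M₁ × (Fin n → ℝ)) × (Fin M₂ × (Fin n → ℝ)) × (Fin n → ℝ × ℝ × ℝ) → ℝ≥0∞}
    (hF : Measurable F) :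
    ∫⁻ ω, F ω ∂(codebookLaw G x₁ x₂) =
      (Fintype.card (Fin M₁ × Fin L₁) : ℝ≥0∞)⁻¹ * ∑ i,
        (Fintype.card (Fin M₂ × Fin L₂) : ℝ≥0∞)⁻¹ * ∑ k,
          ∫⁻ t, F ((i.1, x₁ i), (k.1, x₂ k), t) ∂(Measure.pi fun _ : Fin n => G.noise) := by
  have : Nonempty (Fin M₁) := ⟨⟨0, hM₁⟩⟩
  have : IsProbabilityMeasure (uniformOn (Set.univ : Set (Fin M₁))) :=
    isProbabilityMeasure_uniformOn Set.finite_univ Set.univ_nonempty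
  have : Nonempty (Fin M₂) := ⟨⟨0, hM₂⟩⟩
  have : IsProbabilityMeasure (uniformOn (Set.univ : Set (Fin M₂))) :=
    isProbabilityMeasure_uniformOn Set.finite_univ Set.univ_nonempty
  have := isMarkovKernel_codebookKernel hL₁ x₁
  have := isMarkovKernel_codebookKernel hL₂ x₂
  unfold codebookLaw
  have hF' : Measurable fun q : ((Fin M₁ × (Fin n → ℝ)) × (Fin M₂ × (Fin n → ℝ))) ×
      (Fin n → ℝ × ℝ × ℝ) => F (q.1.1, q.1.2, q.2) := hF.comp (by fun_prop)
  have hF1 := hF'.lintegral_prod_right' (ν := Measure.pi fun _ : Fin n => G.noise)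
  rw [lintegral_prod _ hF.aemeasurable]
  have e (p : Fin M₁ × (Fin n → ℝ)) :
      ∫⁻ q, F (p, q) ∂((uniformOn (Set.univ : Set (Fin M₂)) ⊗ₘ codebookKernel x₂).prod
        (Measure.pi fun _ : Fin n => G.noise)) =
      (Fintype.card (Fin M₂ × Fin L₂) : ℝ≥0∞)⁻¹ * ∑ k,
          ∫⁻ t, F (p, (k.1, x₂ k), t) ∂(Measure.pi fun _ : Fin n => G.noise) := by
    rw [lintegral_prod (fun q => F (p, q)) (by fun_prop)]
    exact lintegral_compProd_codebookKernel hM₂ hL₂ x₂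
      (f := fun q => ∫⁻ t, F (p, q, t) ∂(Measure.pi fun _ : Fin n => G.noise))
      (hF1.comp measurable_prodMk_left)
  simp only [e]
  rw [lintegral_compProd_codebookKernel hM₁ hL₁ x₁]
  refine Measurable.const_mul (Finset.measurable_fun_sum _ fun k _ => ?_) _
  exact hF1.comp (f := fun p => (p, (k.1, x₂ k))) (by fun_prop)

theorem map_pi_noise (m : Fin n → ℝ) {f : ℝ × ℝ × ℝ → ℝ} (hf : Measurable f) {v : ℝ≥0}
    (h : G.noise.map f = gaussianReal 0 v) :
    (Measure.pi fun _ : Fin n => G.noise).map (fun t j => m j + f (t j)) =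
      Measure.pi fun j => gaussianReal (m j) v := by
  have e (j : Fin n) : G.noise.map (fun t => m j + f t) = gaussianReal (m j) v := by
    rw [← Function.comp_def (fun y => m j + y) f, ← Measure.map_map (by fun_prop) hf, h,
      gaussianReal_map_const_add, zero_add]
  have hσ (j : Fin n) : SigmaFinite (G.noise.map (fun t => m j + f t)) := by
    rw [e]; infer_instance
  rw [Measure.pi_map_pi (μ := fun _ : Fin n => G.noise) (f := fun j t => m j + f t)
    (fun j => by fun_prop)]
  simp only [e]

/-- Once a user's own signal is subtracted, its output depends only on the other user's codeword and
its own noise. The union bound then involves only the marginal laws of the noise, so no joint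
condition on the noise triple is needed. -/
theorem errorProb_codebookCode_le (hM₁ : 0 < M₁) (hL₁ : 0 < L₁) (hM₂ : 0 < M₂) (hL₂ : 0 < L₂) :
    (codebookCode G hM₁ hL₁ hM₂ hL₂ x₁ x₂ hd₁ hd₂).errorProb G ≤
      (Fintype.card (Fin M₁ × Fin L₁) : ℝ≥0∞)⁻¹ * ∑ i,
        (Measure.pi fun j => gaussianReal (G.a₂ * x₁ i j) G.v₂) {y | d₁ y ≠ i.1} +
      (Fintype.card (Fin M₂ × Fin L₂) : ℝ≥0∞)⁻¹ * ∑ k,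
        (Measure.pi fun j => gaussianReal (G.b₁ * x₂ k j) G.v₁) {y | d₂ y ≠ k.1} := by
  have hN₁ : (Fintype.card (Fin M₁ × Fin L₁) : ℝ≥0∞) ≠ 0 := by
    simp [hM₁.ne', hL₁.ne']
  have hN₂ : (Fintype.card (Fin M₂ × Fin L₂) : ℝ≥0∞) ≠ 0 := by
    simp [hM₂.ne', hL₂.ne']
  let E₁ : Set ((Fin M₁ × (Fin n → ℝ)) × (Fin M₂ × (Fin n → ℝ)) × (Fin n → ℝ × ℝ × ℝ)) :=
    {ω | d₁ (fun j => G.a₂ * ω.1.2 j + (ω.2.2 j).2.1) ≠ ω.1.1}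
  let E₂ : Set ((Fin M₁ × (Fin n → ℝ)) × (Fin M₂ × (Fin n → ℝ)) × (Fin n → ℝ × ℝ × ℝ)) :=
    {ω | d₂ (fun j => G.b₁ * ω.2.1.2 j + (ω.2.2 j).1) ≠ ω.2.1.1}
  have hE₁ : MeasurableSet E₁ :=
    (measurableSet_eq_fun (hd₁.comp (by fun_prop)) (by fun_prop)).compl
  have hE₂ : MeasurableSet E₂ :=
    (measurableSet_eq_fun (hd₂.comp (by fun_prop)) (by fun_prop)).compl
  change codebookLaw G x₁ x₂ {ω |
    d₂ (fun j => G.a₁ * ω.1.2 j + G.b₁ * ω.2.1.2 j + (ω.2.2 j).1 - G.a₁ * ω.1.2 j) ≠ ω.2.1.1 ∨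
    d₁ (fun j => G.a₂ * ω.1.2 j + G.b₂ * ω.2.1.2 j + (ω.2.2 j).2.1 - G.b₂ * ω.2.1.2 j) ≠
      ω.1.1} ≤ _
  have hset : {ω : (Fin M₁ × (Fin n → ℝ)) × (Fin M₂ × (Fin n → ℝ)) × (Fin n → ℝ × ℝ × ℝ) |
    d₂ (fun j => G.a₁ * ω.1.2 j + G.b₁ * ω.2.1.2 j + (ω.2.2 j).1 - G.a₁ * ω.1.2 j) ≠ ω.2.1.1 ∨
    d₁ (fun j => G.a₂ * ω.1.2 j + G.b₂ * ω.2.1.2 j + (ω.2.2 j).2.1 - G.b₂ * ω.2.1.2 j) ≠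
      ω.1.1} = E₁ ∪ E₂ := by
    ext ω
    have e1 (j : Fin n) : G.a₁ * ω.1.2 j + G.b₁ * ω.2.1.2 j + (ω.2.2 j).1 - G.a₁ * ω.1.2 j =
      G.b₁ * ω.2.1.2 j + (ω.2.2 j).1 := by ring
    have e2 (j : Fin n) : G.a₂ * ω.1.2 j + G.b₂ * ω.2.1.2 j + (ω.2.2 j).2.1 - G.b₂ * ω.2.1.2 j =
      G.a₂ * ω.1.2 j + (ω.2.2 j).2.1 := by ring
    simp only [Set.mem_ofPred_eq, e1, e2, E₁, E₂, Set.mem_union]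
    exact or_comm
  rw [hset]
  refine (measure_union_le _ _).trans (add_le_add ?_ ?_)
  · rw [← lintegral_indicator_one hE₁,
      lintegral_codebookLaw G x₁ x₂ hM₁ hL₁ hM₂ hL₂ (measurable_one.indicator hE₁)]
    refine mul_le_mul_right (Finset.sum_le_sum fun i _ => ?_) _
    have hk (k : Fin M₂ × Fin L₂) : ∫⁻ t, E₁.indicator 1 ((i.1, x₁ i), (k.1, x₂ k), t)
        ∂(Measure.pi fun _ : Fin n => G.noise) =
        (Measure.pi fun j => gaussianReal (G.a₂ * x₁ i j) G.v₂) {y | d₁ y ≠ i.1} := by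
      have hm : MeasurableSet {y | d₁ y ≠ i.1} := hd₁ (measurableSet_singleton i.1).compl
      rw [← map_pi_noise G _ (f := fun t => t.2.1) (by fun_prop) G.noise_snd,
        Measure.map_apply (by fun_prop) hm, ← lintegral_indicator_one (hm.preimage (by fun_prop))]
      rfl
    simp only [hk]
    rw [Finset.sum_const, Finset.card_univ, nsmul_eq_mul, ← mul_assoc,
      ENNReal.inv_mul_cancel hN₂ (ENNReal.natCast_ne_top _), one_mul]
  · rw [← lintegral_indicator_one hE₂,
      lintegral_codebookLaw G x₁ x₂ hM₁ hL₁ hM₂ hL₂ (measurable_one.indicator hE₂)]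
    have hk (i : Fin M₁ × Fin L₁) (k : Fin M₂ × Fin L₂) :
        ∫⁻ t, E₂.indicator 1 ((i.1, x₁ i), (k.1, x₂ k), t)
        ∂(Measure.pi fun _ : Fin n => G.noise) =
        (Measure.pi fun j => gaussianReal (G.b₁ * x₂ k j) G.v₁) {y | d₂ y ≠ k.1} := by
      have hm : MeasurableSet {y | d₂ y ≠ k.1} := hd₂ (measurableSet_singleton k.1).compl
      rw [← map_pi_noise G _ (f := fun t => t.1) (by fun_prop) G.noise_fst,
        Measure.map_apply (by fun_prop) hm, ← lintegral_indicator_one (hm.preimage (by fun_prop))]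
      rfl
    simp only [hk]
    rw [Finset.sum_const, Finset.card_univ, nsmul_eq_mul, ← mul_assoc,
      ENNReal.inv_mul_cancel hN₁ (ENNReal.natCast_ne_top _), one_mul]

/-- The law of the two messages and the eavesdropper's output, in terms of densities. -/
theorem lintegral_codebookLaw_msg_output (hM₁ : 0 < M₁) (hL₁ : 0 < L₁) (hM₂ : 0 < M₂) (hL₂ : 0 < L₂)
    {σ : Fin n → ℝ≥0} (hσ : ∀ j, σ j ≠ 0)
    {F : Fin M₁ → Fin M₂ → (Fin n → ℝ) → ℝ≥0∞} (hF : ∀ m₁ m₂, Measurable (F m₁ m₂)) :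
    ∫⁻ ω, F ω.1.1 ω.2.1.1 (fun j => G.a₃ * ω.1.2 j + G.b₃ * ω.2.1.2 j + (ω.2.2 j).2.2)
        ∂(codebookLaw G x₁ x₂) =
      (Fintype.card (Fin M₁ × Fin L₁) : ℝ≥0∞)⁻¹ * ∑ i,
        (Fintype.card (Fin M₂ × Fin L₂) : ℝ≥0∞)⁻¹ * ∑ k,
          ∫⁻ z, gaussianVecRatio (fun _ => G.v₃) σ (fun j => G.a₃ * x₁ i j + G.b₃ * x₂ k j) z *
            F i.1 k.1 z ∂(gaussianVec σ) := by
  have hFm : Measurable fun q : (Fin M₁ × Fin M₂) × (Fin n → ℝ) => F q.1.1 q.1.2 q.2 :=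
    measurable_from_prod_countable_right fun q => hF q.1 q.2
  rw [lintegral_codebookLaw G x₁ x₂ hM₁ hL₁ hM₂ hL₂ (F := fun ω =>
    F ω.1.1 ω.2.1.1 (fun j => G.a₃ * ω.1.2 j + G.b₃ * ω.2.1.2 j + (ω.2.2 j).2.2))
    (hFm.comp (f := fun ω : (Fin M₁ × (Fin n → ℝ)) × (Fin M₂ × (Fin n → ℝ)) ×
      (Fin n → ℝ × ℝ × ℝ) => ((ω.1.1, ω.2.1.1),
        fun j => G.a₃ * ω.1.2 j + G.b₃ * ω.2.1.2 j + (ω.2.2 j).2.2)) (by fun_prop))]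
  have hk (i : Fin M₁ × Fin L₁) (k : Fin M₂ × Fin L₂) :
      ∫⁻ t, F i.1 k.1 (fun j => G.a₃ * x₁ i j + G.b₃ * x₂ k j + (t j).2.2)
        ∂(Measure.pi fun _ : Fin n => G.noise) =
      ∫⁻ z, gaussianVecRatio (fun _ => G.v₃) σ (fun j => G.a₃ * x₁ i j + G.b₃ * x₂ k j) z *
            F i.1 k.1 z ∂(gaussianVec σ) := by
    rw [← lintegral_map (f := F i.1 k.1)
      (g := fun t : Fin n → ℝ × ℝ × ℝ => fun j => G.a₃ * x₁ i j + G.b₃ * x₂ k j + (t j).2.2)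
      (hF _ _) (by fun_prop), map_pi_noise G (fun j => G.a₃ * x₁ i j + G.b₃ * x₂ k j)
      (f := fun t => t.2.2) (by fun_prop) G.noise_trd,
      pi_gaussianReal_eq_withDensity (u := fun _ => G.v₃) (fun _ => G.v₃_pos.ne') hσ,
      lintegral_withDensity_eq_lintegral_mul _ (by fun_prop) (hF _ _)]
    rfl
  simp only [hk]

end CodebookCode

/-! ### Leakage bounded by divergences of codebook-induced outputs. -/

section Leakage

open InformationTheory

variable {α β γ : Type*} [MeasurableSpace α] [MeasurableSpace β] [MeasurableSpace γ]
variable {ι₁ ι₂ σ₁ σ₂ : Type*} [Fintype σ₁] [Fintype σ₂]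

theorem lintegral_pairAverage_mul (Q : Measure γ) {w : α × β × γ → ℝ≥0} (hw : Measurable w)
    (e₁ : σ₁ → ι₁) (e₂ : σ₂ → ι₂) (x₁ : ι₁ → α) (x₂ : ι₂ → β) {F : γ → ℝ≥0∞}
    (hF : Measurable F) [Nonempty σ₁] [Nonempty σ₂] :
    ∫⁻ z, pairAverage (fun p => w (p.1, p.2, z)) e₁ e₂ x₁ x₂ * F z ∂Q =
      ((Fintype.card σ₁ : ℝ≥0∞)⁻¹ * (Fintype.card σ₂ : ℝ≥0∞)⁻¹) *
        ∑ a, ∑ b, ∫⁻ z, w (x₁ (e₁ a), x₂ (e₂ b), z) * F z ∂Q := by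
  have e (z : γ) : (pairAverage (fun p => w (p.1, p.2, z)) e₁ e₂ x₁ x₂ : ℝ≥0∞) * F z =
      ((Fintype.card σ₁ : ℝ≥0∞)⁻¹ * (Fintype.card σ₂ : ℝ≥0∞)⁻¹) *
        ∑ a, ∑ b, (w (x₁ (e₁ a), x₂ (e₂ b), z) : ℝ≥0∞) * F z := by
    simp only [pairAverage, ← Finset.sum_mul]
    rw [ENNReal.coe_mul, ENNReal.coe_inv (by simp), ENNReal.coe_mul,
      ENNReal.mul_inv (by simp) (by simp)]
    simp only [ENNReal.ofNNReal_finsetSum, ENNReal.coe_natCast, mul_assoc]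
  simp only [e]
  rw [lintegral_const_mul _ (by fun_prop), lintegral_finsetSum _ (fun a _ => by fun_prop)]
  congr 1
  exact Finset.sum_congr rfl fun a _ => lintegral_finsetSum _ (fun b _ => by fun_prop)

theorem lintegral_pairAverage_density (Q : Measure γ) {w : α × β × γ → ℝ≥0} (hw : Measurable w)
    (hQ : ∀ u v, ∫⁻ z, w (u, v, z) ∂Q = 1)
    (e₁ : σ₁ → ι₁) (e₂ : σ₂ → ι₂) (x₁ : ι₁ → α) (x₂ : ι₂ → β) [Nonempty σ₁] [Nonempty σ₂] :
    ∫⁻ z, pairAverage (fun p => w (p.1, p.2, z)) e₁ e₂ x₁ x₂ ∂Q = 1 := by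
  have h := lintegral_pairAverage_mul Q hw e₁ e₂ x₁ x₂ (F := fun _ => 1) measurable_const
  simp only [mul_one, hQ] at h
  rw [h]
  simp only [Finset.sum_const, Finset.card_univ, nsmul_eq_mul, mul_one]
  rw [mul_mul_mul_comm, ENNReal.inv_mul_cancel (by simp) (by simp),
    ENNReal.inv_mul_cancel (by simp) (by simp), one_mul]

theorem pairAverage_ne_zero {α β : Type*} {w : α × β → ℝ≥0} (hw : ∀ p, w p ≠ 0)
    (e₁ : σ₁ → ι₁) (e₂ : σ₂ → ι₂) (x₁ : ι₁ → α) (x₂ : ι₂ → β) [Nonempty σ₁] [Nonempty σ₂] :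
    pairAverage w e₁ e₂ x₁ x₂ ≠ 0 := by
  refine mul_ne_zero (by simp) (Finset.sum_pos (fun a _ => Finset.sum_pos (fun b _ => ?_)
    Finset.univ_nonempty) Finset.univ_nonempty).ne'
  exact pos_iff_ne_zero.2 (hw _)

variable {n M₁ L₁ M₂ L₂ : ℕ} (G : GaussianTWWC)

/-- The density of the eavesdropper's output block, given the input blocks, with respect to the
product of the `N(0, σ j)`. -/
def eveDensity (σ : Fin n → ℝ≥0) (p : (Fin n → ℝ) × (Fin n → ℝ) × (Fin n → ℝ)) : ℝ≥0 :=
  gaussianVecRatio (fun _ => G.v₃) σ (fun j => G.a₃ * p.1 j + G.b₃ * p.2.1 j) p.2.2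

@[fun_prop]
theorem measurable_eveDensity (σ : Fin n → ℝ≥0) : Measurable (eveDensity G σ) := by
  unfold eveDensity; fun_prop

theorem lintegral_eveDensity {σ : Fin n → ℝ≥0} (hσ : ∀ j, σ j ≠ 0) (u v : Fin n → ℝ) :
    ∫⁻ z, eveDensity G σ (u, v, z) ∂(gaussianVec σ) = 1 := by
  unfold eveDensity
  exact lintegral_gaussianVecRatio_one (u := fun _ => G.v₃) (fun _ => G.v₃_pos.ne') hσ
    (fun j => G.a₃ * u j + G.b₃ * v j)

theorem eveDensity_ne_zero {σ : Fin n → ℝ≥0} (hσ : ∀ j, σ j ≠ 0)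
    (p : (Fin n → ℝ) × (Fin n → ℝ) × (Fin n → ℝ)) : eveDensity G σ p ≠ 0 := by
  unfold eveDensity
  exact gaussianVecRatio_ne_zero (fun _ => G.v₃_pos.ne') hσ _ _

/-- The relative entropy, with respect to `Q`, of the eavesdropper's output law for uniformly
chosen codewords with indices in the images of `e₁` and `e₂`. -/
def eveDivergence {m l : Type*} (σ : Fin n → ℝ≥0) (e₁ : σ₁ → m) (e₂ : σ₂ → l)
    (x : (m → Fin n → ℝ) × (l → Fin n → ℝ)) : ℝ≥0∞ :=
  ∫⁻ z, ENNReal.ofReal (klFun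
    (pairAverage (fun p => eveDensity G σ (p.1, p.2, z)) e₁ e₂ x.1 x.2)) ∂(gaussianVec σ)

theorem measurable_eveDivergence {m l : Type*} [Fintype m] [Fintype l] (σ : Fin n → ℝ≥0)
    (e₁ : σ₁ → m) (e₂ : σ₂ → l) :
    Measurable (eveDivergence (n := n) G σ e₁ e₂) := by
  have : Measurable fun q : ((m → Fin n → ℝ) × (l → Fin n → ℝ)) × (Fin n → ℝ) =>
      ENNReal.ofReal (klFun (pairAverage (fun p => eveDensity G σ (p.1, p.2, q.2)) e₁ e₂
        q.1.1 q.1.2)) := by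
    unfold pairAverage; fun_prop
  exact this.lintegral_prod_right'

theorem isProbabilityMeasure_codebookLaw (hM₁ : 0 < M₁) (hL₁ : 0 < L₁) (hM₂ : 0 < M₂)
    (hL₂ : 0 < L₂) (x₁ : Fin M₁ × Fin L₁ → Fin n → ℝ) (x₂ : Fin M₂ × Fin L₂ → Fin n → ℝ) :
    IsProbabilityMeasure (codebookLaw G x₁ x₂) := by
  have : Nonempty (Fin M₁) := ⟨⟨0, hM₁⟩⟩
  have : IsProbabilityMeasure (uniformOn (Set.univ : Set (Fin M₁))) :=
    isProbabilityMeasure_uniformOn Set.finite_univ Set.univ_nonempty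
  have : Nonempty (Fin M₂) := ⟨⟨0, hM₂⟩⟩
  have : IsProbabilityMeasure (uniformOn (Set.univ : Set (Fin M₂))) :=
    isProbabilityMeasure_uniformOn Set.finite_univ Set.univ_nonempty
  have := isMarkovKernel_codebookKernel hL₁ x₁
  have := isMarkovKernel_codebookKernel hL₂ x₂
  unfold codebookLaw
  infer_instance

/-- The hypothesis `hB` says that a uniform pair of codeword indices amounts to a uniform protected
message m followed by uniform indices drawn through `e₁ m` and `e₂ m`. Different choices of these
maps give joint and individual leakage. -/
theorem mutualInfo_codebookLaw_le (hM₁ : 0 < M₁) (hL₁ : 0 < L₁) (hM₂ : 0 < M₂) (hL₂ : 0 < L₂)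
    (x₁ : Fin M₁ × Fin L₁ → Fin n → ℝ) (x₂ : Fin M₂ × Fin L₂ → Fin n → ℝ) {σ : Fin n → ℝ≥0}
    (hσ : ∀ j, σ j ≠ 0) {ι : Type*} [Fintype ι] [Nonempty ι] [MeasurableSpace ι]
    [MeasurableSingletonClass ι] [Nonempty σ₁] [Nonempty σ₂] (g : Fin M₁ → Fin M₂ → ι)
    (e₁ : ι → σ₁ → Fin M₁ × Fin L₁) (e₂ : ι → σ₂ → Fin M₂ × Fin L₂)
    (hB : ∀ B : Fin M₁ × Fin L₁ → Fin M₂ × Fin L₂ → ι → ℝ≥0∞,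
      (Fintype.card (Fin M₁ × Fin L₁) : ℝ≥0∞)⁻¹ * ∑ i,
        (Fintype.card (Fin M₂ × Fin L₂) : ℝ≥0∞)⁻¹ * ∑ k, B i k (g i.1 k.1) =
      (Fintype.card ι : ℝ≥0∞)⁻¹ * ∑ m, (((Fintype.card σ₁ : ℝ≥0∞)⁻¹ *
        (Fintype.card σ₂ : ℝ≥0∞)⁻¹) * ∑ a, ∑ b, B (e₁ m a) (e₂ m b) m)) :
    mutualInfo (codebookLaw G x₁ x₂) (fun ω : (Fin M₁ × (Fin n → ℝ)) × (Fin M₂ × (Fin n → ℝ)) ×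
      (Fin n → ℝ × ℝ × ℝ) => g ω.1.1 ω.2.1.1)
        (fun ω j => G.a₃ * ω.1.2 j + G.b₃ * ω.2.1.2 j + (ω.2.2 j).2.2) ≤
      (Fintype.card ι : ℝ≥0∞)⁻¹ * ∑ m, eveDivergence G σ (e₁ m) (e₂ m) (x₁, x₂) := by
  have := isProbabilityMeasure_codebookLaw G hM₁ hL₁ hM₂ hL₂ x₁ x₂
  have hg : Measurable fun q : Fin M₁ × Fin M₂ => g q.1 q.2 := measurable_of_countable _
  have hX : Measurable fun ω : (Fin M₁ × (Fin n → ℝ)) × (Fin M₂ × (Fin n → ℝ)) ×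
      (Fin n → ℝ × ℝ × ℝ) => g ω.1.1 ω.2.1.1 :=
    hg.comp (f := fun ω : (Fin M₁ × (Fin n → ℝ)) × (Fin M₂ × (Fin n → ℝ)) ×
      (Fin n → ℝ × ℝ × ℝ) => (ω.1.1, ω.2.1.1)) (by fun_prop)
  have hY : Measurable fun (ω : (Fin M₁ × (Fin n → ℝ)) × (Fin M₂ × (Fin n → ℝ)) ×
      (Fin n → ℝ × ℝ × ℝ)) (j : Fin n) =>
        G.a₃ * ω.1.2 j + G.b₃ * ω.2.1.2 j + (ω.2.2 j).2.2 := by fun_prop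
  have hT (m : ι) : Measurable fun z =>
      pairAverage (fun p => eveDensity G σ (p.1, p.2, z)) (e₁ m) (e₂ m) x₁ x₂ := by
    unfold pairAverage; fun_prop
  have hD1 := lintegral_eveDensity G hσ
  refine mutualInfo_le_average_klFun (codebookLaw G x₁ x₂) hX hY (gaussianVec σ) hT
    (fun m z => pairAverage_ne_zero (fun p => eveDensity_ne_zero G hσ _) _ _ _ _)
    (fun m => lintegral_pairAverage_density _ (measurable_eveDensity G σ) hD1 _ _ _ _) ?_
  intro F hF
  have hF' (i : ι) : Measurable fun z => F (i, z) := hF.comp measurable_prodMk_left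
  have e (m : ι) := lintegral_pairAverage_mul (gaussianVec σ) (measurable_eveDensity G σ)
    (e₁ m) (e₂ m) x₁ x₂ (hF' m)
  simp only [e]
  rw [← hB fun i k m => ∫⁻ z, eveDensity G σ (x₁ i, x₂ k, z) * F (m, z) ∂(gaussianVec σ)]
  simp only [eveDensity]
  exact lintegral_codebookLaw_msg_output G x₁ x₂ hM₁ hL₁ hM₂ hL₂ hσ
    (F := fun m₁ m₂ z => F (g m₁ m₂, z)) fun m₁ m₂ => hF' _

variable (hM₁ : 0 < M₁) (hL₁ : 0 < L₁) (hM₂ : 0 < M₂) (hL₂ : 0 < L₂)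
  (x₁ : Fin M₁ × Fin L₁ → Fin n → ℝ) (x₂ : Fin M₂ × Fin L₂ → Fin n → ℝ)
  {d₁ : (Fin n → ℝ) → Fin M₁} {d₂ : (Fin n → ℝ) → Fin M₂} (hd₁ : Measurable d₁)
  (hd₂ : Measurable d₂)

theorem leakJoint_codebookCode_le {σ : Fin n → ℝ≥0} (hσ : ∀ j, σ j ≠ 0) :
    (codebookCode G hM₁ hL₁ hM₂ hL₂ x₁ x₂ hd₁ hd₂).leakJoint G ≤
      (Fintype.card (Fin M₁ × Fin M₂) : ℝ≥0∞)⁻¹ * ∑ m : Fin M₁ × Fin M₂,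
        eveDivergence G σ (fun l : Fin L₁ => (m.1, l)) (fun l : Fin L₂ => (m.2, l)) (x₁, x₂) := by
  have : NeZero M₁ := ⟨hM₁.ne'⟩
  have : NeZero L₁ := ⟨hL₁.ne'⟩
  have : NeZero M₂ := ⟨hM₂.ne'⟩
  have : NeZero L₂ := ⟨hL₂.ne'⟩
  refine mutualInfo_codebookLaw_le G hM₁ hL₁ hM₂ hL₂ x₁ x₂ hσ (ι := Fin M₁ × Fin M₂)
    (fun m₁ m₂ => (m₁, m₂)) (fun m l => (m.1, l)) (fun m l => (m.2, l)) fun B => ?_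
  simp only [Fintype.card_prod, Fintype.card_fin, Fintype.sum_prod_type, ← Finset.mul_sum,
    ← mul_assoc, Nat.cast_mul]
  rw [ENNReal.mul_inv (by simp) (by simp), ENNReal.mul_inv (by simp) (by simp),
    ENNReal.mul_inv (by simp) (by simp)]
  congr 1
  · ring
  · exact Finset.sum_congr rfl fun m₁ _ => Finset.sum_comm

/-- Fixing only the first message leaves the whole second codebook as randomness, hence the map
`id`. This is the gain of individual over joint secrecy. -/
theorem leak₁_codebookCode_le {σ : Fin n → ℝ≥0} (hσ : ∀ j, σ j ≠ 0) :
    (codebookCode G hM₁ hL₁ hM₂ hL₂ x₁ x₂ hd₁ hd₂).leak₁ G ≤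
      (Fintype.card (Fin M₁) : ℝ≥0∞)⁻¹ * ∑ m : Fin M₁,
        eveDivergence G σ (fun l : Fin L₁ => (m, l)) (id : Fin M₂ × Fin L₂ → _) (x₁, x₂) := by
  have : NeZero M₁ := ⟨hM₁.ne'⟩
  have : NeZero L₁ := ⟨hL₁.ne'⟩
  have : NeZero M₂ := ⟨hM₂.ne'⟩
  have : NeZero L₂ := ⟨hL₂.ne'⟩
  refine mutualInfo_codebookLaw_le G hM₁ hL₁ hM₂ hL₂ x₁ x₂ hσ (ι := Fin M₁)
    (fun m₁ m₂ => m₁) (fun m l => (m, l)) (fun m => id) fun B => ?_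
  simp only [Fintype.card_prod, Fintype.card_fin, Fintype.sum_prod_type, ← Finset.mul_sum,
    ← mul_assoc, Nat.cast_mul, id]
  rw [ENNReal.mul_inv (by simp) (by simp)]

theorem leak₂_codebookCode_le {σ : Fin n → ℝ≥0} (hσ : ∀ j, σ j ≠ 0) :
    (codebookCode G hM₁ hL₁ hM₂ hL₂ x₁ x₂ hd₁ hd₂).leak₂ G ≤
      (Fintype.card (Fin M₂) : ℝ≥0∞)⁻¹ * ∑ m : Fin M₂,
        eveDivergence G σ (id : Fin M₁ × Fin L₁ → _) (fun l : Fin L₂ => (m, l)) (x₁, x₂) := by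
  have : NeZero M₁ := ⟨hM₁.ne'⟩
  have : NeZero L₁ := ⟨hL₁.ne'⟩
  have : NeZero M₂ := ⟨hM₂.ne'⟩
  have : NeZero L₂ := ⟨hL₂.ne'⟩
  refine mutualInfo_codebookLaw_le G hM₁ hL₁ hM₂ hL₂ x₁ x₂ hσ (ι := Fin M₂)
    (fun m₁ m₂ => m₂) (fun m => id) (fun m l => (m, l)) fun B => ?_
  simp only [← Finset.mul_sum]
  rw [Finset.sum_comm (s := (Finset.univ : Finset (Fin M₁ × Fin L₁)))]
  have h (m : Fin M₂) : ∑ a, ∑ b : Fin L₂, B (id a) (m, b) m = ∑ b : Fin L₂, ∑ a, B a (m, b) m :=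
    Finset.sum_comm
  simp only [h]
  rw [Fintype.sum_prod_type, Fintype.card_prod (Fin M₂), Nat.cast_mul,
    ENNReal.mul_inv (by simp) (by simp)]
  simp only [← mul_assoc]
  rw [mul_comm ((Fintype.card (Fin M₁ × Fin L₁) : ℝ≥0∞)⁻¹) ((Fintype.card (Fin M₂) : ℝ≥0∞)⁻¹)]

end Leakage

/-! ### Expected divergence and decoding error of Gaussian random codebooks. -/

section CodeExistence

open InformationTheory

/-- A codebook of size at least e^ρ lowers the exponent of the moment by s ρ. -/
theorem lintegral_mul_div_rpow_le {α β γ : Type*} [MeasurableSpace α] [MeasurableSpace β]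
    [MeasurableSpace γ] (P₁ : Measure α) (P₂ : Measure β) (Q : Measure γ)
    (w X : α → β → γ → ℝ≥0) {N : ℝ≥0} {ρ s A : ℝ} (hs : 0 ≤ s) (hN : Real.exp ρ ≤ N)
    (h : ∫⁻ u, ∫⁻ v, ∫⁻ z, (w u v z * X u v z ^ s : ℝ≥0) ∂Q ∂P₂ ∂P₁ ≤
      ENNReal.ofReal (Real.exp A)) :
    ∫⁻ u, ∫⁻ v, ∫⁻ z, (w u v z * (X u v z / N) ^ s : ℝ≥0) ∂Q ∂P₂ ∂P₁ ≤
      ENNReal.ofReal (Real.exp (A - s * ρ)) := by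
  set c : ℝ≥0∞ := ENNReal.ofReal (Real.exp (-(s * ρ))) with hc
  have hct : c ≠ ∞ := ENNReal.ofReal_ne_top
  have hpt (u v z) : ((w u v z * (X u v z / N) ^ s : ℝ≥0) : ℝ≥0∞) ≤
      c * (w u v z * X u v z ^ s : ℝ≥0) := by
    rw [hc, ENNReal.ofReal, ← ENNReal.coe_mul, ENNReal.coe_le_coe, ← NNReal.coe_le_coe,
      NNReal.coe_mul, NNReal.coe_rpow, NNReal.coe_mul, Real.coe_toNNReal _ (Real.exp_pos _).le,
      NNReal.coe_mul, NNReal.coe_rpow, NNReal.coe_div, Real.div_rpow (by positivity) (by positivity)]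
    have h1 : Real.exp (s * ρ) ≤ (N : ℝ) ^ s := by
      rw [mul_comm, Real.exp_mul]
      exact Real.rpow_le_rpow (Real.exp_pos _).le hN hs
    rw [Real.exp_neg, ← mul_div_assoc, div_eq_inv_mul]
    gcongr
  calc _ ≤ ∫⁻ u, ∫⁻ v, ∫⁻ z, c * (w u v z * X u v z ^ s : ℝ≥0) ∂Q ∂P₂ ∂P₁ :=
        lintegral_mono fun u => lintegral_mono fun v => lintegral_mono fun z => hpt u v z
    _ = c * ∫⁻ u, ∫⁻ v, ∫⁻ z, (w u v z * X u v z ^ s : ℝ≥0) ∂Q ∂P₂ ∂P₁ := by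
        simp only [lintegral_const_mul' c _ hct]
    _ ≤ c * ENNReal.ofReal (Real.exp A) := by gcongr
    _ = _ := by
        rw [hc, ← ENNReal.ofReal_mul (Real.exp_pos _).le, ← Real.exp_add]
        congr 2; ring

variable {n : ℕ} (G : GaussianTWWC)

/-- The variance of the eavesdropper's output for Gaussian inputs of powers `p` and `q`. -/
def eveVar (p q : ℝ≥0) : ℝ≥0 := ‖G.a₃‖₊ ^ 2 * p + ‖G.b₃‖₊ ^ 2 * q + G.v₃

theorem coe_eveVar (p q : ℝ≥0) :
    (eveVar G p q : ℝ) = G.a₃ ^ 2 * p + G.b₃ ^ 2 * q + G.v₃ := by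
  simp [eveVar]

theorem eveVar_pos (p q : ℝ≥0) : 0 < eveVar G p q := by
  have := G.v₃_pos
  unfold eveVar; positivity

/-- The mutual information between both inputs and the eavesdropper's output. -/
def infoEve (p q : ℝ≥0) : ℝ := 1 / 2 * Real.log (eveVar G p q / G.v₃)

/-- The mutual information between the first input and the eavesdropper's output. -/
def infoEve₁ (p q : ℝ≥0) : ℝ := 1 / 2 * Real.log (eveVar G p q / eveVar G 0 q)

/-- The mutual information between the second input and the eavesdropper's output. -/
def infoEve₂ (p q : ℝ≥0) : ℝ := 1 / 2 * Real.log (eveVar G p q / eveVar G p 0)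

/-- The mutual information of the Gaussian channel `x ↦ a x + N(0, v)` at input power `p`. -/
def gaussianInfo (a : ℝ) (v p : ℝ≥0) : ℝ := 1 / 2 * Real.log ((a ^ 2 * p + v) / v)

/-- An upper bound for the expected divergence of the output of a random codebook. -/
def resolvabilityBound (κ : ℝ≥0) (s A A₁ A₂ : ℝ) : ℝ≥0∞ :=
  ENNReal.ofReal (Real.log (κ ^ 2)) + (κ ^ 2 * s.toNNReal⁻¹ : ℝ≥0) *
    (ENNReal.ofReal (Real.exp A) + ENNReal.ofReal (Real.exp A₁) + ENNReal.ofReal (Real.exp A₂))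

/-- The general resolvability bound at the output law induced by the unconditioned Gaussian inputs.
The three exponents compare the total rate and the two separate rates with the informations of both
inputs, the first and the second about Z. -/
theorem lintegral_eveDivergence_le (p₁ p₂ : Fin n → ℝ≥0) {P₁ P₂ : Measure (Fin n → ℝ)}
    [IsProbabilityMeasure P₁] [IsProbabilityMeasure P₂] {κ : ℝ≥0}
    (h₁ : P₁ ≤ κ • gaussianVec p₁) (h₂ : P₂ ≤ κ • gaussianVec p₂)
    {m l σ₁ σ₂ : Type*} [Fintype m] [Fintype l] [Fintype σ₁] [Fintype σ₂] [Nonempty σ₁]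
    [Nonempty σ₂] {e₁ : σ₁ → m} {e₂ : σ₂ → l} (he₁ : Function.Injective e₁)
    (he₂ : Function.Injective e₂) {s ρ₁ ρ₂ : ℝ} (hs : 0 < s) (hs1 : s ≤ 1 / 4)
    (hρ₁ : Real.exp ρ₁ ≤ Fintype.card σ₁) (hρ₂ : Real.exp ρ₂ ≤ Fintype.card σ₂) :
    ∫⁻ x₁, ∫⁻ x₂, eveDivergence G (fun j => eveVar G (p₁ j) (p₂ j)) e₁ e₂ (x₁, x₂)
        ∂(Measure.pi fun _ : l => P₂) ∂(Measure.pi fun _ : m => P₁) ≤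
      resolvabilityBound κ s
        (s * ∑ j, infoEve G (p₁ j) (p₂ j) + n * (2 * s ^ 2) - s * (ρ₁ + ρ₂))
        (s * ∑ j, infoEve₁ G (p₁ j) (p₂ j) + n * (2 * s ^ 2) - s * ρ₁)
        (s * ∑ j, infoEve₂ G (p₁ j) (p₂ j) + n * (2 * s ^ 2) - s * ρ₂) := by
  set σ : Fin n → ℝ≥0 := fun j => eveVar G (p₁ j) (p₂ j) with hσd
  have hσ (j) : σ j ≠ 0 := (eveVar_pos G _ _).ne'
  have hv (j : Fin n) : (fun _ : Fin n => G.v₃) j ≠ 0 := G.v₃_pos.ne'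
  set q₁ : Fin n → ℝ≥0 := fun j => eveVar G 0 (p₂ j)
  set q₂ : Fin n → ℝ≥0 := fun j => eveVar G (p₁ j) 0
  have hq₁ (j) : q₁ j ≠ 0 := (eveVar_pos G _ _).ne'
  have hq₂ (j) : q₂ j ≠ 0 := (eveVar_pos G _ _).ne'
  have hs' : |s| ≤ 1 / 4 := by rwa [abs_of_pos hs]
  -- After averaging over the other input, that input acts as additional Gaussian noise, which
  -- raises the conditional variance to `q₁` or `q₂`.
  let w₁ : (Fin n → ℝ) × (Fin n → ℝ) → ℝ≥0 := fun p =>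
    gaussianVecRatio q₁ σ (fun j => G.a₃ * p.1 j) p.2
  let w₂ : (Fin n → ℝ) × (Fin n → ℝ) → ℝ≥0 := fun p =>
    gaussianVecRatio q₂ σ (fun j => G.b₃ * p.1 j) p.2
  have hm₁ (u z : Fin n → ℝ) : ∫⁻ v, eveDensity G σ (u, v, z) ∂(gaussianVec p₂) = w₁ (u, z) :=
    lintegral_gaussianVecRatio (v := fun _ => G.v₃) (q := q₁) hv
      (fun j => by simp [q₁, coe_eveVar]) (fun j => G.a₃ * u j) z
  have hm₂ (v z : Fin n → ℝ) : ∫⁻ u, eveDensity G σ (u, v, z) ∂(gaussianVec p₁) = w₂ (v, z) := by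
    have := lintegral_gaussianVecRatio (v := fun _ => G.v₃) (q := q₂) (σ := σ) (p := p₁)
      (b := G.a₃) hv (fun j => by simp [q₂, coe_eveVar]) (fun j => G.b₃ * v j) z
    simp only [eveDensity, w₂, ← this]
    simp only [add_comm]
  have hm (z : Fin n → ℝ) : ∫⁻ u, w₁ (u, z) ∂(gaussianVec p₁) = 1 := by
    have := lintegral_gaussianVecRatio (v := q₁) (q := σ) (σ := σ) (p := p₁)
      (b := G.a₃) hq₁ (fun j => by simp [q₁, σ, coe_eveVar]; ring) 0 z
    simp only [Pi.zero_apply, zero_add, gaussianVecRatio_self hσ] at this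
    exact_mod_cast this
  refine (lintegral_klFun_resolvability_le (gaussianVec p₁) P₁ (gaussianVec p₂) P₂ (gaussianVec σ)
    h₁ h₂ he₁ he₂ (measurable_eveDensity G σ) (w₁ := w₁) (w₂ := w₂) (by fun_prop) (by fun_prop)
    (lintegral_eveDensity G hσ) hm₁ hm₂ hm hs (by linarith)).trans ?_
  unfold resolvabilityBound
  gcongr
  -- The three terms use the same moment bound, conditioning on both inputs, on the first (β = 0)
  -- and on the second (α = 0).
  · refine lintegral_mul_div_rpow_le _ _ _ (fun u v z => eveDensity G σ (u, v, z))
      (fun u v z => eveDensity G σ (u, v, z)) hs.le ?_ ?_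
    · push_cast
      rw [Real.exp_add]
      exact mul_le_mul hρ₁ hρ₂ (Real.exp_pos _).le (by positivity)
    · exact lintegral_gaussianVecRatio_rpow_le (v := fun _ => G.v₃) (u := fun _ => G.v₃) (σ := σ)
        (p₁ := p₁) (p₂ := p₂) (a := G.a₃) (b := G.b₃) (α := G.a₃) (β := G.b₃) hv
        (fun j => coe_eveVar G _ _) (fun j => by simp) hs'
  · refine lintegral_mul_div_rpow_le _ _ _ (fun u v z => eveDensity G σ (u, v, z))
      (fun u v z => w₁ (u, z)) hs.le (by simpa using hρ₁) ?_
    have := lintegral_gaussianVecRatio_rpow_le (v := fun _ => G.v₃) (u := q₁) (σ := σ)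
        (p₁ := p₁) (p₂ := p₂) (a := G.a₃) (b := G.b₃) (α := G.a₃) (β := 0) hv
        (fun j => coe_eveVar G _ _) (fun j => by simp [q₁, coe_eveVar]) hs'
    simp only [zero_mul, add_zero] at this
    exact this
  · refine lintegral_mul_div_rpow_le _ _ _ (fun u v z => eveDensity G σ (u, v, z))
      (fun u v z => w₂ (v, z)) hs.le (by simpa using hρ₂) ?_
    have := lintegral_gaussianVecRatio_rpow_le (v := fun _ => G.v₃) (u := q₂) (σ := σ)
        (p₁ := p₁) (p₂ := p₂) (a := G.a₃) (b := G.b₃) (α := 0) (β := G.b₃) hv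
        (fun j => coe_eveVar G _ _) (fun j => by simp [q₂, coe_eveVar]) hs'
    simp only [zero_mul, zero_add] at this
    exact this

/-- An upper bound for the expected decoding error probability of a random codebook. -/
def decodingBound (κ : ℝ≥0) (M : ℕ) (A B : ℝ) : ℝ≥0∞ :=
  if M = 1 then 0 else κ * ENNReal.ofReal (Real.exp A) + κ * ENNReal.ofReal (4 * Real.exp B)

/-- The decoder depends on the codebook by an arbitrary choice. Averaging over codebooks therefore
uses an explicit measurable majorant `D` of its error probability. -/
theorem exists_decoding_functional {M L : ℕ} (hM : 0 < M) (hL : 0 < L) (a : ℝ) {v : ℝ≥0}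
    (hv : v ≠ 0) (p : Fin n → ℝ≥0) {P : Measure (Fin n → ℝ)} [IsProbabilityMeasure P] {κ : ℝ≥0}
    (hP : P ≤ κ • gaussianVec p) {s t ρ : ℝ} (hs : 0 < s) (hs1 : s ≤ 1 / 4)
    (hρ : (M * L : ℝ) ≤ 4 * Real.exp ρ) :
    ∃ D : (Fin M × Fin L → Fin n → ℝ) → ℝ≥0∞, Measurable D ∧
      (∀ x, ∃ d : (Fin n → ℝ) → Fin M, Measurable d ∧
        (Fintype.card (Fin M × Fin L) : ℝ≥0∞)⁻¹ * ∑ i,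
          (Measure.pi fun j => gaussianReal (a * x i j) v) {y | d y ≠ i.1} ≤ D x) ∧
      ∫⁻ x, D x ∂(Measure.pi fun _ => P) ≤
        decodingBound κ M (s * t - s * ∑ j, gaussianInfo a v (p j) + n * (2 * s ^ 2)) (ρ - t) := by
  have : NeZero M := ⟨hM.ne'⟩
  have : NeZero L := ⟨hL.ne'⟩
  -- A single message is never decoded wrongly, however many randomization indices there are. This
  -- allows a user of rate zero to randomize at any rate.
  by_cases hM1 : M = 1
  · refine ⟨fun _ => 0, measurable_const, fun x => ⟨fun _ => 0, measurable_const, ?_⟩, by simp⟩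
    have : Subsingleton (Fin M) := by rw [hM1]; infer_instance
    simp [Subsingleton.elim _ (0 : Fin M)]
  set σ : Fin n → ℝ≥0 := fun j => ‖a‖₊ ^ 2 * p j + v with hσd
  have hσ (j) : σ j ≠ 0 := by positivity
  have hσc (j) : (σ j : ℝ) = a ^ 2 * p j + v := by simp [σ]
  set w : (Fin n → ℝ) × (Fin n → ℝ) → ℝ≥0 := fun q =>
    gaussianVecRatio (fun _ => v) σ (fun j => a * q.1 j) q.2 with hwd
  have hw : Measurable w := by fun_prop
  have hw0 (q) : w q ≠ 0 := gaussianVecRatio_ne_zero (fun _ => hv) hσ _ _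
  have hQ (u : Fin n → ℝ) : ∫⁻ y, w (u, y) ∂(gaussianVec σ) = 1 :=
    lintegral_gaussianVecRatio_one (u := fun _ => v) (fun _ => hv) hσ (fun j => a * u j)
  have hm (z : Fin n → ℝ) : ∫⁻ u, w (u, z) ∂(gaussianVec p) = 1 := by
    have := lintegral_gaussianVecRatio (v := fun _ => v) (q := σ) (σ := σ) (p := p)
      (b := a) (fun _ => hv) hσc 0 z
    simp only [Pi.zero_apply, zero_add, gaussianVecRatio_self hσ] at this
    exact_mod_cast this
  set τ : ℝ≥0 := (Real.exp t).toNNReal with hτd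
  have hτ : τ ≠ 0 := (Real.toNNReal_pos.2 (Real.exp_pos t)).ne'
  have hτc : (τ : ℝ) = Real.exp t := Real.coe_toNNReal _ (Real.exp_pos _).le
  refine ⟨fun x => (Fintype.card (Fin M × Fin L) : ℝ≥0∞)⁻¹ * ∑ i, ∫⁻ y, (w (x i, y) *
    ((τ / w (x i, y)) ^ s + ∑ j ∈ Finset.univ.erase i, w (x j, y) / τ) : ℝ≥0) ∂(gaussianVec σ),
    ?_, ?_, ?_⟩
  · refine Measurable.const_mul (Finset.measurable_fun_sum _ fun i _ => ?_) _
    refine Measurable.lintegral_prod_right' (f := fun q : (Fin M × Fin L → Fin n → ℝ) ×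
      (Fin n → ℝ) => ((w (q.1 i, q.2) * ((τ / w (q.1 i, q.2)) ^ s +
        ∑ j ∈ Finset.univ.erase i, w (q.1 j, q.2) / τ) : ℝ≥0) : ℝ≥0∞)) ?_
    have h1 : Measurable fun q : (Fin M × Fin L → Fin n → ℝ) × (Fin n → ℝ) => w (q.1 i, q.2) := by
      fun_prop
    have h2 : Measurable fun q : (Fin M × Fin L → Fin n → ℝ) × (Fin n → ℝ) =>
        ∑ j ∈ Finset.univ.erase i, w (q.1 j, q.2) / τ :=
      Finset.measurable_fun_sum _ fun j _ => by fun_prop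
    fun_prop
  · intro x
    obtain ⟨d, hd, h⟩ := exists_threshold_decoder (gaussianVec σ) (fun i y => w (x i, y))
      (fun i => by fun_prop) (fun i y => hw0 _) hτ hs
    refine ⟨d, hd, ?_⟩
    refine mul_le_mul_right (Finset.sum_le_sum fun i _ => ?_) _
    have := pi_gaussianReal_eq_withDensity (u := fun _ => v) (fun _ => hv) hσ (fun j => a * x i j)
    rw [this]
    exact h i
  · refine (lintegral_threshold_decoder_le (gaussianVec p) P (gaussianVec σ) hP hw hQ hm τ s).trans
      ?_
    rw [decodingBound, if_neg hM1]
    gcongr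
    · have hpt (u y) : ((w (u, y) * (τ / w (u, y)) ^ s : ℝ≥0) : ℝ≥0∞) =
          ENNReal.ofReal (Real.exp (s * t)) * (w (u, y) * (w (u, y)) ^ (-s) : ℝ≥0) := by
        rw [ENNReal.ofReal, ← ENNReal.coe_mul, NNReal.div_rpow, NNReal.rpow_neg]
        congr 1
        have : (Real.exp (s * t)).toNNReal = τ ^ s := by
          rw [← NNReal.coe_inj, NNReal.coe_rpow, hτc, ← Real.exp_mul, mul_comm,
            Real.coe_toNNReal _ (Real.exp_pos _).le]
        rw [this]
        ring
      simp only [hpt]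
      simp only [lintegral_const_mul' _ _ ENNReal.ofReal_ne_top]
      -- The lower tail of the information density needs the moment of order -s. The point-to-point
      -- channel is the two-input channel whose second input has power and coefficient zero.
      have := lintegral_gaussianVecRatio_rpow_le (v := fun _ => v) (u := fun _ => v) (σ := σ)
        (p₁ := p) (p₂ := 0) (a := a) (b := 0) (α := a) (β := 0) (s := -s) (fun _ => hv)
        (fun j => by simp [hσc]) (fun j => by simp) (by rwa [abs_neg, abs_of_pos hs])
      simp only [zero_mul, add_zero, lintegral_const, measure_univ, mul_one] at this
      refine (mul_le_mul_right this _).trans_eq ?_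
      rw [← ENNReal.ofReal_mul (Real.exp_pos _).le, ← Real.exp_add]
      congr 2
      simp only [gaussianInfo, hσc]
      ring
    · rw [mul_div_assoc, ENNReal.coe_mul]
      gcongr
      rw [ENNReal.ofReal, ENNReal.coe_le_coe, ← NNReal.coe_le_coe, Real.coe_toNNReal _ (by positivity)]
      simp only [Fintype.card_prod, Fintype.card_fin, NNReal.coe_div, hτc, Nat.cast_mul,
        Real.exp_sub]
      rw [← mul_div_assoc]
      gcongr
      exact_mod_cast hρ

end CodeExistence

/-! ### Derandomization. -/

section CodeSelection

variable {n M₁ L₁ M₂ L₂ : ℕ} (G : GaussianTWWC)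

/-- Derandomization: some pair of codebooks of admissible power has error probability and
value of the cost `Λ` below the random coding bounds. -/
theorem exists_codebookCode (hM₁ : 0 < M₁) (hL₁ : 0 < L₁) (hM₂ : 0 < M₂) (hL₂ : 0 < L₂)
    (p₁ p₂ : Fin n → ℝ≥0) {P₁ P₂ : Measure (Fin n → ℝ)}
    [IsProbabilityMeasure P₁] [IsProbabilityMeasure P₂] {κ : ℝ≥0}
    (h₁ : P₁ ≤ κ • gaussianVec p₁) (h₂ : P₂ ≤ κ • gaussianVec p₂) {c₁ c₂ : ℝ}
    (hc₁ : ∀ᵐ x ∂P₁, (1 / (n : ℝ)) * ∑ j, x j ^ 2 ≤ c₁)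
    (hc₂ : ∀ᵐ x ∂P₂, (1 / (n : ℝ)) * ∑ j, x j ^ 2 ≤ c₂)
    {s t₁ t₂ ρ₁ ρ₂ : ℝ} (hs : 0 < s) (hs1 : s ≤ 1 / 4)
    (hρ₁ : (M₁ * L₁ : ℝ) ≤ 4 * Real.exp ρ₁) (hρ₂ : (M₂ * L₂ : ℝ) ≤ 4 * Real.exp ρ₂)
    {Λ : (Fin M₁ × Fin L₁ → Fin n → ℝ) × (Fin M₂ × Fin L₂ → Fin n → ℝ) → ℝ≥0∞}
    (hΛ : Measurable Λ) {B : ℝ≥0∞}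
    (hB : ∫⁻ x₁, ∫⁻ x₂, Λ (x₁, x₂) ∂(Measure.pi fun _ => P₂) ∂(Measure.pi fun _ => P₁) ≤ B) :
    ∃ (x₁ : Fin M₁ × Fin L₁ → Fin n → ℝ) (x₂ : Fin M₂ × Fin L₂ → Fin n → ℝ)
      (d₁ : (Fin n → ℝ) → Fin M₁) (d₂ : (Fin n → ℝ) → Fin M₂) (hd₁ : Measurable d₁)
      (hd₂ : Measurable d₂),
      (codebookCode G hM₁ hL₁ hM₂ hL₂ x₁ x₂ hd₁ hd₂).PeakConstraint c₁ c₂ ∧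
      (codebookCode G hM₁ hL₁ hM₂ hL₂ x₁ x₂ hd₁ hd₂).errorProb G + Λ (x₁, x₂) ≤
        decodingBound κ M₁ (s * t₁ - s * ∑ j, gaussianInfo G.a₂ G.v₂ (p₁ j) + n * (2 * s ^ 2))
          (ρ₁ - t₁) +
        decodingBound κ M₂ (s * t₂ - s * ∑ j, gaussianInfo G.b₁ G.v₁ (p₂ j) + n * (2 * s ^ 2))
          (ρ₂ - t₂) + B := by
  obtain ⟨D₁, hD₁, hdec₁, hi₁⟩ := exists_decoding_functional hM₁ hL₁ G.a₂ G.v₂_pos.ne' p₁ h₁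
    (t := t₁) hs hs1 hρ₁
  obtain ⟨D₂, hD₂, hdec₂, hi₂⟩ := exists_decoding_functional hM₂ hL₂ G.b₁ G.v₁_pos.ne' p₂ h₂
    (t := t₂) hs hs1 hρ₂
  let π₁ : Measure (Fin M₁ × Fin L₁ → Fin n → ℝ) := Measure.pi fun _ => P₁
  let π₂ : Measure (Fin M₂ × Fin L₂ → Fin n → ℝ) := Measure.pi fun _ => P₂
  have hint : ∫⁻ x, (D₁ x.1 + D₂ x.2 + Λ x) ∂(π₁.prod π₂) ≤
      decodingBound κ M₁ (s * t₁ - s * ∑ j, gaussianInfo G.a₂ G.v₂ (p₁ j) + n * (2 * s ^ 2))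
          (ρ₁ - t₁) +
        decodingBound κ M₂ (s * t₂ - s * ∑ j, gaussianInfo G.b₁ G.v₁ (p₂ j) + n * (2 * s ^ 2))
          (ρ₂ - t₂) + B := by
    rw [lintegral_add_left (by fun_prop), lintegral_add_left (by fun_prop),
      lintegral_prod _ (by fun_prop), lintegral_prod _ (by fun_prop),
      lintegral_prod _ (by fun_prop)]
    simp only [lintegral_const, measure_univ, mul_one]
    exact add_le_add (add_le_add hi₁ hi₂) hB
  have hae₁ : ∀ᵐ x ∂π₁, ∀ i, (1 / (n : ℝ)) * ∑ j, x i j ^ 2 ≤ c₁ :=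
    ae_all_iff.2 fun i => (Measure.quasiMeasurePreserving_eval (μ := fun _ => P₁) i).ae hc₁
  have hae₂ : ∀ᵐ x ∂π₂, ∀ i, (1 / (n : ℝ)) * ∑ j, x i j ^ 2 ≤ c₂ :=
    ae_all_iff.2 fun i => (Measure.quasiMeasurePreserving_eval (μ := fun _ => P₂) i).ae hc₂
  have hae : ∀ᵐ x ∂(π₁.prod π₂), (∀ i, (1 / (n : ℝ)) * ∑ j, x.1 i j ^ 2 ≤ c₁) ∧
      ∀ i, (1 / (n : ℝ)) * ∑ j, x.2 i j ^ 2 ≤ c₂ :=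
    (Measure.quasiMeasurePreserving_fst.ae hae₁).and (Measure.quasiMeasurePreserving_snd.ae hae₂)
  -- A single pair of codebooks lies outside the null set violating the power constraint and keeps
  -- the sum of error majorants and `Λ` at most at its mean.
  obtain ⟨x, hx, hle⟩ := exists_notMem_null_le_lintegral (μ := π₁.prod π₂)
    (f := fun x => D₁ x.1 + D₂ x.2 + Λ x) (by fun_prop) hae
  simp only [Set.mem_compl_iff, Set.mem_ofPred_eq, not_not] at hx
  obtain ⟨d₁, hd₁, he₁⟩ := hdec₁ x.1
  obtain ⟨d₂, hd₂, he₂⟩ := hdec₂ x.2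
  refine ⟨x.1, x.2, d₁, d₂, hd₁, hd₂, peakConstraint_codebookCode G x.1 x.2 hd₁ hd₂ hM₁ hL₁ hM₂ hL₂
    hx.1 hx.2, ?_⟩
  refine le_trans ?_ (hle.trans hint)
  exact add_le_add ((errorProb_codebookCode_le G x.1 x.2 hd₁ hd₂ hM₁ hL₁ hM₂ hL₂).trans
    (add_le_add he₁ he₂)) le_rfl

theorem lintegral_lintegral_average_le {α β ι : Type*} [MeasurableSpace α] [MeasurableSpace β]
    [Fintype ι] [Nonempty ι] (P : Measure α) (Q : Measure β) [SFinite Q]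
    {f : ι → α × β → ℝ≥0∞} (hf : ∀ i, Measurable (f i)) {B : ℝ≥0∞}
    (h : ∀ i, ∫⁻ x, ∫⁻ y, f i (x, y) ∂Q ∂P ≤ B) :
    ∫⁻ x, ∫⁻ y, (Fintype.card ι : ℝ≥0∞)⁻¹ * ∑ i, f i (x, y) ∂Q ∂P ≤ B := by
  have e (x : α) : ∫⁻ y, (Fintype.card ι : ℝ≥0∞)⁻¹ * ∑ i, f i (x, y) ∂Q =
      (Fintype.card ι : ℝ≥0∞)⁻¹ * ∑ i, ∫⁻ y, f i (x, y) ∂Q := by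
    rw [lintegral_const_mul _ (by fun_prop), lintegral_finsetSum _ (fun i _ => by fun_prop)]
  have hm (i : ι) : Measurable fun x => ∫⁻ y, f i (x, y) ∂Q := (hf i).lintegral_prod_right'
  simp only [e]
  rw [lintegral_const_mul _ (by fun_prop), lintegral_finsetSum _ (fun i _ => hm i)]
  calc _ ≤ (Fintype.card ι : ℝ≥0∞)⁻¹ * ∑ _i : ι, B := by gcongr with i _; exact h i
    _ = B := by
      rw [Finset.sum_const, Finset.card_univ, nsmul_eq_mul, ← mul_assoc,
        ENNReal.inv_mul_cancel (by simp) (by simp), one_mul]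

theorem lintegral_lintegral_add_le {α β : Type*} [MeasurableSpace α] [MeasurableSpace β]
    (P : Measure α) (Q : Measure β) [SFinite Q] {f g : α × β → ℝ≥0∞} (hf : Measurable f)
    {A B : ℝ≥0∞} (hA : ∫⁻ x, ∫⁻ y, f (x, y) ∂Q ∂P ≤ A) (hB : ∫⁻ x, ∫⁻ y, g (x, y) ∂Q ∂P ≤ B) :
    ∫⁻ x, ∫⁻ y, (f (x, y) + g (x, y)) ∂Q ∂P ≤ A + B := by
  have e (x : α) : ∫⁻ y, (f (x, y) + g (x, y)) ∂Q = ∫⁻ y, f (x, y) ∂Q + ∫⁻ y, g (x, y) ∂Q :=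
    lintegral_add_left (by fun_prop) _
  simp only [e]
  rw [lintegral_add_left hf.lintegral_prod_right']
  exact add_le_add hA hB

/-- With both messages fixed, only the randomization indices are free, so `r₁` and `r₂` measure `L₁`
and `L₂` alone. -/
theorem exists_code_joint (hM₁ : 0 < M₁) (hL₁ : 0 < L₁) (hM₂ : 0 < M₂) (hL₂ : 0 < L₂)
    (p₁ p₂ : Fin n → ℝ≥0) {P₁ P₂ : Measure (Fin n → ℝ)}
    [IsProbabilityMeasure P₁] [IsProbabilityMeasure P₂] {κ : ℝ≥0}
    (h₁ : P₁ ≤ κ • gaussianVec p₁) (h₂ : P₂ ≤ κ • gaussianVec p₂) {c₁ c₂ : ℝ}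
    (hc₁ : ∀ᵐ x ∂P₁, (1 / (n : ℝ)) * ∑ j, x j ^ 2 ≤ c₁)
    (hc₂ : ∀ᵐ x ∂P₂, (1 / (n : ℝ)) * ∑ j, x j ^ 2 ≤ c₂)
    {s t₁ t₂ ρ₁ ρ₂ r₁ r₂ : ℝ} (hs : 0 < s) (hs1 : s ≤ 1 / 4)
    (hρ₁ : (M₁ * L₁ : ℝ) ≤ 4 * Real.exp ρ₁) (hρ₂ : (M₂ * L₂ : ℝ) ≤ 4 * Real.exp ρ₂)
    (hr₁ : Real.exp r₁ ≤ L₁) (hr₂ : Real.exp r₂ ≤ L₂) :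
    ∃ C : NonAdaptiveCode n, C.M₁ = M₁ ∧ C.M₂ = M₂ ∧ C.PeakConstraint c₁ c₂ ∧
      C.errorProb G + C.leakJoint G ≤
        decodingBound κ M₁ (s * t₁ - s * ∑ j, gaussianInfo G.a₂ G.v₂ (p₁ j) + n * (2 * s ^ 2))
          (ρ₁ - t₁) +
        decodingBound κ M₂ (s * t₂ - s * ∑ j, gaussianInfo G.b₁ G.v₁ (p₂ j) + n * (2 * s ^ 2))
          (ρ₂ - t₂) +
        resolvabilityBound κ s
          (s * ∑ j, infoEve G (p₁ j) (p₂ j) + n * (2 * s ^ 2) - s * (r₁ + r₂))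
          (s * ∑ j, infoEve₁ G (p₁ j) (p₂ j) + n * (2 * s ^ 2) - s * r₁)
          (s * ∑ j, infoEve₂ G (p₁ j) (p₂ j) + n * (2 * s ^ 2) - s * r₂) := by
  have : NeZero M₁ := ⟨hM₁.ne'⟩
  have : NeZero L₁ := ⟨hL₁.ne'⟩
  have : NeZero M₂ := ⟨hM₂.ne'⟩
  have : NeZero L₂ := ⟨hL₂.ne'⟩
  have hmeas (m : Fin M₁ × Fin M₂) := measurable_eveDivergence G (fun j => eveVar G (p₁ j) (p₂ j))
    (fun l : Fin L₁ => (m.1, l)) (fun l : Fin L₂ => (m.2, l))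
  obtain ⟨x₁, x₂, d₁, d₂, hd₁, hd₂, hp, hle⟩ := exists_codebookCode G hM₁ hL₁ hM₂ hL₂ p₁ p₂ h₁ h₂
    hc₁ hc₂ (t₁ := t₁) (t₂ := t₂) hs hs1 hρ₁ hρ₂
    (Λ := fun x => (Fintype.card (Fin M₁ × Fin M₂) : ℝ≥0∞)⁻¹ * ∑ m : Fin M₁ × Fin M₂,
      eveDivergence G (fun j => eveVar G (p₁ j) (p₂ j)) (fun l : Fin L₁ => (m.1, l))
        (fun l : Fin L₂ => (m.2, l)) x) (by fun_prop)
    (lintegral_lintegral_average_le _ _ hmeas fun m => lintegral_eveDivergence_le G p₁ p₂ h₁ h₂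
      (Prod.mk_right_injective m.1) (Prod.mk_right_injective m.2) (ρ₁ := r₁) (ρ₂ := r₂) hs hs1
      (by simpa using hr₁) (by simpa using hr₂))
  refine ⟨codebookCode G hM₁ hL₁ hM₂ hL₂ x₁ x₂ hd₁ hd₂, rfl, rfl, hp, le_trans ?_ hle⟩
  gcongr
  exact leakJoint_codebookCode_le G hM₁ hL₁ hM₂ hL₂ x₁ x₂ hd₁ hd₂
    fun j => (eveVar_pos G _ _).ne'

/-- The exponents `q₁` and `q₂` measure entire codebooks: each leakage pairs the randomization of
the protected user with the full codebook of the other. -/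
theorem exists_code_individual (hM₁ : 0 < M₁) (hL₁ : 0 < L₁) (hM₂ : 0 < M₂) (hL₂ : 0 < L₂)
    (p₁ p₂ : Fin n → ℝ≥0) {P₁ P₂ : Measure (Fin n → ℝ)}
    [IsProbabilityMeasure P₁] [IsProbabilityMeasure P₂] {κ : ℝ≥0}
    (h₁ : P₁ ≤ κ • gaussianVec p₁) (h₂ : P₂ ≤ κ • gaussianVec p₂) {c₁ c₂ : ℝ}
    (hc₁ : ∀ᵐ x ∂P₁, (1 / (n : ℝ)) * ∑ j, x j ^ 2 ≤ c₁)
    (hc₂ : ∀ᵐ x ∂P₂, (1 / (n : ℝ)) * ∑ j, x j ^ 2 ≤ c₂)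
    {s t₁ t₂ ρ₁ ρ₂ r₁ r₂ q₁ q₂ : ℝ} (hs : 0 < s) (hs1 : s ≤ 1 / 4)
    (hρ₁ : (M₁ * L₁ : ℝ) ≤ 4 * Real.exp ρ₁) (hρ₂ : (M₂ * L₂ : ℝ) ≤ 4 * Real.exp ρ₂)
    (hr₁ : Real.exp r₁ ≤ L₁) (hr₂ : Real.exp r₂ ≤ L₂) (hq₁ : Real.exp q₁ ≤ M₁ * L₁)
    (hq₂ : Real.exp q₂ ≤ M₂ * L₂) :
    ∃ C : NonAdaptiveCode n, C.M₁ = M₁ ∧ C.M₂ = M₂ ∧ C.PeakConstraint c₁ c₂ ∧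
      C.errorProb G + (C.leak₁ G + C.leak₂ G) ≤
        decodingBound κ M₁ (s * t₁ - s * ∑ j, gaussianInfo G.a₂ G.v₂ (p₁ j) + n * (2 * s ^ 2))
          (ρ₁ - t₁) +
        decodingBound κ M₂ (s * t₂ - s * ∑ j, gaussianInfo G.b₁ G.v₁ (p₂ j) + n * (2 * s ^ 2))
          (ρ₂ - t₂) +
        (resolvabilityBound κ s
          (s * ∑ j, infoEve G (p₁ j) (p₂ j) + n * (2 * s ^ 2) - s * (r₁ + q₂))
          (s * ∑ j, infoEve₁ G (p₁ j) (p₂ j) + n * (2 * s ^ 2) - s * r₁)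
          (s * ∑ j, infoEve₂ G (p₁ j) (p₂ j) + n * (2 * s ^ 2) - s * q₂) +
        resolvabilityBound κ s
          (s * ∑ j, infoEve G (p₁ j) (p₂ j) + n * (2 * s ^ 2) - s * (q₁ + r₂))
          (s * ∑ j, infoEve₁ G (p₁ j) (p₂ j) + n * (2 * s ^ 2) - s * q₁)
          (s * ∑ j, infoEve₂ G (p₁ j) (p₂ j) + n * (2 * s ^ 2) - s * r₂)) := by
  have : NeZero M₁ := ⟨hM₁.ne'⟩
  have : NeZero L₁ := ⟨hL₁.ne'⟩
  have : NeZero M₂ := ⟨hM₂.ne'⟩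
  have : NeZero L₂ := ⟨hL₂.ne'⟩
  have hmeas₁ (m : Fin M₁) := measurable_eveDivergence G (fun j => eveVar G (p₁ j) (p₂ j))
    (fun l : Fin L₁ => (m, l)) (id : Fin M₂ × Fin L₂ → _)
  have hmeas₂ (m : Fin M₂) := measurable_eveDivergence G (fun j => eveVar G (p₁ j) (p₂ j))
    (id : Fin M₁ × Fin L₁ → _) (fun l : Fin L₂ => (m, l))
  have hB₁ := lintegral_lintegral_average_le (Measure.pi fun _ : Fin M₁ × Fin L₁ => P₁)
    (Measure.pi fun _ : Fin M₂ × Fin L₂ => P₂) hmeas₁ fun m =>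
      lintegral_eveDivergence_le G p₁ p₂ h₁ h₂
        (Prod.mk_right_injective m) Function.injective_id (ρ₁ := r₁) (ρ₂ := q₂) hs hs1
        (by simpa using hr₁) (by simpa using hq₂)
  have hB₂ := lintegral_lintegral_average_le (Measure.pi fun _ : Fin M₁ × Fin L₁ => P₁)
    (Measure.pi fun _ : Fin M₂ × Fin L₂ => P₂) hmeas₂ fun m =>
      lintegral_eveDivergence_le G p₁ p₂ h₁ h₂
        Function.injective_id (Prod.mk_right_injective m) (ρ₁ := q₁) (ρ₂ := r₂) hs hs1
        (by simpa using hq₁) (by simpa using hr₂)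
  set Λ₁ : (Fin M₁ × Fin L₁ → Fin n → ℝ) × (Fin M₂ × Fin L₂ → Fin n → ℝ) → ℝ≥0∞ :=
    fun x => (Fintype.card (Fin M₁) : ℝ≥0∞)⁻¹ * ∑ m : Fin M₁,
      eveDivergence G (fun j => eveVar G (p₁ j) (p₂ j)) (fun l : Fin L₁ => (m, l)) id x with hΛ₁
  set Λ₂ : (Fin M₁ × Fin L₁ → Fin n → ℝ) × (Fin M₂ × Fin L₂ → Fin n → ℝ) → ℝ≥0∞ :=
    fun x => (Fintype.card (Fin M₂) : ℝ≥0∞)⁻¹ * ∑ m : Fin M₂,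
      eveDivergence G (fun j => eveVar G (p₁ j) (p₂ j)) id (fun l : Fin L₂ => (m, l)) x with hΛ₂
  have hΛm₁ : Measurable Λ₁ :=
    Measurable.const_mul (Finset.measurable_fun_sum _ fun m _ => hmeas₁ m) _
  have hΛm₂ : Measurable Λ₂ :=
    Measurable.const_mul (Finset.measurable_fun_sum _ fun m _ => hmeas₂ m) _
  have hB := lintegral_lintegral_add_le _ _ (f := Λ₁) (g := Λ₂) hΛm₁ hB₁ hB₂
  obtain ⟨x₁, x₂, d₁, d₂, hd₁, hd₂, hp, hle⟩ := exists_codebookCode G hM₁ hL₁ hM₂ hL₂ p₁ p₂ h₁ h₂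
    hc₁ hc₂ (t₁ := t₁) (t₂ := t₂) hs hs1 hρ₁ hρ₂ (Λ := fun x => Λ₁ x + Λ₂ x) (hΛm₁.add hΛm₂) hB
  refine ⟨codebookCode G hM₁ hL₁ hM₂ hL₂ x₁ x₂ hd₁ hd₂, rfl, rfl, hp, le_trans ?_ hle⟩
  gcongr
  · exact leak₁_codebookCode_le G hM₁ hL₁ hM₂ hL₂ x₁ x₂ hd₁ hd₂ fun j => (eveVar_pos G _ _).ne'
  · exact leak₂_codebookCode_le G hM₁ hL₁ hM₂ hL₂ x₁ x₂ hd₁ hd₂ fun j => (eveVar_pos G _ _).ne'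

end CodeSelection

/-! ### Conditioning Gaussian blocks on the peak power constraint. -/

section PeakPower

variable {n : ℕ}

theorem lintegral_exp_mul_sq_gaussianReal_le {u P : ℝ≥0} (hu : u ≤ P) {r : ℝ} (hr : 0 ≤ r)
    (hrP : 2 * r * P < 1) :
    ∫⁻ x, ENNReal.ofReal (Real.exp (r * x ^ 2)) ∂(gaussianReal 0 u) ≤
      ENNReal.ofReal ((√(1 - 2 * r * P))⁻¹) := by
  have hu' : (u : ℝ) ≤ P := by exact_mod_cast hu
  have hsq : √(1 - 2 * r * P) ≤ √(1 - 2 * (r * u)) :=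
    Real.sqrt_le_sqrt (by nlinarith [mul_le_mul_of_nonneg_left hu' hr])
  have hpos : 0 < √(1 - 2 * r * P) := Real.sqrt_pos.2 (by linarith)
  rcases eq_or_ne u 0 with rfl | hu0
  · rw [gaussianReal_zero_var, lintegral_dirac]
    refine ENNReal.ofReal_le_ofReal ?_
    simp only [ne_eq, OfNat.ofNat_ne_zero, not_false_eq_true, zero_pow, mul_zero, Real.exp_zero]
    refine (one_le_inv₀ hpos).2 (Real.sqrt_le_one.2 ?_)
    have : 0 ≤ 2 * r * P := by positivity
    linarith
  · have h := lintegral_exp_sq_gaussianReal hu0 (r := r * u)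
      (by nlinarith [mul_le_mul_of_nonneg_left hu' hr])
    have e (x : ℝ) : r * u * (x ^ 2 / u) = r * x ^ 2 := by
      have : (u : ℝ) ≠ 0 := by exact_mod_cast hu0
      field_simp
    simp only [e] at h
    rw [h]
    exact ENNReal.ofReal_le_ofReal (inv_anti₀ hpos hsq)

/-- Chernoff's bound for the power of a Gaussian block. -/
theorem exists_gaussianVec_power_gt_le {P : ℝ≥0} {c : ℝ} (hP : (P : ℝ) < c) :
    ∃ ρ : ℝ≥0, ρ < 1 ∧ ∀ (n : ℕ) (p : Fin n → ℝ≥0), (∀ j, p j ≤ P) →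
      gaussianVec p {x | (1 / (n : ℝ)) * ∑ j, x j ^ 2 ≤ c}ᶜ ≤ (ρ : ℝ≥0∞) ^ n := by
  have hc : 0 < c := P.coe_nonneg.trans_lt hP
  obtain ⟨r, hr, hrP, hlt⟩ : ∃ r : ℝ, 0 < r ∧ 2 * r * P < 1 ∧
      Real.exp (-(r * c)) < √(1 - 2 * r * P) := by
    -- The first bound gives 2rc ≤ 1, where exp(-2rc) ≤ 1 - 2rc + (2rc)². The second makes (2rc)²
    -- smaller than 2r(c - P), so this is below 1 - 2rP.
    set r : ℝ := min (1 / (2 * c)) ((c - P) / (4 * c ^ 2)) with hrd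
    have hr : 0 < r := by
      have : 0 < c - P := by linarith
      positivity
    have h1 : r * (2 * c) ≤ 1 := (le_div_iff₀ (by positivity)).1 (min_le_left _ _)
    have h2 : r * (4 * c ^ 2) ≤ c - P := (le_div_iff₀ (by positivity)).1 (min_le_right _ _)
    have h3 : 2 * r * P < 1 := by nlinarith
    refine ⟨r, hr, h3, ?_⟩
    refine Real.lt_sqrt_of_sq_lt ?_
    rw [← Real.exp_nat_mul]
    have h4 : Real.exp (-(2 * r * c)) ≤ 1 - 2 * r * c + (2 * r * c) ^ 2 := by
      have h5 := Real.abs_exp_sub_one_sub_id_le (x := -(2 * r * c))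
        (by rw [abs_neg, abs_of_pos (by positivity)]; linarith)
      have := (abs_le.1 h5).2
      nlinarith
    have e : (((2 : ℕ) : ℝ) * -(r * c)) = -(2 * r * c) := by push_cast; ring
    rw [e]
    refine h4.trans_lt ?_
    nlinarith [mul_le_mul_of_nonneg_left h2 hr.le, mul_pos hr (sub_pos.2 hP), mul_pos hr hc]
  have hpos : 0 < √(1 - 2 * r * P) := Real.sqrt_pos.2 (by linarith)
  set ρ : ℝ≥0 := (Real.exp (-(r * c)) * (√(1 - 2 * r * P))⁻¹).toNNReal with hρ
  refine ⟨ρ, ?_, fun n p hp => ?_⟩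
  · rw [hρ, ← NNReal.coe_lt_coe, Real.coe_toNNReal _ (by positivity), NNReal.coe_one,
      ← div_eq_mul_inv, div_lt_one hpos]
    exact hlt
  have hS : MeasurableSet {x : Fin n → ℝ | (1 / (n : ℝ)) * ∑ j, x j ^ 2 ≤ c} :=
    measurableSet_le (by fun_prop) measurable_const
  rw [← lintegral_indicator_one hS.compl]
  calc _ ≤ ∫⁻ x, ∏ j, ENNReal.ofReal (Real.exp (-(r * c))) *
          ENNReal.ofReal (Real.exp (r * x j ^ 2)) ∂(gaussianVec p) := by
        refine lintegral_mono fun x => ?_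
        rw [Set.indicator_apply]
        split_ifs with hx
        swap
        · exact zero_le
        have hx' : c * n ≤ ∑ j, x j ^ 2 := by
          rcases Nat.eq_zero_or_pos n with rfl | hn
          · simp
          have hn' : (0 : ℝ) < n := by exact_mod_cast hn
          have : ¬ (1 / (n : ℝ)) * ∑ j, x j ^ 2 ≤ c := hx
          rw [not_le, one_div, inv_mul_eq_div, lt_div_iff₀ hn'] at this
          exact this.le
        have e (j : Fin n) : ENNReal.ofReal (Real.exp (-(r * c))) *
            ENNReal.ofReal (Real.exp (r * x j ^ 2)) =
            ENNReal.ofReal (Real.exp (r * (x j ^ 2 - c))) := by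
          rw [← ENNReal.ofReal_mul (Real.exp_pos _).le, ← Real.exp_add]
          congr 2; ring
        simp only [e, Pi.one_apply]
        rw [← ENNReal.ofReal_prod_of_nonneg (fun _ _ => (Real.exp_pos _).le), ← Real.exp_sum,
          ← Finset.mul_sum, Finset.sum_sub_distrib, Finset.sum_const, Finset.card_univ,
          Fintype.card_fin, nsmul_eq_mul, ENNReal.one_le_ofReal]
        exact Real.one_le_exp (mul_nonneg hr.le (by linarith))
    _ = ∏ j, ∫⁻ y, ENNReal.ofReal (Real.exp (-(r * c))) *
          ENNReal.ofReal (Real.exp (r * y ^ 2)) ∂(gaussianReal 0 (p j)) :=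
        lintegral_pi_prod_eq_prod (fun j => gaussianReal 0 (p j)) (f := fun _ y =>
          ENNReal.ofReal (Real.exp (-(r * c))) * ENNReal.ofReal (Real.exp (r * y ^ 2)))
          (fun j => by fun_prop)
    _ ≤ ∏ _j : Fin n, (ρ : ℝ≥0∞) := by
        refine Finset.prod_le_prod' fun j _ => ?_
        rw [lintegral_const_mul _ (by fun_prop)]
        refine (mul_le_mul_right (lintegral_exp_mul_sq_gaussianReal_le (hp j) hr.le hrP) _).trans_eq
          ?_
        rw [← ENNReal.ofReal_mul (Real.exp_pos _).le]
        rfl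
    _ = _ := by simp

theorem ae_gaussianVec_zero (n : ℕ) : ∀ᵐ x ∂(gaussianVec (0 : Fin n → ℝ≥0)), x = 0 := by
  have h : ∀ᵐ x ∂(gaussianVec (0 : Fin n → ℝ≥0)), ∀ j, x j = 0 := by
    refine ae_all_iff.2 fun j => ?_
    refine (Measure.quasiMeasurePreserving_eval
      (μ := fun j => gaussianReal 0 ((0 : Fin n → ℝ≥0) j)) j).ae (p := fun y => y = 0) ?_
    simp
  filter_upwards [h] with x hx using funext hx

/-- Gaussian blocks of power below `c` can be conditioned on satisfying the peak power constraint
at an asymptotically negligible cost. -/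
theorem exists_peak_measure {P : ℝ≥0} {c : ℝ} (hP : (P : ℝ) < c ∨ P = 0 ∧ 0 ≤ c) :
    ∃ κ : ℕ → ℝ≥0, Tendsto κ atTop (𝓝 1) ∧ ∀ᶠ n in atTop, ∀ p : Fin n → ℝ≥0, (∀ j, p j ≤ P) →
      ∃ P' : Measure (Fin n → ℝ), IsProbabilityMeasure P' ∧ P' ≤ κ n • gaussianVec p ∧
        ∀ᵐ x ∂P', (1 / (n : ℝ)) * ∑ j, x j ^ 2 ≤ c := by
  rcases hP with hP | ⟨rfl, hc⟩
  swap
  -- At power zero the block vanishes almost surely and no conditioning is needed; this covers c =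
  -- 0.
  · refine ⟨fun _ => 1, tendsto_const_nhds, .of_forall fun n p hp => ⟨gaussianVec p, inferInstance,
      by simp, ?_⟩⟩
    obtain rfl : p = 0 := funext fun j => le_zero_iff.1 (hp j)
    filter_upwards [ae_gaussianVec_zero n] with x hx
    simpa [hx] using hc
  obtain ⟨ρ, hρ, h⟩ := exists_gaussianVec_power_gt_le hP
  have hlim : Tendsto (fun n => ρ ^ n) atTop (𝓝 0) := NNReal.tendsto_pow_atTop_nhds_zero_of_lt_one hρ
  -- Conditioning on an event of probability at least 1 - ρ^n increases the measure of any set by at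
  -- most this factor.
  refine ⟨fun n => (1 - ρ ^ n)⁻¹, ?_, ?_⟩
  · have : Tendsto (fun n => (1 : ℝ≥0) - ρ ^ n) atTop (𝓝 (1 - 0)) :=
      tendsto_const_nhds.sub hlim
    simpa using this.inv₀ (by simp)
  · filter_upwards [hlim.eventually_lt_const one_pos] with n hn p hp
    set S := {x : Fin n → ℝ | (1 / (n : ℝ)) * ∑ j, x j ^ 2 ≤ c}
    have hS : MeasurableSet S := measurableSet_le (by fun_prop) measurable_const
    have hle : ((1 - ρ ^ n : ℝ≥0) : ℝ≥0∞) ≤ gaussianVec p S := by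
      have h1 := prob_compl_eq_one_sub (μ := gaussianVec p) hS.compl
      rw [compl_compl] at h1
      rw [h1]
      push_cast
      exact tsub_le_tsub_left (h n p hp) 1
    have hne : (1 - ρ ^ n : ℝ≥0) ≠ 0 := (tsub_pos_of_lt hn).ne'
    have hS0 : gaussianVec p S ≠ 0 := fun h0 => hne (ENNReal.coe_eq_zero.1 (le_zero_iff.1 (h0 ▸ hle)))
    refine ⟨cond (gaussianVec p) S, cond_isProbabilityMeasure hS0, ?_, ?_⟩
    · refine Measure.le_iff.2 fun A hA => ?_
      rw [cond_apply hS, Measure.smul_apply, ENNReal.smul_def, smul_eq_mul, ENNReal.coe_inv hne]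
      gcongr
      exact Set.inter_subset_right
    · exact ae_cond_of_forall_mem hS fun x hx => hx

end PeakPower

/-! ### Deterministic time sharing. -/

section Schedule

/-- Every probability vector is the limit of the empirical distributions of words. -/
theorem exists_schedule {K : Type*} [Fintype K] {w : K → ℝ} (hw : ∀ k, 0 ≤ w k)
    (hw1 : ∑ k, w k = 1) :
    ∃ κ : ∀ n : ℕ, Fin n → K, ∀ f : K → ℝ,
      Tendsto (fun n : ℕ => (∑ j, f (κ n j)) / n) atTop (𝓝 (∑ k, w k * f k)) := by
  have hK : Nonempty K := by
    by_contra h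
    rw [not_nonempty_iff] at h
    simp at hw1
  obtain ⟨k₀⟩ := hK
  -- Rounding down leaves a vanishing fraction of the positions unassigned; they are filled with
  -- `k₀`.
  let N (n : ℕ) (k : K) : ℕ := ⌊w k * n⌋₊
  have hN (n : ℕ) : ∑ k, N n k ≤ n := by
    have : (∑ k, (N n k : ℝ)) ≤ ∑ k, w k * n :=
      Finset.sum_le_sum fun k _ => Nat.floor_le (mul_nonneg (hw k) n.cast_nonneg)
    rw [← Finset.sum_mul, hw1, one_mul] at this
    exact_mod_cast this
  have e (n : ℕ) : Fin n ≃ (Σ k, Fin (N n k)) ⊕ Fin (n - ∑ k, N n k) := by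
    refine Fintype.equivOfCardEq ?_
    simp only [Fintype.card_fin, Fintype.card_sum, Fintype.card_sigma]
    have := hN n
    omega
  refine ⟨fun n j => Sum.elim (fun q => q.1) (fun _ => k₀) (e n j), fun f => ?_⟩
  have hsum (n : ℕ) : ∑ j, f (Sum.elim (fun q => q.1) (fun _ => k₀) (e n j)) =
      ∑ k, N n k * f k + (n - ∑ k, (N n k : ℝ)) * f k₀ := by
    rw [(e n).sum_comp fun q => f (Sum.elim (fun q => q.1) (fun _ => k₀) q), Fintype.sum_sum_type,
      Fintype.sum_sigma]
    simp [Nat.cast_sub (hN n)]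
  have hlim (k : K) : Tendsto (fun n : ℕ => (N n k : ℝ) / n) atTop (𝓝 (w k)) :=
    (tendsto_nat_floor_mul_div_atTop (hw k)).comp tendsto_natCast_atTop_atTop
  have hlim' : Tendsto (fun n : ℕ => ∑ k, (N n k : ℝ) / n * f k +
      (1 - ∑ k, (N n k : ℝ) / n) * f k₀) atTop
      (𝓝 (∑ k, w k * f k + (1 - ∑ k, w k) * f k₀)) :=
    (tendsto_finsetSum _ fun k _ => (hlim k).mul_const _).add
      ((tendsto_const_nhds.sub (tendsto_finsetSum _ fun k _ => hlim k)).mul_const _)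
  rw [hw1, sub_self, zero_mul, add_zero] at hlim'
  refine hlim'.congr' ?_
  filter_upwards [eventually_gt_atTop 0] with n hn
  have hn' : (n : ℝ) ≠ 0 := by exact_mod_cast hn.ne'
  rw [hsum, add_div, Finset.sum_div, ← Finset.sum_div, sub_eq_add_neg, sub_eq_add_neg]
  field_simp

end Schedule

/-! ### From approximate codes at large lengths to sequences of codes. -/

section Approachability

/-- At each n, choose a valid element within 1/n of the infimum of `g n`. The hypothesis `hne`
supplies an element where the infimum is infinite. -/
theorem exists_seq_tendsto_zero {X : ℕ → Type*} {valid : ∀ n, X n → Prop}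
    (hne : ∀ n, ∃ x, valid n x) (g : ∀ n, X n → ℝ≥0∞)
    (h : ∀ ε : ℝ≥0∞, 0 < ε → ∀ᶠ n in atTop, ∃ x, valid n x ∧ g n x ≤ ε) :
    ∃ x : ∀ n, X n, (∀ n, valid n (x n)) ∧ Tendsto (fun n => g n (x n)) atTop (𝓝 0) := by
  let f (n : ℕ) : ℝ≥0∞ := ⨅ (x : X n) (_ : valid n x), g n x
  have hx (n : ℕ) : ∃ x, valid n x ∧ g n x ≤ f n + (n : ℝ≥0∞)⁻¹ := by
    by_cases hf : f n = ∞
    · obtain ⟨x, hx⟩ := hne n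
      exact ⟨x, hx, by simp [hf]⟩
    · have : f n < f n + (n : ℝ≥0∞)⁻¹ := ENNReal.lt_add_right hf (by simp)
      obtain ⟨x, hx⟩ := iInf_lt_iff.1 this
      obtain ⟨hv, hx⟩ := iInf_lt_iff.1 hx
      exact ⟨x, hv, hx.le⟩
  choose x hv hx using hx
  refine ⟨x, hv, ?_⟩
  have hf : Tendsto f atTop (𝓝 0) := by
    refine ENNReal.tendsto_nhds_zero.2 fun ε hε => ?_
    filter_upwards [h ε hε] with n ⟨y, hy, hle⟩
    exact (iInf₂_le y hy).trans hle
  refine tendsto_of_tendsto_of_tendsto_of_le_of_le tendsto_const_nhds ?_ (fun _ => zero_le) hx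
  simpa using hf.add ENNReal.tendsto_inv_nat_nhds_zero

variable (G : GaussianTWWC) (leak : ∀ n, NonAdaptiveCode n → ℝ≥0∞) (c₁ c₂ : ℝ)

/-- How much a code misses the rates `R`, reliability and secrecy. -/
def codeDeviation (R : ℝ × ℝ) {n : ℕ} (C : NonAdaptiveCode n) : ℝ≥0∞ :=
  edist C.rate₁ R.1 + edist C.rate₂ R.2 + (C.errorProb G + leak n C)

/-- The rate pairs which codes of large length attain up to arbitrarily small deviations. -/
def approachableRates : Set (ℝ × ℝ) :=
  {R | ∀ ε : ℝ≥0∞, 0 < ε → ∀ᶠ n in atTop, ∃ C : NonAdaptiveCode n, C.PeakConstraint c₁ c₂ ∧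
    codeDeviation G leak R C ≤ ε}

/-- A nearby rate pair changes the deviation by no more than its distance to `R`. Thus limits of
rates need no diagonal construction and strict inequalities suffice later. -/
theorem isClosed_approachableRates : IsClosed (approachableRates G leak c₁ c₂) := by
  refine isClosed_of_closure_subset fun R hR ε hε => ?_
  have hε4 : 0 < ε / 2 / 2 := ENNReal.half_pos (ENNReal.half_pos hε.ne').ne'
  obtain ⟨R', hR', hd⟩ := EMetric.mem_closure_iff.1 hR _ hε4
  filter_upwards [hR' (ε / 2) (ENNReal.half_pos hε.ne')] with n ⟨C, hC, hle⟩
  refine ⟨C, hC, ?_⟩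
  have h1 : edist R'.1 R.1 ≤ ε / 2 / 2 := by
    rw [edist_comm]; exact (le_max_left _ _).trans hd.le
  have h2 : edist R'.2 R.2 ≤ ε / 2 / 2 := by
    rw [edist_comm]; exact (le_max_right _ _).trans hd.le
  calc codeDeviation G leak R C
      ≤ (edist C.rate₁ R'.1 + edist R'.1 R.1) + (edist C.rate₂ R'.2 + edist R'.2 R.2) +
        (C.errorProb G + leak n C) := by
        unfold codeDeviation
        gcongr <;> exact edist_triangle _ _ _
    _ = codeDeviation G leak R' C + (edist R'.1 R.1 + edist R'.2 R.2) := by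
        unfold codeDeviation; ring
    _ ≤ ε / 2 + (ε / 2 / 2 + ε / 2 / 2) := by gcongr
    _ = ε := by rw [ENNReal.add_halves, ENNReal.add_halves]

variable {c₁ c₂}

/-- All-zero codewords satisfy the constraint. A code is required at every length, also at those not
covered by the asymptotic construction. -/
theorem exists_peakConstraint (G : GaussianTWWC) (n : ℕ) (hc₁ : 0 ≤ c₁) (hc₂ : 0 ≤ c₂) :
    ∃ C : NonAdaptiveCode n, C.PeakConstraint c₁ c₂ :=
  ⟨_, peakConstraint_codebookCode G (M₁ := 1) (L₁ := 1) (M₂ := 1) (L₂ := 1) 0 0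
    (measurable_const (a := 0)) (measurable_const (a := 0)) one_pos one_pos one_pos one_pos
    (by simpa using hc₁) (by simpa using hc₂)⟩

theorem exists_code_seq (hc₁ : 0 ≤ c₁) (hc₂ : 0 ≤ c₂) {R : ℝ × ℝ}
    (hR : R ∈ approachableRates G leak c₁ c₂) :
    ∃ C : ∀ n : ℕ, NonAdaptiveCode n, (∀ n, (C n).PeakConstraint c₁ c₂) ∧
      Tendsto (fun n => (C n).rate₁) atTop (𝓝 R.1) ∧
      Tendsto (fun n => (C n).rate₂) atTop (𝓝 R.2) ∧
      Tendsto (fun n => (C n).errorProb G) atTop (𝓝 0) ∧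
      Tendsto (fun n => leak n (C n)) atTop (𝓝 0) := by
  obtain ⟨C, hC, h⟩ := exists_seq_tendsto_zero (fun n => exists_peakConstraint G n hc₁ hc₂)
    (fun n C => codeDeviation G leak R C) hR
  refine ⟨C, hC, tendsto_iff_edist_tendsto_0.2 ?_, tendsto_iff_edist_tendsto_0.2 ?_, ?_, ?_⟩ <;>
  refine tendsto_of_tendsto_of_tendsto_of_le_of_le tendsto_const_nhds h (fun _ => zero_le)
    fun n => ?_
  · exact le_self_add.trans le_self_add
  · exact le_add_self.trans le_self_add
  · exact le_self_add.trans le_add_self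
  · exact le_add_self.trans le_add_self

theorem approachableRates_subset_capacityJoint (hc₁ : 0 ≤ c₁) (hc₂ : 0 ≤ c₂) :
    approachableRates G (fun _ C => C.leakJoint G) c₁ c₂ ⊆ G.capacityJoint c₁ c₂ :=
  fun _ hR => exists_code_seq G _ hc₁ hc₂ hR

theorem approachableRates_subset_capacityIndividual (hc₁ : 0 ≤ c₁) (hc₂ : 0 ≤ c₂) :
    approachableRates G (fun _ C => C.leak₁ G + C.leak₂ G) c₁ c₂ ⊆
      G.capacityIndividual c₁ c₂ := fun _ hR => by
  obtain ⟨C, hC, h₁, h₂, he, hl⟩ := exists_code_seq G _ hc₁ hc₂ hR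
  exact ⟨C, hC, h₁, h₂, he,
    tendsto_of_tendsto_of_tendsto_of_le_of_le tendsto_const_nhds hl (fun _ => zero_le)
      fun _ => le_self_add,
    tendsto_of_tendsto_of_tendsto_of_le_of_le tendsto_const_nhds hl (fun _ => zero_le)
      fun _ => le_add_self⟩

end Approachability

/-! ### Codebook sizes and decay of the random coding bounds. -/

section Asymptotics

/-- The number of codewords of rate `R` and length `n`. -/
def codebookSize (R : ℝ) (n : ℕ) : ℕ := ⌈Real.exp (n * R)⌉₊

theorem codebookSize_pos (R : ℝ) (n : ℕ) : 0 < codebookSize R n :=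
  Nat.ceil_pos.2 (Real.exp_pos _)

theorem exp_le_codebookSize (R : ℝ) (n : ℕ) : Real.exp (n * R) ≤ codebookSize R n :=
  Nat.le_ceil _

/-- Rate zero gives exactly one message, the case in which `decodingBound` vanishes. -/
theorem codebookSize_zero (n : ℕ) : codebookSize 0 n = 1 := by simp [codebookSize]

theorem codebookSize_le {R : ℝ} (hR : 0 ≤ R) (n : ℕ) :
    (codebookSize R n : ℝ) ≤ 2 * Real.exp (n * R) := by
  have h1 := (Nat.ceil_lt_add_one (Real.exp_pos (n * R)).le).le
  have h2 : 1 ≤ Real.exp (n * R) := Real.one_le_exp (by positivity)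
  unfold codebookSize
  linarith

theorem codebookSize_mul_le {R r : ℝ} (hR : 0 ≤ R) (hr : 0 ≤ r) (n : ℕ) :
    (codebookSize R n * codebookSize r n : ℝ) ≤ 4 * Real.exp (n * (R + r)) := by
  calc _ ≤ (2 * Real.exp (n * R)) * (2 * Real.exp (n * r)) :=
        mul_le_mul (codebookSize_le hR n) (codebookSize_le hr n) (by positivity) (by positivity)
    _ = _ := by rw [mul_add, Real.exp_add]; ring

theorem exp_le_codebookSize_mul (R r : ℝ) (n : ℕ) :
    Real.exp (n * (R + r)) ≤ codebookSize R n * codebookSize r n := by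
  rw [mul_add, Real.exp_add]
  exact mul_le_mul (exp_le_codebookSize R n) (exp_le_codebookSize r n) (Real.exp_pos _).le
    (by positivity)

theorem tendsto_log_codebookSize_div {R : ℝ} (hR : 0 ≤ R) :
    Tendsto (fun n : ℕ => Real.log (codebookSize R n) / n) atTop (𝓝 R) := by
  have hlim : Tendsto (fun n : ℕ => R + Real.log 2 / n) atTop (𝓝 (R + 0)) :=
    tendsto_const_nhds.add (tendsto_const_div_atTop_nhds_zero_nat _)
  rw [add_zero] at hlim
  refine tendsto_of_tendsto_of_tendsto_of_le_of_le' tendsto_const_nhds hlim ?_ ?_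
  · filter_upwards [eventually_gt_atTop 0] with n hn
    have hn' : (0 : ℝ) < n := by exact_mod_cast hn
    rw [le_div_iff₀ hn', mul_comm]
    exact (Real.le_log_iff_exp_le (by exact_mod_cast codebookSize_pos R n)).2
      (exp_le_codebookSize R n)
  · filter_upwards [eventually_gt_atTop 0] with n hn
    have hn' : (0 : ℝ) < n := by exact_mod_cast hn
    rw [div_le_iff₀ hn', add_mul, div_mul_cancel₀ _ hn'.ne']
    have := Real.log_le_log (by exact_mod_cast codebookSize_pos R n) (codebookSize_le hR n)
    rw [Real.log_mul (by norm_num) (Real.exp_pos _).ne', Real.log_exp] at this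
    linarith

theorem tendsto_natCast_mul_atBot {x : ℕ → ℝ} {l : ℝ} (hl : l < 0) (hx : Tendsto x atTop (𝓝 l)) :
    Tendsto (fun n : ℕ => n * x n) atTop atBot :=
  tendsto_natCast_atTop_atTop.atTop_mul_neg hl hx

/-- The exponent is n s (S/n + 2s - r). The margin 3s leaves s to spare after the quadratic term. -/
theorem tendsto_resolvability_exponent {S : ℕ → ℝ} {E r s : ℝ} (hs : 0 < s)
    (hS : Tendsto (fun n => S n / n) atTop (𝓝 E)) (h : E + 3 * s < r) :
    Tendsto (fun n : ℕ => s * S n + n * (2 * s ^ 2) - s * (n * r)) atTop atBot := by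
  have hx : Tendsto (fun n => s * (S n / n) + 2 * s ^ 2 - s * r) atTop
      (𝓝 (s * E + 2 * s ^ 2 - s * r)) := ((hS.const_mul s).add_const _).sub_const _
  refine (tendsto_natCast_mul_atBot (by nlinarith) hx).congr' ?_
  filter_upwards [eventually_gt_atTop 0] with n hn
  have hn' : (n : ℝ) ≠ 0 := by exact_mod_cast hn.ne'
  field_simp

theorem tendsto_ofReal_exp_of_atBot {A : ℕ → ℝ} (hA : Tendsto A atTop atBot) :
    Tendsto (fun n => ENNReal.ofReal (Real.exp (A n))) atTop (𝓝 0) := by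
  simpa using ENNReal.tendsto_ofReal (Real.tendsto_exp_atBot.comp hA)

theorem tendsto_resolvabilityBound {κ : ℕ → ℝ≥0} (hκ : Tendsto κ atTop (𝓝 1)) (s : ℝ)
    {A A₁ A₂ : ℕ → ℝ} (hA : Tendsto A atTop atBot) (hA₁ : Tendsto A₁ atTop atBot)
    (hA₂ : Tendsto A₂ atTop atBot) :
    Tendsto (fun n => resolvabilityBound (κ n) s (A n) (A₁ n) (A₂ n)) atTop (𝓝 0) := by
  unfold resolvabilityBound
  have h1 : Tendsto (fun n => ENNReal.ofReal (Real.log ((κ n : ℝ) ^ 2))) atTop (𝓝 0) := by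
    have : Tendsto (fun n => Real.log ((κ n : ℝ) ^ 2)) atTop (𝓝 (Real.log ((1 : ℝ≥0) ^ 2 : ℝ))) :=
      (((NNReal.tendsto_coe.2 hκ).pow 2)).log (by simp)
    simpa using ENNReal.tendsto_ofReal this
  have h2 : Tendsto (fun n => ((κ n ^ 2 * s.toNNReal⁻¹ : ℝ≥0) : ℝ≥0∞)) atTop
      (𝓝 ((1 ^ 2 * s.toNNReal⁻¹ : ℝ≥0) : ℝ≥0∞)) :=
    ENNReal.tendsto_coe.2 ((hκ.pow 2).mul_const _)
  have h3 := ((tendsto_ofReal_exp_of_atBot hA).add (tendsto_ofReal_exp_of_atBot hA₁)).add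
    (tendsto_ofReal_exp_of_atBot hA₂)
  simp only [add_zero] at h3
  have h4 := ENNReal.Tendsto.mul h2 (.inr (by simp)) h3 (.inr ENNReal.coe_ne_top)
  simpa using h1.add h4

theorem tendsto_decodingBound {κ : ℕ → ℝ≥0} (hκ : Tendsto κ atTop (𝓝 1)) {S : ℕ → ℝ}
    {J R r s : ℝ} (hs : 0 < s) (hS : Tendsto (fun n => S n / n) atTop (𝓝 J))
    (h : R = 0 ∨ R + r + 3 * s < J) :
    Tendsto (fun n : ℕ => decodingBound (κ n) (codebookSize R n)
      (s * (n * (R + r + s)) - s * S n + n * (2 * s ^ 2)) (n * (R + r) - n * (R + r + s)))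
      atTop (𝓝 0) := by
  rcases h with rfl | h
  · simp [decodingBound, codebookSize_zero]
  -- The decoding threshold lies n s above the total rate. False acceptance then has exponent -n s,
  -- and rejection has exponent asymptotic to n s (R + r + 3s - J).
  have hA : Tendsto (fun n : ℕ => s * (n * (R + r + s)) - s * S n + n * (2 * s ^ 2))
      atTop atBot := by
    have hx : Tendsto (fun n => s * (R + r + s) - s * (S n / n) + 2 * s ^ 2) atTop
        (𝓝 (s * (R + r + s) - s * J + 2 * s ^ 2)) := ((hS.const_mul s).const_sub _).add_const _
    refine (tendsto_natCast_mul_atBot (by nlinarith) hx).congr' ?_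
    filter_upwards [eventually_gt_atTop 0] with n hn
    have hn' : (n : ℝ) ≠ 0 := by exact_mod_cast hn.ne'
    field_simp
  have hB : Tendsto (fun n : ℕ => (n : ℝ) * (R + r) - n * (R + r + s)) atTop atBot := by
    refine (tendsto_natCast_mul_atBot (x := fun _ => -s) (by linarith)
      tendsto_const_nhds).congr fun n => ?_
    ring
  have hκ' := ENNReal.tendsto_coe.2 hκ
  have h1 := ENNReal.Tendsto.mul hκ' (.inr (by simp)) (tendsto_ofReal_exp_of_atBot hA)
    (.inr ENNReal.coe_ne_top)
  have h2 : Tendsto (fun n : ℕ => ENNReal.ofReal (4 * Real.exp (n * (R + r) - n * (R + r + s))))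
      atTop (𝓝 0) := by
    simpa using ENNReal.tendsto_ofReal ((Real.tendsto_exp_atBot.comp hB).const_mul 4)
  have h3 := ENNReal.Tendsto.mul hκ' (.inr (by simp)) h2 (.inr ENNReal.coe_ne_top)
  have h4 := h1.add h3
  simp only [mul_zero, add_zero] at h4
  refine tendsto_of_tendsto_of_tendsto_of_le_of_le tendsto_const_nhds h4 (fun _ => zero_le)
    fun n => ?_
  simp only [decodingBound]
  split_ifs
  · exact zero_le
  · exact le_rfl

theorem eventually_add_mul_lt {a b : ℝ} (h : a < b) : ∀ᶠ s in 𝓝[>] (0 : ℝ), a + 3 * s < b := by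
  have : Tendsto (fun s : ℝ => a + 3 * s) (𝓝 0) (𝓝 (a + 3 * 0)) :=
    Continuous.tendsto (by fun_prop) _
  exact nhdsWithin_le_nhds (this.eventually_lt_const (by simpa using h))

variable (G : GaussianTWWC) {c₁ c₂ : ℝ}

/-- Common end of both secrecy arguments: insert the conditioned input laws. The bound `b` depends
only on κ and is uniform over the dominated laws. -/
theorem mem_approachableRates {leak : ∀ n, NonAdaptiveCode n → ℝ≥0∞} {P₁ P₂ : ℝ≥0}
    (hP₁ : (P₁ : ℝ) < c₁ ∨ P₁ = 0 ∧ 0 ≤ c₁) (hP₂ : (P₂ : ℝ) < c₂ ∨ P₂ = 0 ∧ 0 ≤ c₂)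
    {p₁ p₂ : ∀ n : ℕ, Fin n → ℝ≥0} (hp₁ : ∀ n j, p₁ n j ≤ P₁) (hp₂ : ∀ n j, p₂ n j ≤ P₂)
    {R₁ R₂ : ℝ} (hR₁ : 0 ≤ R₁) (hR₂ : 0 ≤ R₂)
    (h : ∀ κ : ℕ → ℝ≥0, Tendsto κ atTop (𝓝 1) → ∃ b : ℕ → ℝ≥0∞, Tendsto b atTop (𝓝 0) ∧
      ∀ n, ∀ Q₁ Q₂ : Measure (Fin n → ℝ), IsProbabilityMeasure Q₁ → IsProbabilityMeasure Q₂ →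
        Q₁ ≤ κ n • gaussianVec (p₁ n) → Q₂ ≤ κ n • gaussianVec (p₂ n) →
        (∀ᵐ x ∂Q₁, (1 / (n : ℝ)) * ∑ j, x j ^ 2 ≤ c₁) →
        (∀ᵐ x ∂Q₂, (1 / (n : ℝ)) * ∑ j, x j ^ 2 ≤ c₂) →
        ∃ C : NonAdaptiveCode n, C.M₁ = codebookSize R₁ n ∧ C.M₂ = codebookSize R₂ n ∧
          C.PeakConstraint c₁ c₂ ∧ C.errorProb G + leak n C ≤ b n) :
    (R₁, R₂) ∈ approachableRates G leak c₁ c₂ := by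
  obtain ⟨κ₁, hκ₁, hQ₁⟩ := exists_peak_measure hP₁
  obtain ⟨κ₂, hκ₂, hQ₂⟩ := exists_peak_measure hP₂
  have hκ : Tendsto (fun n => max (κ₁ n) (κ₂ n)) atTop (𝓝 1) := by simpa using hκ₁.max hκ₂
  obtain ⟨b, hb, h⟩ := h _ hκ
  have hr₁ := tendsto_iff_edist_tendsto_0.1 (tendsto_log_codebookSize_div hR₁)
  have hr₂ := tendsto_iff_edist_tendsto_0.1 (tendsto_log_codebookSize_div hR₂)
  have hlim := (hr₁.add hr₂).add hb
  simp only [add_zero] at hlim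
  intro ε hε
  filter_upwards [ENNReal.tendsto_nhds_zero.1 hlim ε hε, hQ₁, hQ₂] with n hn hQ₁ hQ₂
  obtain ⟨Q₁, i₁, hle₁, hc₁⟩ := hQ₁ (p₁ n) (hp₁ n)
  obtain ⟨Q₂, i₂, hle₂, hc₂⟩ := hQ₂ (p₂ n) (hp₂ n)
  have mono {k k' : ℝ≥0} (hk : k ≤ k') (μ : Measure (Fin n → ℝ)) : k • μ ≤ k' • μ := by
    refine Measure.le_iff.2 fun A _ => ?_
    simp only [Measure.smul_apply]
    gcongr
  obtain ⟨C, h1, h2, hC, hle⟩ := h n Q₁ Q₂ i₁ i₂ (hle₁.trans (mono (le_max_left _ _) _))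
    (hle₂.trans (mono (le_max_right _ _) _)) hc₁ hc₂
  refine ⟨C, hC, le_trans ?_ hn⟩
  unfold codeDeviation NonAdaptiveCode.rate₁ NonAdaptiveCode.rate₂
  rw [h1, h2]
  gcongr

theorem mem_approachableRates_joint {P₁ P₂ : ℝ≥0}
    (hP₁ : (P₁ : ℝ) < c₁ ∨ P₁ = 0 ∧ 0 ≤ c₁) (hP₂ : (P₂ : ℝ) < c₂ ∨ P₂ = 0 ∧ 0 ≤ c₂)
    {p₁ p₂ : ∀ n : ℕ, Fin n → ℝ≥0} (hp₁ : ∀ n j, p₁ n j ≤ P₁) (hp₂ : ∀ n j, p₂ n j ≤ P₂)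
    {J₁ J₂ E E₁ E₂ : ℝ}
    (hJ₁ : Tendsto (fun n => (∑ j, gaussianInfo G.a₂ G.v₂ (p₁ n j)) / n) atTop (𝓝 J₁))
    (hJ₂ : Tendsto (fun n => (∑ j, gaussianInfo G.b₁ G.v₁ (p₂ n j)) / n) atTop (𝓝 J₂))
    (hE : Tendsto (fun n => (∑ j, infoEve G (p₁ n j) (p₂ n j)) / n) atTop (𝓝 E))
    (hE₁ : Tendsto (fun n => (∑ j, infoEve₁ G (p₁ n j) (p₂ n j)) / n) atTop (𝓝 E₁))
    (hE₂ : Tendsto (fun n => (∑ j, infoEve₂ G (p₁ n j) (p₂ n j)) / n) atTop (𝓝 E₂))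
    {R₁ R₂ r₁ r₂ : ℝ} (hR₁ : 0 ≤ R₁) (hR₂ : 0 ≤ R₂) (hr₁ : 0 ≤ r₁) (hr₂ : 0 ≤ r₂)
    (hd₁ : R₁ = 0 ∨ R₁ + r₁ < J₁) (hd₂ : R₂ = 0 ∨ R₂ + r₂ < J₂)
    (he₁ : E₁ < r₁) (he₂ : E₂ < r₂) (he : E < r₁ + r₂) :
    (R₁, R₂) ∈ approachableRates G (fun _ C => C.leakJoint G) c₁ c₂ := by
  have hd {R r J : ℝ} (h : R = 0 ∨ R + r < J) :
      ∀ᶠ s in 𝓝[>] (0 : ℝ), R = 0 ∨ R + r + 3 * s < J := by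
    rcases h with h | h
    · exact .of_forall fun _ => .inl h
    · exact (eventually_add_mul_lt h).mono fun _ => .inr
  -- All strict inequalities hold with margin 3s for a common small s.
  obtain ⟨s, hs, hs1, hd₁, hd₂, he₁, he₂, he⟩ := ((eventually_mem_nhdsWithin (a := (0 : ℝ))
    (s := Set.Ioi 0)).and (((eventually_le_nhds (by norm_num : (0 : ℝ) < 1 / 4)).filter_mono nhdsWithin_le_nhds).and
    ((hd hd₁).and ((hd hd₂).and ((eventually_add_mul_lt he₁).and ((eventually_add_mul_lt he₂).and
    (eventually_add_mul_lt he))))))).exists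
  have hs : 0 < s := hs
  refine mem_approachableRates G hP₁ hP₂ hp₁ hp₂ hR₁ hR₂ fun κ hκ => ?_
  refine ⟨_, ?_, fun n Q₁ Q₂ _ _ hQ₁ hQ₂ hc₁ hc₂ =>
    exists_code_joint G (codebookSize_pos R₁ n) (codebookSize_pos r₁ n) (codebookSize_pos R₂ n)
      (codebookSize_pos r₂ n) (p₁ n) (p₂ n) hQ₁ hQ₂ hc₁ hc₂ (t₁ := n * (R₁ + r₁ + s))
      (t₂ := n * (R₂ + r₂ + s)) hs hs1 (codebookSize_mul_le hR₁ hr₁ n)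
      (codebookSize_mul_le hR₂ hr₂ n) (exp_le_codebookSize r₁ n) (exp_le_codebookSize r₂ n)⟩
  have := ((tendsto_decodingBound hκ hs hJ₁ hd₁).add (tendsto_decodingBound hκ hs hJ₂ hd₂)).add
    (tendsto_resolvabilityBound hκ s (tendsto_resolvability_exponent hs hE he)
      (tendsto_resolvability_exponent hs hE₁ he₁) (tendsto_resolvability_exponent hs hE₂ he₂))
  simpa only [mul_add, add_zero] using this

theorem mem_approachableRates_individual {P₁ P₂ : ℝ≥0}
    (hP₁ : (P₁ : ℝ) < c₁ ∨ P₁ = 0 ∧ 0 ≤ c₁) (hP₂ : (P₂ : ℝ) < c₂ ∨ P₂ = 0 ∧ 0 ≤ c₂)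
    {p₁ p₂ : ∀ n : ℕ, Fin n → ℝ≥0} (hp₁ : ∀ n j, p₁ n j ≤ P₁) (hp₂ : ∀ n j, p₂ n j ≤ P₂)
    {J₁ J₂ E E₁ E₂ : ℝ}
    (hJ₁ : Tendsto (fun n => (∑ j, gaussianInfo G.a₂ G.v₂ (p₁ n j)) / n) atTop (𝓝 J₁))
    (hJ₂ : Tendsto (fun n => (∑ j, gaussianInfo G.b₁ G.v₁ (p₂ n j)) / n) atTop (𝓝 J₂))
    (hE : Tendsto (fun n => (∑ j, infoEve G (p₁ n j) (p₂ n j)) / n) atTop (𝓝 E))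
    (hE₁ : Tendsto (fun n => (∑ j, infoEve₁ G (p₁ n j) (p₂ n j)) / n) atTop (𝓝 E₁))
    (hE₂ : Tendsto (fun n => (∑ j, infoEve₂ G (p₁ n j) (p₂ n j)) / n) atTop (𝓝 E₂))
    {R₁ R₂ r₁ r₂ : ℝ} (hR₁ : 0 ≤ R₁) (hR₂ : 0 ≤ R₂) (hr₁ : 0 ≤ r₁) (hr₂ : 0 ≤ r₂)
    (hd₁ : R₁ = 0 ∨ R₁ + r₁ < J₁) (hd₂ : R₂ = 0 ∨ R₂ + r₂ < J₂)
    (he₁ : E₁ < r₁) (he₂ : E₂ < r₂) (he : E < r₁ + (R₂ + r₂)) (he' : E < R₁ + r₁ + r₂) :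
    (R₁, R₂) ∈ approachableRates G (fun _ C => C.leak₁ G + C.leak₂ G) c₁ c₂ := by
  have hd {R r J : ℝ} (h : R = 0 ∨ R + r < J) :
      ∀ᶠ s in 𝓝[>] (0 : ℝ), R = 0 ∨ R + r + 3 * s < J := by
    rcases h with h | h
    · exact .of_forall fun _ => .inl h
    · exact (eventually_add_mul_lt h).mono fun _ => .inr
  obtain ⟨s, hs, hs1, hd₁, hd₂, he₁, he₂, he, he'⟩ := ((eventually_mem_nhdsWithin (a := (0 : ℝ))
    (s := Set.Ioi 0)).and (((eventually_le_nhds (by norm_num : (0 : ℝ) < 1 / 4)).filter_mono nhdsWithin_le_nhds).and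
    ((hd hd₁).and ((hd hd₂).and ((eventually_add_mul_lt he₁).and ((eventually_add_mul_lt he₂).and
    ((eventually_add_mul_lt he).and (eventually_add_mul_lt he')))))))).exists
  have hs : 0 < s := hs
  refine mem_approachableRates G hP₁ hP₂ hp₁ hp₂ hR₁ hR₂ fun κ hκ => ?_
  refine ⟨_, ?_, fun n Q₁ Q₂ _ _ hQ₁ hQ₂ hc₁ hc₂ =>
    exists_code_individual G (codebookSize_pos R₁ n) (codebookSize_pos r₁ n)
      (codebookSize_pos R₂ n) (codebookSize_pos r₂ n) (p₁ n) (p₂ n) hQ₁ hQ₂ hc₁ hc₂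
      (t₁ := n * (R₁ + r₁ + s)) (t₂ := n * (R₂ + r₂ + s)) hs hs1 (codebookSize_mul_le hR₁ hr₁ n)
      (codebookSize_mul_le hR₂ hr₂ n) (exp_le_codebookSize r₁ n) (exp_le_codebookSize r₂ n)
      (exp_le_codebookSize_mul R₁ r₁ n) (exp_le_codebookSize_mul R₂ r₂ n)⟩
  have := ((tendsto_decodingBound hκ hs hJ₁ hd₁).add (tendsto_decodingBound hκ hs hJ₂ hd₂)).add
    ((tendsto_resolvabilityBound hκ s (tendsto_resolvability_exponent hs hE he)
      (tendsto_resolvability_exponent hs hE₁ he₁)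
      (tendsto_resolvability_exponent hs hE₂ (r := R₂ + r₂) (by linarith))).add
    (tendsto_resolvabilityBound hκ s (tendsto_resolvability_exponent hs hE he')
      (tendsto_resolvability_exponent hs hE₁ (r := R₁ + r₁) (by linarith))
      (tendsto_resolvability_exponent hs hE₂ he₂)))
  simpa only [mul_add, add_zero] using this

end Asymptotics

/-! ### Elimination of the randomization rates, perturbation and time sharing. -/

section InnerBound

/-- Fourier–Motzkin elimination of r₁ and r₂. A user of rate zero has no upper limit on its
randomization rate, so its rate is simply chosen large. -/
theorem exists_randomization_rates_joint {J₁ J₂ E E₁ E₂ R₁ R₂ : ℝ} (hE₁ : 0 ≤ E₁) (hE₂ : 0 ≤ E₂)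
    (h₁ : R₁ = 0 ∨ R₁ < J₁ - E₁) (h₂ : R₂ = 0 ∨ R₂ < J₂ - E₂)
    (h₁₂ : R₁ = 0 ∨ R₂ = 0 ∨ R₁ + R₂ < J₁ + J₂ - E) :
    ∃ r₁ r₂, 0 ≤ r₁ ∧ 0 ≤ r₂ ∧ (R₁ = 0 ∨ R₁ + r₁ < J₁) ∧ (R₂ = 0 ∨ R₂ + r₂ < J₂) ∧
      E₁ < r₁ ∧ E₂ < r₂ ∧ E < r₁ + r₂ := by
  have hE := le_abs_self E
  have hE' := abs_nonneg E
  have one {R J F : ℝ} (h : R = 0 ∨ R < J - F) : ∃ r, (R = 0 ∨ R + r < J) ∧ F < r := by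
    rcases h with h | h
    · exact ⟨F + 1, .inl h, by linarith⟩
    · exact ⟨(F + (J - R)) / 2, .inr (by linarith), by linarith⟩
  rcases h₁₂ with h | h | h
  · obtain ⟨r₂, hd, hr⟩ := one h₂
    exact ⟨E₁ + |E| + 1, r₂, by linarith, by linarith, .inl h, hd, by linarith, hr, by linarith⟩
  · obtain ⟨r₁, hd, hr⟩ := one h₁
    exact ⟨r₁, E₂ + |E| + 1, by linarith, by linarith, hd, .inl h, hr, by linarith, by linarith⟩
  rcases h₁ with h1 | h1
  · obtain ⟨r₂, hd, hr⟩ := one h₂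
    exact ⟨E₁ + |E| + 1, r₂, by linarith, by linarith, .inl h1, hd, by linarith, hr, by linarith⟩
  rcases h₂ with h2 | h2
  · obtain ⟨r₁, hd, hr⟩ := one (R := R₁) (J := J₁) (F := E₁) (.inr h1)
    exact ⟨r₁, E₂ + |E| + 1, by linarith, by linarith, hd, .inl h2, hr, by linarith, by linarith⟩
  -- Taking each r_i at distance δ/3 below its decoding limit spends 2δ/3 of the slack in the sum
  -- condition and leaves δ/3.
  set δ := min (J₁ - E₁ - R₁) (min (J₂ - E₂ - R₂) (J₁ + J₂ - E - R₁ - R₂)) with hδ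
  have hpos : 0 < δ := lt_min (by linarith) (lt_min (by linarith) (by linarith))
  have d1 : δ ≤ J₁ - E₁ - R₁ := min_le_left _ _
  have d2 : δ ≤ J₂ - E₂ - R₂ := (min_le_right _ _).trans (min_le_left _ _)
  have d3 : δ ≤ J₁ + J₂ - E - R₁ - R₂ := (min_le_right _ _).trans (min_le_right _ _)
  exact ⟨J₁ - R₁ - δ / 3, J₂ - R₂ - δ / 3, by linarith, by linarith, .inr (by linarith),
    .inr (by linarith), by linarith, by linarith, by linarith⟩

/-- Both sum conditions follow from r₁ + r₂ > E - min(R₁, R₂). As R₁ + R₂ = max + min, this is the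
joint problem with E replaced by E - min(R₁, R₂). -/
theorem exists_randomization_rates_individual {J₁ J₂ E E₁ E₂ R₁ R₂ : ℝ} (hE₁ : 0 ≤ E₁)
    (hE₂ : 0 ≤ E₂) (h₁ : R₁ = 0 ∨ R₁ < J₁ - E₁) (h₂ : R₂ = 0 ∨ R₂ < J₂ - E₂)
    (h₁₂ : R₁ = 0 ∨ R₂ = 0 ∨ max R₁ R₂ < J₁ + J₂ - E) :
    ∃ r₁ r₂, 0 ≤ r₁ ∧ 0 ≤ r₂ ∧ (R₁ = 0 ∨ R₁ + r₁ < J₁) ∧ (R₂ = 0 ∨ R₂ + r₂ < J₂) ∧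
      E₁ < r₁ ∧ E₂ < r₂ ∧ E < r₁ + (R₂ + r₂) ∧ E < R₁ + r₁ + r₂ := by
  have key : R₁ = 0 ∨ R₂ = 0 ∨ R₁ + R₂ < J₁ + J₂ - (E - min R₁ R₂) := by
    refine h₁₂.imp_right (Or.imp_right fun h => ?_)
    have := max_add_min R₁ R₂
    linarith
  obtain ⟨r₁, r₂, h0₁, h0₂, hd₁, hd₂, he₁, he₂, he⟩ :=
    exists_randomization_rates_joint hE₁ hE₂ h₁ h₂ key
  have := min_le_left R₁ R₂
  have := min_le_right R₁ R₂
  exact ⟨r₁, r₂, h0₁, h0₂, hd₁, hd₂, he₁, he₂, by linarith, by linarith⟩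

theorem continuous_gaussianInfo (a : ℝ) {v : ℝ≥0} (hv : 0 < v) :
    Continuous (gaussianInfo a v) := by
  have hv' : (0 : ℝ) < v := by exact_mod_cast hv
  unfold gaussianInfo
  refine continuous_const.mul (Continuous.log (by fun_prop) fun p => ?_)
  positivity

variable (G : GaussianTWWC)

@[fun_prop]
theorem continuous_eveVar {X : Type*} [TopologicalSpace X] {f g : X → ℝ≥0} (hf : Continuous f)
    (hg : Continuous g) : Continuous fun x => eveVar G (f x) (g x) := by
  unfold eveVar; fun_prop

theorem continuous_log_eveVar_div {X : Type*} [TopologicalSpace X] {f g : X → ℝ≥0}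
    (hf : Continuous f) (hg : Continuous g) {u : X → ℝ≥0} (hu : Continuous u)
    (hu0 : ∀ x, 0 < u x) :
    Continuous fun x => 1 / 2 * Real.log (eveVar G (f x) (g x) / u x) := by
  have h1 (x : X) : (u x : ℝ) ≠ 0 := by exact_mod_cast (hu0 x).ne'
  have h2 (x : X) : (eveVar G (f x) (g x) : ℝ) ≠ 0 := by exact_mod_cast (eveVar_pos G _ _).ne'
  have h3 : Continuous fun x => (u x : ℝ) := by fun_prop
  exact continuous_const.mul (Continuous.log (Continuous.div (by fun_prop) h3 h1)
    fun x => div_ne_zero (h2 x) (h1 x))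

theorem infoEve₁_nonneg (p q : ℝ≥0) : 0 ≤ infoEve₁ G p q := by
  refine mul_nonneg (by norm_num) (Real.log_nonneg ?_)
  rw [one_le_div (by exact_mod_cast eveVar_pos G 0 q)]
  simp only [coe_eveVar, NNReal.coe_zero]
  nlinarith [mul_nonneg (sq_nonneg G.a₃) p.coe_nonneg]

theorem infoEve₂_nonneg (p q : ℝ≥0) : 0 ≤ infoEve₂ G p q := by
  refine mul_nonneg (by norm_num) (Real.log_nonneg ?_)
  rw [one_le_div (by exact_mod_cast eveVar_pos G p 0)]
  simp only [coe_eveVar, NNReal.coe_zero]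
  nlinarith [mul_nonneg (sq_nonneg G.b₃) q.coe_nonneg]

theorem gaussianInfo_eq (a : ℝ) {v : ℝ≥0} (hv : 0 < v) (p : ℝ≥0) :
    gaussianInfo a v p = 1 / 2 * (Real.log (a ^ 2 * p + v) - Real.log v) := by
  have hv' : (0 : ℝ) < v := by exact_mod_cast hv
  rw [gaussianInfo, Real.log_div (by positivity) hv'.ne']

theorem bound₁_eq (p q : ℝ≥0) :
    G.bound₁ p q = gaussianInfo G.a₂ G.v₂ p - infoEve₁ G p q := by
  have h1 : (eveVar G p q : ℝ) ≠ 0 := by exact_mod_cast (eveVar_pos G p q).ne'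
  have h2 : (eveVar G 0 q : ℝ) ≠ 0 := by exact_mod_cast (eveVar_pos G 0 q).ne'
  rw [gaussianInfo_eq _ G.v₂_pos, infoEve₁, Real.log_div h1 h2, GaussianTWWC.bound₁, coe_eveVar,
    coe_eveVar, NNReal.coe_zero, mul_zero, zero_add]
  ring

theorem bound₂_eq (p q : ℝ≥0) :
    G.bound₂ p q = gaussianInfo G.b₁ G.v₁ q - infoEve₂ G p q := by
  have h1 : (eveVar G p q : ℝ) ≠ 0 := by exact_mod_cast (eveVar_pos G p q).ne'
  have h2 : (eveVar G p 0 : ℝ) ≠ 0 := by exact_mod_cast (eveVar_pos G p 0).ne'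
  rw [gaussianInfo_eq _ G.v₁_pos, infoEve₂, Real.log_div h1 h2, GaussianTWWC.bound₂, coe_eveVar,
    coe_eveVar, NNReal.coe_zero, mul_zero, add_zero]
  ring

theorem bound₁₂_eq (p q : ℝ≥0) : G.bound₁₂ p q =
    gaussianInfo G.a₂ G.v₂ p + gaussianInfo G.b₁ G.v₁ q - infoEve G p q := by
  have h1 : (eveVar G p q : ℝ) ≠ 0 := by exact_mod_cast (eveVar_pos G p q).ne'
  have h2 : (G.v₃ : ℝ) ≠ 0 := by exact_mod_cast G.v₃_pos.ne'
  rw [gaussianInfo_eq _ G.v₁_pos, gaussianInfo_eq _ G.v₂_pos, infoEve, Real.log_div h1 h2,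
    GaussianTWWC.bound₁₂, coe_eveVar]
  ring

/-- A rate pair inside the time-shared bounds, shrunk by a factor, lies strictly inside the bounds
for slightly reduced powers. -/
theorem exists_power_reduction {K : Type*} [Fintype K] (w : K → ℝ) (p q : K → ℝ≥0)
    {R₁ R₂ R₁₂ : ℝ}
    (h₁ : R₁ = 0 ∨ R₁ < ∑ k, w k * gaussianInfo G.a₂ G.v₂ (p k) -
      ∑ k, w k * infoEve₁ G (p k) (q k))
    (h₂ : R₂ = 0 ∨ R₂ < ∑ k, w k * gaussianInfo G.b₁ G.v₁ (q k) -
      ∑ k, w k * infoEve₂ G (p k) (q k))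
    (h₁₂ : R₁ = 0 ∨ R₂ = 0 ∨ R₁₂ < ∑ k, w k * gaussianInfo G.a₂ G.v₂ (p k) +
      ∑ k, w k * gaussianInfo G.b₁ G.v₁ (q k) - ∑ k, w k * infoEve G (p k) (q k)) :
    ∃ θ : ℝ≥0, θ < 1 ∧
      (R₁ = 0 ∨ R₁ < ∑ k, w k * gaussianInfo G.a₂ G.v₂ (θ * p k) -
        ∑ k, w k * infoEve₁ G (θ * p k) (θ * q k)) ∧
      (R₂ = 0 ∨ R₂ < ∑ k, w k * gaussianInfo G.b₁ G.v₁ (θ * q k) -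
        ∑ k, w k * infoEve₂ G (θ * p k) (θ * q k)) ∧
      (R₁ = 0 ∨ R₂ = 0 ∨ R₁₂ < ∑ k, w k * gaussianInfo G.a₂ G.v₂ (θ * p k) +
        ∑ k, w k * gaussianInfo G.b₁ G.v₁ (θ * q k) -
        ∑ k, w k * infoEve G (θ * p k) (θ * q k)) := by
  have c1 : Continuous fun θ : ℝ≥0 => ∑ k, w k * gaussianInfo G.a₂ G.v₂ (θ * p k) := by
    have := continuous_gaussianInfo G.a₂ G.v₂_pos
    fun_prop
  have c2 : Continuous fun θ : ℝ≥0 => ∑ k, w k * gaussianInfo G.b₁ G.v₁ (θ * q k) := by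
    have := continuous_gaussianInfo G.b₁ G.v₁_pos
    fun_prop
  have c3 : Continuous fun θ : ℝ≥0 => ∑ k, w k * infoEve G (θ * p k) (θ * q k) :=
    continuous_finsetSum _ fun k _ => continuous_const.mul (continuous_log_eveVar_div G
      (by fun_prop) (by fun_prop) continuous_const fun _ => G.v₃_pos)
  have c4 : Continuous fun θ : ℝ≥0 => ∑ k, w k * infoEve₁ G (θ * p k) (θ * q k) :=
    continuous_finsetSum _ fun k _ => continuous_const.mul (continuous_log_eveVar_div G
      (by fun_prop) (by fun_prop) (by fun_prop) fun _ => eveVar_pos G _ _)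
  have c5 : Continuous fun θ : ℝ≥0 => ∑ k, w k * infoEve₂ G (θ * p k) (θ * q k) :=
    continuous_finsetSum _ fun k _ => continuous_const.mul (continuous_log_eveVar_div G
      (by fun_prop) (by fun_prop) (by fun_prop) fun _ => eveVar_pos G _ _)
  -- Strict inequalities at θ = 1 persist for θ slightly smaller, by continuity of all informations
  -- in the powers.
  have ev {F : ℝ≥0 → ℝ} (hF : Continuous F) {R : ℝ} (h : R < F 1) : ∀ᶠ θ in 𝓝[<] 1, R < F θ :=
    nhdsWithin_le_nhds (hF.continuousAt.eventually_const_lt h)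
  have e1 : ∀ᶠ θ : ℝ≥0 in 𝓝[<] 1, R₁ = 0 ∨ R₁ < ∑ k, w k * gaussianInfo G.a₂ G.v₂ (θ * p k) -
        ∑ k, w k * infoEve₁ G (θ * p k) (θ * q k) := by
    rcases h₁ with h | h
    · exact .of_forall fun _ => .inl h
    · exact (ev (c1.sub c4) (by simpa using h)).mono fun _ => .inr
  have e2 : ∀ᶠ θ : ℝ≥0 in 𝓝[<] 1, R₂ = 0 ∨ R₂ < ∑ k, w k * gaussianInfo G.b₁ G.v₁ (θ * q k) -
        ∑ k, w k * infoEve₂ G (θ * p k) (θ * q k) := by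
    rcases h₂ with h | h
    · exact .of_forall fun _ => .inl h
    · exact (ev (c2.sub c5) (by simpa using h)).mono fun _ => .inr
  have e3 : ∀ᶠ θ : ℝ≥0 in 𝓝[<] 1, R₁ = 0 ∨ R₂ = 0 ∨
      R₁₂ < ∑ k, w k * gaussianInfo G.a₂ G.v₂ (θ * p k) +
        ∑ k, w k * gaussianInfo G.b₁ G.v₁ (θ * q k) -
        ∑ k, w k * infoEve G (θ * p k) (θ * q k) := by
    rcases h₁₂ with h | h | h
    · exact .of_forall fun _ => .inl h
    · exact .of_forall fun _ => .inr (.inl h)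
    · exact (ev ((c1.add c2).sub c3) (by simpa using h)).mono fun _ h => .inr (.inr h)
  have : (𝓝[<] (1 : ℝ≥0)).NeBot := nhdsLT_neBot_of_exists_lt ⟨0, one_pos⟩
  obtain ⟨θ, h0, h1, h2, h3⟩ := ((eventually_mem_nhdsWithin (a := (1 : ℝ≥0))
    (s := Set.Iio 1)).and (e1.and (e2.and e3))).exists
  exact ⟨θ, h0, h1, h2, h3⟩

/-- A zero power limit leaves no room for a strict reduction, which is why the zero-power
alternative accompanies the strict one. -/
theorem reduced_power_lt {c : ℝ} (hc : 0 ≤ c) {θ : ℝ≥0} (hθ : θ < 1) :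
    ((θ * c.toNNReal : ℝ≥0) : ℝ) < c ∨ θ * c.toNNReal = 0 ∧ 0 ≤ c := by
  rcases hc.eq_or_lt with rfl | hc'
  · right; simp
  · left
    rw [NNReal.coe_mul, Real.coe_toNNReal _ hc]
    have : (θ : ℝ) < 1 := by exact_mod_cast hθ
    nlinarith

variable {c₁ c₂ : ℝ}

/-- Scaling the rates by η < 1 makes the averaged bounds strict, scaling the powers by θ < 1 leaves
room for the peak constraint, and the schedule realizes the averages. Closedness restores η = 1. -/
theorem mem_approachableRates_joint_of_average (hc₁ : 0 ≤ c₁) (hc₂ : 0 ≤ c₂) {K : Type*}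
    [Fintype K] {w : K → ℝ} (hw : ∀ k, 0 ≤ w k) (hw1 : ∑ k, w k = 1) {p q : K → ℝ≥0}
    (hp : ∀ k, p k ≤ c₁.toNNReal) (hq : ∀ k, q k ≤ c₂.toNNReal) {R₁ R₂ : ℝ} (hR₁ : 0 ≤ R₁)
    (hR₂ : 0 ≤ R₂) (h₁ : R₁ ≤ ∑ k, w k * G.bound₁ (p k) (q k))
    (h₂ : R₂ ≤ ∑ k, w k * G.bound₂ (p k) (q k))
    (h₁₂ : R₁ + R₂ ≤ ∑ k, w k * G.bound₁₂ (p k) (q k)) :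
    (R₁, R₂) ∈ approachableRates G (fun _ C => C.leakJoint G) c₁ c₂ := by
  simp only [bound₁_eq, bound₂_eq, bound₁₂_eq, mul_sub, mul_add, Finset.sum_sub_distrib,
    Finset.sum_add_distrib] at h₁ h₂ h₁₂
  have key (η : ℝ) (h0 : 0 < η) (h1 : η < 1) :
      (η * R₁, η * R₂) ∈ approachableRates G (fun _ C => C.leakJoint G) c₁ c₂ := by
    -- Scaling gives no strict inequality at rate zero; that alternative is carried along instead.
    have shrink {R : ℝ} (hR : 0 ≤ R) : η * R = 0 ∨ η * R < R := by
      rcases hR.eq_or_lt with rfl | h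
      · simp
      · right; nlinarith
    obtain ⟨θ, hθ, k₁, k₂, k₁₂⟩ := exists_power_reduction G w p q (R₁ := η * R₁) (R₂ := η * R₂)
      (R₁₂ := η * R₁ + η * R₂) ((shrink hR₁).imp_right fun h => h.trans_le h₁)
      ((shrink hR₂).imp_right fun h => h.trans_le h₂) (by
        rcases shrink hR₁ with h | h
        · exact .inl h
        rcases shrink hR₂ with h' | h'
        · exact .inr (.inl h')
        · exact .inr (.inr (by linarith)))
    obtain ⟨r₁, r₂, h0₁, h0₂, hd₁, hd₂, he₁, he₂, he⟩ := exists_randomization_rates_joint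
      (Finset.sum_nonneg fun k _ => mul_nonneg (hw k) (infoEve₁_nonneg G _ _))
      (Finset.sum_nonneg fun k _ => mul_nonneg (hw k) (infoEve₂_nonneg G _ _)) k₁ k₂ k₁₂
    obtain ⟨κ, hκ⟩ := exists_schedule hw hw1
    exact mem_approachableRates_joint G (reduced_power_lt hc₁ hθ) (reduced_power_lt hc₂ hθ)
      (p₁ := fun n j => θ * p (κ n j)) (p₂ := fun n j => θ * q (κ n j))
      (fun n j => mul_le_mul_right (hp _) θ) (fun n j => mul_le_mul_right (hq _) θ)
      (hκ fun k => gaussianInfo G.a₂ G.v₂ (θ * p k)) (hκ fun k => gaussianInfo G.b₁ G.v₁ (θ * q k))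
      (hκ fun k => infoEve G (θ * p k) (θ * q k)) (hκ fun k => infoEve₁ G (θ * p k) (θ * q k))
      (hκ fun k => infoEve₂ G (θ * p k) (θ * q k)) (by positivity) (by positivity) h0₁ h0₂ hd₁ hd₂
      he₁ he₂ he
  have hlim : Tendsto (fun η : ℝ => (η * R₁, η * R₂)) (𝓝[<] 1) (𝓝 (1 * R₁, 1 * R₂)) :=
    (Continuous.tendsto (by fun_prop) (1 : ℝ)).mono_left nhdsWithin_le_nhds
  rw [one_mul, one_mul] at hlim
  refine (isClosed_approachableRates G _ c₁ c₂).mem_of_tendsto hlim ?_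
  filter_upwards [Ioo_mem_nhdsLT (zero_lt_one' ℝ)] with η hη using key η hη.1 hη.2

theorem mem_approachableRates_individual_of_average (hc₁ : 0 ≤ c₁) (hc₂ : 0 ≤ c₂) {K : Type*}
    [Fintype K] {w : K → ℝ} (hw : ∀ k, 0 ≤ w k) (hw1 : ∑ k, w k = 1) {p q : K → ℝ≥0}
    (hp : ∀ k, p k ≤ c₁.toNNReal) (hq : ∀ k, q k ≤ c₂.toNNReal) {R₁ R₂ : ℝ} (hR₁ : 0 ≤ R₁)
    (hR₂ : 0 ≤ R₂) (h₁ : R₁ ≤ ∑ k, w k * G.bound₁ (p k) (q k))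
    (h₂ : R₂ ≤ ∑ k, w k * G.bound₂ (p k) (q k))
    (h₁₂ : max R₁ R₂ ≤ ∑ k, w k * G.bound₁₂ (p k) (q k)) :
    (R₁, R₂) ∈ approachableRates G (fun _ C => C.leak₁ G + C.leak₂ G) c₁ c₂ := by
  simp only [bound₁_eq, bound₂_eq, bound₁₂_eq, mul_sub, mul_add, Finset.sum_sub_distrib,
    Finset.sum_add_distrib] at h₁ h₂ h₁₂
  have key (η : ℝ) (h0 : 0 < η) (h1 : η < 1) :
      (η * R₁, η * R₂) ∈ approachableRates G (fun _ C => C.leak₁ G + C.leak₂ G) c₁ c₂ := by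
    have shrink {R : ℝ} (hR : 0 ≤ R) : η * R = 0 ∨ η * R < R := by
      rcases hR.eq_or_lt with rfl | h
      · simp
      · right; nlinarith
    obtain ⟨θ, hθ, k₁, k₂, k₁₂⟩ := exists_power_reduction G w p q (R₁ := η * R₁) (R₂ := η * R₂)
      (R₁₂ := max (η * R₁) (η * R₂)) ((shrink hR₁).imp_right fun h => h.trans_le h₁)
      ((shrink hR₂).imp_right fun h => h.trans_le h₂) (by
        rcases shrink hR₁ with h | h
        · exact .inl h
        rcases shrink hR₂ with h' | h'
        · exact .inr (.inl h')
        · exact .inr (.inr ((max_lt_max h h').trans_le h₁₂)))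
    have hR₁' : 0 ≤ η * R₁ := by positivity
    have hR₂' : 0 ≤ η * R₂ := by positivity
    obtain ⟨r₁, r₂, h0₁, h0₂, hd₁, hd₂, he₁, he₂, he, he'⟩ := exists_randomization_rates_individual
      (Finset.sum_nonneg fun k _ => mul_nonneg (hw k) (infoEve₁_nonneg G _ _))
      (Finset.sum_nonneg fun k _ => mul_nonneg (hw k) (infoEve₂_nonneg G _ _)) k₁ k₂ k₁₂
    obtain ⟨κ, hκ⟩ := exists_schedule hw hw1
    exact mem_approachableRates_individual G (reduced_power_lt hc₁ hθ) (reduced_power_lt hc₂ hθ)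
      (p₁ := fun n j => θ * p (κ n j)) (p₂ := fun n j => θ * q (κ n j))
      (fun n j => mul_le_mul_right (hp _) θ) (fun n j => mul_le_mul_right (hq _) θ)
      (hκ fun k => gaussianInfo G.a₂ G.v₂ (θ * p k)) (hκ fun k => gaussianInfo G.b₁ G.v₁ (θ * q k))
      (hκ fun k => infoEve G (θ * p k) (θ * q k)) (hκ fun k => infoEve₁ G (θ * p k) (θ * q k))
      (hκ fun k => infoEve₂ G (θ * p k) (θ * q k)) hR₁' hR₂' h0₁ h0₂ hd₁ hd₂ he₁ he₂ he he'
  have hlim : Tendsto (fun η : ℝ => (η * R₁, η * R₂)) (𝓝[<] 1) (𝓝 (1 * R₁, 1 * R₂)) :=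
    (Continuous.tendsto (by fun_prop) (1 : ℝ)).mono_left nhdsWithin_le_nhds
  rw [one_mul, one_mul] at hlim
  refine (isClosed_approachableRates G _ c₁ c₂).mem_of_tendsto hlim ?_
  filter_upwards [Ioo_mem_nhdsLT (zero_lt_one' ℝ)] with η hη using key η hη.1 hη.2

theorem exists_average_of_mem_convexHull {T : ℝ → ℝ → Set (ℝ × ℝ)} {R : ℝ × ℝ}
    (hR : R ∈ convexHull ℝ (⋃ p₁ ∈ Set.Icc 0 c₁, ⋃ p₂ ∈ Set.Icc 0 c₂, T p₁ p₂)) :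
    ∃ (K : Type) (_ : Fintype K) (w : K → ℝ) (p q : K → ℝ≥0) (S : K → ℝ × ℝ),
      (∀ k, 0 ≤ w k) ∧ ∑ k, w k = 1 ∧ (∀ k, p k ≤ c₁.toNNReal) ∧ (∀ k, q k ≤ c₂.toNNReal) ∧
      (∀ k, S k ∈ T (p k) (q k)) ∧ R.1 = ∑ k, w k * (S k).1 ∧ R.2 = ∑ k, w k * (S k).2 := by
  obtain ⟨K, _, w, S, hw, hw1, hS, rfl⟩ := mem_convexHull_iff_exists_fintype.1 hR
  simp only [Set.mem_iUnion, exists_prop] at hS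
  choose p hp q hq hS using hS
  refine ⟨K, inferInstance, w, fun k => (p k).toNNReal, fun k => (q k).toNNReal, S, hw, hw1,
    fun k => Real.toNNReal_le_toNNReal (hp k).2, fun k => Real.toNNReal_le_toNNReal (hq k).2,
    fun k => ?_, by simp [Prod.fst_sum], by simp [Prod.snd_sum]⟩
  rw [Real.coe_toNNReal _ (hp k).1, Real.coe_toNNReal _ (hq k).1]
  exact hS k

/-- A negative power limit makes the union empty, so a point of the closed hull certifies
nonnegative limits. -/
theorem nonneg_of_mem_closure_convexHull {T : ℝ → ℝ → Set (ℝ × ℝ)} {R : ℝ × ℝ}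
    (hR : R ∈ closure (convexHull ℝ (⋃ p₁ ∈ Set.Icc 0 c₁, ⋃ p₂ ∈ Set.Icc 0 c₂, T p₁ p₂))) :
    0 ≤ c₁ ∧ 0 ≤ c₂ := by
  obtain ⟨S, hS⟩ := convexHull_nonempty_iff.1 (closure_nonempty_iff.1 ⟨R, hR⟩)
  simp only [Set.mem_iUnion, exists_prop] at hS
  obtain ⟨p, hp, q, hq, -⟩ := hS
  exact ⟨hp.1.trans hp.2, hq.1.trans hq.2⟩

theorem average_le {K : Type*} [Fintype K] {w f g : K → ℝ} (hw : ∀ k, 0 ≤ w k)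
    (h : ∀ k, f k ≤ g k) : ∑ k, w k * f k ≤ ∑ k, w k * g k :=
  Finset.sum_le_sum fun k _ => mul_le_mul_of_nonneg_left (h k) (hw k)

end InnerBound

end

theorem theorem5 (G : GaussianTWWC) (c₁ c₂ : ℝ) :
    G.innerJoint c₁ c₂ ⊆ G.capacityJoint c₁ c₂ ∧
      G.innerIndividual c₁ c₂ ⊆ G.capacityIndividual c₁ c₂ := by
  constructor
  · intro R hR
    obtain ⟨hc₁, hc₂⟩ := nonneg_of_mem_closure_convexHull hR
    refine approachableRates_subset_capacityJoint G hc₁ hc₂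
      -- Since the approachable set is closed, only points of the convex hull itself have to be
      -- treated.
      (closure_minimal (fun R hR => ?_) (isClosed_approachableRates G _ c₁ c₂) hR)
    obtain ⟨K, _, w, p, q, S, hw, hw1, hp, hq, hS, h₁, h₂⟩ := exists_average_of_mem_convexHull hR
    refine mem_approachableRates_joint_of_average G hc₁ hc₂ hw hw1 hp hq ?_ ?_ ?_ ?_ ?_
    · rw [h₁]; exact Finset.sum_nonneg fun k _ => mul_nonneg (hw k) (hS k).1
    · rw [h₂]; exact Finset.sum_nonneg fun k _ => mul_nonneg (hw k) (hS k).2.1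
    · rw [h₁]; exact average_le hw fun k => (hS k).2.2.1
    · rw [h₂]; exact average_le hw fun k => (hS k).2.2.2.1
    · rw [h₁, h₂, ← Finset.sum_add_distrib]
      simp only [← mul_add]
      exact average_le hw fun k => (hS k).2.2.2.2
  · intro R hR
    obtain ⟨hc₁, hc₂⟩ := nonneg_of_mem_closure_convexHull hR
    refine approachableRates_subset_capacityIndividual G hc₁ hc₂
      (closure_minimal (fun R hR => ?_) (isClosed_approachableRates G _ c₁ c₂) hR)
    obtain ⟨K, _, w, p, q, S, hw, hw1, hp, hq, hS, h₁, h₂⟩ := exists_average_of_mem_convexHull hR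
    refine mem_approachableRates_individual_of_average G hc₁ hc₂ hw hw1 hp hq ?_ ?_ ?_ ?_ ?_
    · rw [h₁]; exact Finset.sum_nonneg fun k _ => mul_nonneg (hw k) (hS k).1
    · rw [h₂]; exact Finset.sum_nonneg fun k _ => mul_nonneg (hw k) (hS k).2.1
    · rw [h₁]; exact average_le hw fun k => (hS k).2.2.1
    · rw [h₂]; exact average_le hw fun k => (hS k).2.2.2.1
    · rw [h₁, h₂]
      exact max_le (average_le hw fun k => (le_max_left _ _).trans (hS k).2.2.2.2)
        (average_le hw fun k => (le_max_right _ _).trans (hS k).2.2.2.2)
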